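/- **Setting.** Consider caching with a cache of $k\ge 2$ pages: a request sequence $r_1,\dots,r_T$ is revealed online, after each request the requested page has to be in the cache, and the cost is the number of page loads (each load evicts a page). The algorithm and Belady's offline algorithm start with the same $k$ pages. Belady's algorithm changes its cache only at a page fault, where it evicts a page of its cache whose next request is furthest in the future, with ties between pages that are never requested again broken arbitrarily; let $B_t$ be its cache content after $r_t$ and $\mathrm{OPT}$ its number of page faults. A predictor has, for each time $t$, a predicted cache content $P_t$ (an arbitrary set of $k$ pages), whose error is $\eta_t=|B_t\setminus P_t|$. At any moment of time step $t$ the algorithm may query the predictor for some number $n$ of pages; the predictor reports $n$ pages of the algorithm's current cache that are not in $P_t$ (all such pages, if there are fewer than $n$), and the choice among them is arbitrary. The total prediction error $\eta$ of an execution is the sum of $\eta_t$ over the time steps $t$ in which the predictor is queried. The algorithm may be randomized; the request sequence, Belady's tie-breaking and the predictor are fixed in advance. **Theorem.** There is an absolute constant $C$ such that the following holds for every $k\ge 2$ and every strictly increasing convex function $f:[0,\infty)\to\mathbb{R}$ with $f(0)=0$ and $f(i)\le 2^i-1$ for all integers $i\ge 0$. There is a randomized online caching algorithm such that for every initial cache,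 every request sequence, every run of Belady's algorithm and every predictor: 1. (number of predictions) both the number of queries and the total number of pages reported by the predictor are always at most $C\,(1+f(\log_2 k))\cdot\mathrm{OPT}$; 2. ($1$-consistency) if the expected total error of the queried predictions is $0$, the expected cost is at most $\mathrm{OPT}$; 3. ($O(\log k)$-robustness) the expected cost is at most $C\log_2 k\cdot\mathrm{OPT}$, whatever the predictions are; 4. (smoothness) if the expected total error of the queried predictions is at most $\eta$, the expected cost is at most $C\,\bigl(1+f^{-1}(\eta/\mathrm{OPT})\bigr)\cdot\mathrm{OPT}$ (and the expected cost is $0$ if $\mathrm{OPT}=0$). -/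

import Mathlib

open scoped ENNReal NNReal

universe u

namespace Caching

/-!
Time convention: the requests are `r 0, …, r (T - 1)`. Serving `r t` leads from the state with
index `t` to the state with index `t + 1`; states with index `0` are initial states.
A state is the set of pages in the cache.
-/

section Belady

variable {Page : Type u} [DecidableEq Page]

/-- Among the pages of `A`, the page `q` is requested furthest in the future after the request
`r t`: before or at any later request to `q`, every page of `A` is requested. In particular every
page of `A` that is never requested again qualifies. -/
def FurthestInFuture (r : ℕ → Page) (T t : ℕ) (A : Finset Page) (q : Page) : Prop :=
  q ∈ A ∧ ∀ p ∈ A, ∀ s, t < s → s < T → r s = q → ∃ s', t < s' ∧ s' ≤ s ∧ r s' = p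

/-- `B 0, …, B T` are the cache contents of Belady's algorithm on the requests
`r 0, …, r (T - 1)` with initial cache `A₀`, for some way of breaking ties. -/
structure IsBeladyRun (r : ℕ → Page) (T : ℕ) (A₀ : Finset Page) (B : ℕ → Finset Page) :
    Prop where
  init : B 0 = A₀
  hit : ∀ t < T, r t ∈ B t → B (t + 1) = B t
  fault : ∀ t < T, r t ∉ B t →
    ∃ q, FurthestInFuture r T t (B t) q ∧ B (t + 1) = insert (r t) ((B t).erase q)

/-- The number of page faults of a sequence of cache contents `B`. -/
def faults (r : ℕ → Page) (T : ℕ) (B : ℕ → Finset Page) : ℕ :=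
  ((Finset.range T).filter fun t => r t ∉ B t).card

end Belady

/-- An action predictor for caches of size `k`: `state t` is the predicted cache content with
index `t`. A query made with cache content `A` for `n` pages is answered by `n` pages which are in
`A` but not in the predicted cache (by all such pages, if there are fewer than `n`); which of them
are reported is up to the predictor. -/
structure Predictor (Page : Type u) [DecidableEq Page] (k : ℕ) where
  state : ℕ → Finset Page
  card_state : ∀ t, (state t).card = k
  report : ℕ → Finset Page → ℕ → Finset Page
  report_subset : ∀ t A n, report t A n ⊆ A \ state t
  card_report : ∀ t A n, (report t A n).card = min n (A \ state t).card

/-- What an algorithm does in one time step: a finite interactive program. -/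
inductive Prog (Page : Type u) (Mem : Type u) : Type u
  /-- Finish the time step, keeping the memory `m`. -/
  | done (m : Mem) : Prog Page Mem
  /-- Load the page `p` in place of the page `q`. -/
  | swap (p q : Page) (next : Prog Page Mem) : Prog Page Mem
  /-- Ask the predictor for `n` pages of the own cache that are absent from the predicted cache,
  and continue depending on the reported pages. -/
  | query (n : ℕ) (next : Finset Page → Prog Page Mem) : Prog Page Mem
  /-- Draw a uniformly random element of `{0, …, n}`, and continue depending on it. -/
  | toss (n : ℕ) (next : Fin (n + 1) → Prog Page Mem) : Prog Page Mem

/-- A randomized online caching algorithm with access to a predictor. It learns the initial cache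
content, then the requests one by one, and about the predictions only the answers to its
queries. -/
structure OnlineAlgorithm (Page : Type u) where
  Mem : Type u
  init : Finset Page → Mem
  step : Mem → Page → Prog Page Mem

/-- The cache content and the bookkeeping of an execution. -/
structure Config (Page : Type u) where
  cache : Finset Page
  /-- number of pages loaded so far -/
  cost : ℕ
  /-- number of queries so far -/
  queries : ℕ
  /-- total number of pages reported by the predictor so far -/
  indices : ℕ
  /-- indices of the predictions that were queried so far -/
  queryTimes : Finset ℕ
  /-- number of requests so far that were not in the cache at the end of their time step -/
  unserved : ℕ

noncomputable section Execution

variable {Page : Type u} [DecidableEq Page] {k : ℕ}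

/-- Execute a program during the time step that leads to the state with index `t`. A swap is
carried out only if its first page is outside and its second page inside the cache. -/
def exec {Mem : Type u} (pred : Predictor Page k) (t : ℕ) :
    Prog Page Mem → Config Page → PMF (Mem × Config Page)
  | .done m, c => PMF.pure (m, c)
  | .swap p q next, c =>
      exec pred t next
        (if p ∉ c.cache ∧ q ∈ c.cache then
          { c with cache := insert p (c.cache.erase q), cost := c.cost + 1 }
        else c)
  | .query n next, c =>
      exec pred t (next (pred.report t c.cache n))
        { c with
          queries := c.queries + 1
          indices := c.indices + (pred.report t c.cache n).card
          queryTimes := insert t c.queryTimes }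
  | .toss n next, c =>
      (PMF.uniformOfFintype (Fin (n + 1))).bind fun i => exec pred t (next i) c

/-- Joint distribution of the memory and the configuration after the first `t` requests. -/
def OnlineAlgorithm.run (alg : OnlineAlgorithm Page) (pred : Predictor Page k)
    (A₀ : Finset Page) (r : ℕ → Page) : ℕ → PMF (alg.Mem × Config Page)
  | 0 => PMF.pure (alg.init A₀, ⟨A₀, 0, 0, 0, ∅, 0⟩)
  | t + 1 => (OnlineAlgorithm.run alg pred A₀ r t).bind fun x =>
      (exec pred (t + 1) (alg.step x.1 (r t)) x.2).map fun y =>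
        (y.1, { y.2 with unserved := y.2.unserved + if r t ∈ y.2.cache then 0 else 1 })

/-- Distribution of the configuration after the first `T` requests. -/
def OnlineAlgorithm.outcome (alg : OnlineAlgorithm Page) (pred : Predictor Page k)
    (A₀ : Finset Page) (r : ℕ → Page) (T : ℕ) : PMF (Config Page) :=
  (alg.run pred A₀ r T).map Prod.snd

/-- Expectation of a natural-number-valued quantity. -/
def expect {α : Type u} (μ : PMF α) (X : α → ℕ) : ℝ≥0∞ :=
  ∑' a, μ a * (X a : ℝ≥0∞)

/-- Total error, with respect to the states `B`, of the predictions that were queried. The error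
of a single prediction is the number of pages in `B t` absent from the predicted cache. -/
def receivedError (pred : Predictor Page k) (B : ℕ → Finset Page) (c : Config Page) : ℕ :=
  ∑ t ∈ c.queryTimes, (B t \ pred.state t).card

end Execution

end Caching

/-!
Every run of Belady's algorithm has the fewest faults on each prefix of the requests, so the times
of its faults can be computed online. The algorithm organizes the requests in marking phases. It
evicts lazily, at its own faults: usually a random one of the pages that the predictor reported as
absent from Belady's cache, and otherwise a random unmarked page. A window is a range of constant
`⌊f (log₂ m)⌋`, where `m` pages of the phase remain to be marked. The predictor is queried at the
start of each window, for as many pages as the two caches may differ in, namely twice the number of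
Belady's faults in the previous phase plus their number in the current one. Queries within a window
are charged to Belady's faults since the last query.

The cost is bounded with a potential on the *slots*, the first requests in a phase to pages that
Belady's algorithm holds. With `m` pages remaining, a random eviction hits the page of a slot with
probability `O(1 / m)` per page by which the caches differ, and the number of these pages is bounded
both by the faults of Belady's algorithm in two phases and, when evicting candidates at random does
not reduce it, by the error of the window's queries. The first bound for `m < 2 ^ a` gives `O(a)`
times Belady's faults in total. The second bound for `m ≥ 2 ^ a` gives the error times the sum of
`1 / m` over one window, which is at most `3 * a / f a` because `f` is convex. Robustness is the
case in which the first bound is used for all `m`, and `a` with `f a = η / OPT` yields smoothness.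
-/

namespace Caching

/-! ### Belady's algorithm -/

section Belady

variable {Page : Type u} [DecidableEq Page] {r : ℕ → Page} {T t x : ℕ} {A₀ : Finset Page}
  {B S : ℕ → Finset Page}

/-- Cache contents that change only at faults, where some page makes room for the request: the
class of offline algorithms among which Belady's algorithm is compared. -/
structure IsLazyRun (r : ℕ → Page) (T : ℕ) (A₀ : Finset Page) (S : ℕ → Finset Page) : Prop where
  init : S 0 = A₀
  hit : ∀ t < T, r t ∈ S t → S (t + 1) = S t
  fault : ∀ t < T, r t ∉ S t → ∃ q ∈ S t, S (t + 1) = insert (r t) ((S t).erase q)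

theorem IsBeladyRun.isLazyRun (h : IsBeladyRun r T A₀ B) : IsLazyRun r T A₀ B where
  init := h.init
  hit := h.hit
  fault t ht hr := let ⟨q, hq, hB⟩ := h.fault t ht hr; ⟨q, hq.1, hB⟩

theorem faults_succ (r : ℕ → Page) (t : ℕ) (S : ℕ → Finset Page) :
    faults r (t + 1) S = faults r t S + (decide (r t ∉ S t)).toNat := by
  simp only [faults, Finset.range_add_one, Finset.filter_insert]
  split_ifs with h <;> simp [h]

theorem card_insert_erase {A : Finset Page} {p q : Page} (hp : p ∉ A) (hq : q ∈ A) :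
    (insert p (A.erase q)).card = A.card := by
  rw [Finset.card_insert_of_notMem (mt Finset.mem_of_mem_erase hp), Finset.card_erase_add_one hq]

namespace IsLazyRun

theorem card_eq (h : IsLazyRun r T A₀ S) : ∀ t ≤ T, (S t).card = A₀.card
  | 0, _ => by rw [h.init]
  | t + 1, ht => by
    by_cases hr : r t ∈ S t
    · rw [h.hit t ht hr, h.card_eq t (by lia)]
    · obtain ⟨q, hq, hS⟩ := h.fault t ht hr
      rw [hS, card_insert_erase hr hq, h.card_eq t (by lia)]

theorem mem_succ (h : IsLazyRun r T A₀ S) (ht : t < T) : r t ∈ S (t + 1) := by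
  by_cases hr : r t ∈ S t
  · rwa [h.hit t ht hr]
  · obtain ⟨q, -, hS⟩ := h.fault t ht hr
    exact hS ▸ Finset.mem_insert_self _ _

theorem succ_subset (h : IsLazyRun r T A₀ S) (ht : t < T) : S (t + 1) ⊆ insert (r t) (S t) := by
  by_cases hr : r t ∈ S t
  · exact (h.hit t ht hr).trans_subset (Finset.subset_insert _ _)
  · obtain ⟨q, -, hS⟩ := h.fault t ht hr
    exact hS.trans_subset (Finset.insert_subset_insert _ (Finset.erase_subset _ _))

theorem card_sdiff_succ_le (h : IsLazyRun r T A₀ S) (ht : t < T) :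
    (S t \ S (t + 1)).card ≤ (decide (r t ∉ S t)).toNat := by
  by_cases hr : r t ∈ S t
  · simp [h.hit t ht hr]
  · obtain ⟨q, -, hS⟩ := h.fault t ht hr
    have hsub : S t \ S (t + 1) ⊆ {q} := by grind
    simpa [hr] using Finset.card_le_card hsub

end IsLazyRun

section Exchange

variable {A Q : Finset Page} {p q : Page}

theorem card_inter_insert_of_mem (hp : p ∈ A) :
    (A ∩ insert p Q).card + (if p ∈ Q then 1 else 0) = (A ∩ Q).card + 1 := by
  rw [Finset.inter_insert_of_mem hp]
  split_ifs with hQ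
  · rw [Finset.insert_eq_self.2 (Finset.mem_inter.2 ⟨hp, hQ⟩)]
  · rw [Finset.card_insert_of_notMem (by simp [hQ])]

theorem card_insert_erase_inter (hp : p ∉ A) (hq : q ∈ A) :
    (insert p (A.erase q) ∩ Q).card + (if q ∈ Q then 1 else 0) =
      (A ∩ insert p Q).card + (if p ∈ Q then 1 else 0) := by
  have herase : (A.erase q ∩ Q).card + (if q ∈ Q then 1 else 0) = (A ∩ Q).card := by
    rw [Finset.erase_inter]
    split_ifs with hQ
    · exact Finset.card_erase_add_one (Finset.mem_inter.2 ⟨hq, hQ⟩)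
    · rw [Finset.erase_eq_of_notMem (by simp [hQ]), add_zero]
  have hinsert : (insert p (A.erase q) ∩ Q).card =
      (A.erase q ∩ Q).card + (if p ∈ Q then 1 else 0) := by
    split_ifs with hQ
    · rw [Finset.insert_inter_of_mem hQ, Finset.card_insert_of_notMem (by simp [hp])]
    · rw [Finset.insert_inter_of_notMem hQ, add_zero]
  rw [Finset.inter_insert_of_notMem hp]
  lia

theorem card_inter_add_one_le (hp : p ∈ A) :
    (A ∩ Q).card + 1 ≤ A.card + (if p ∈ Q then 1 else 0) := by
  rw [← card_inter_insert_of_mem hp]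
  exact Nat.add_le_add_right (Finset.card_le_card Finset.inter_subset_left) _

end Exchange

/-- The pages requested in the time interval `[t, x)`. -/
def requestedIn (r : ℕ → Page) (t x : ℕ) : Finset Page :=
  (Finset.Ico t x).image r

theorem requestedIn_eq_insert (r : ℕ → Page) (htx : t < x) :
    requestedIn r t x = insert (r t) (requestedIn r (t + 1) x) := by
  rw [requestedIn, ← Finset.insert_Ico_succ_left_eq_Ico htx, Finset.image_insert, requestedIn,
    Nat.succ_eq_succ, Nat.succ_eq_add_one]

theorem IsLazyRun.faults_add_card_inter_le (h : IsLazyRun r T A₀ S) (htx : t < x) (ht : t < T) :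
    faults r t S + (S (t + 1) ∩ requestedIn r (t + 1) x).card + 1 ≤
      faults r (t + 1) S + (S t ∩ requestedIn r t x).card +
        (if r t ∈ requestedIn r (t + 1) x then 1 else 0) := by
  rw [faults_succ, requestedIn_eq_insert r htx]
  by_cases hr : r t ∈ S t
  · have := card_inter_insert_of_mem (Q := requestedIn r (t + 1) x) hr
    rw [h.hit t ht hr]
    lia
  · obtain ⟨q, hq, hS⟩ := h.fault t ht hr
    have := card_insert_erase_inter (Q := requestedIn r (t + 1) x) hr hq
    simp only [hS, hr, not_false_eq_true, decide_true, Bool.toNat_true]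
    lia

/-- If Belady's algorithm evicts a page that is requested before time `x`, then all its pages
are. -/
theorem IsBeladyRun.card_inter_requestedIn (h : IsBeladyRun r T A₀ B) (htx : t < x) (hx : x ≤ T) :
    faults r (t + 1) B + (B t ∩ requestedIn r t x).card +
        (if r t ∈ requestedIn r (t + 1) x then 1 else 0) =
      faults r t B + (B (t + 1) ∩ requestedIn r (t + 1) x).card + 1 ∨
    (B (t + 1) ∩ requestedIn r (t + 1) x).card + 1 =
      A₀.card + (if r t ∈ requestedIn r (t + 1) x then 1 else 0) := by
  have ht : t < T := by lia
  rw [faults_succ, requestedIn_eq_insert r htx]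
  by_cases hr : r t ∈ B t
  · have := card_inter_insert_of_mem (Q := requestedIn r (t + 1) x) hr
    left
    simp only [h.hit t ht hr, hr, not_true_eq_false, decide_false, Bool.toNat_false]
    lia
  obtain ⟨q, hq, hB⟩ := h.fault t ht hr
  have hcard := card_insert_erase_inter (Q := requestedIn r (t + 1) x) hr hq.1
  rw [← hB] at hcard
  by_cases hqx : q ∈ requestedIn r (t + 1) x
  · right
    have hsub : B t ⊆ insert (r t) (requestedIn r (t + 1) x) := by
      intro p hp
      obtain ⟨s, hs, rfl⟩ := Finset.mem_image.1 hqx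
      obtain ⟨hts, hsx⟩ := Finset.mem_Ico.1 hs
      obtain ⟨s', hts', hs', rfl⟩ := hq.2 p hp s hts (by lia) rfl
      exact Finset.mem_insert_of_mem
        (Finset.mem_image_of_mem r (Finset.mem_Ico.2 ⟨hts', by lia⟩))
    rw [Finset.inter_eq_left.2 hsub, h.isLazyRun.card_eq t ht.le, if_pos hqx] at hcard
    exact hcard
  · left
    simp only [hr, not_false_eq_true, decide_true, Bool.toNat_true]
    rw [if_neg hqx] at hcard
    lia

/-- Belady's algorithm is never behind: its lead in faults makes up for every advantage another
algorithm has in the pages requested next. -/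
theorem IsBeladyRun.faults_add_card_le (hB : IsBeladyRun r T A₀ B) (hS : IsLazyRun r T A₀ S)
    (htx : t ≤ x) (hx : x ≤ T) :
    faults r t B + (S t ∩ requestedIn r t x).card ≤
      faults r t S + (B t ∩ requestedIn r t x).card := by
  induction t generalizing x with
  | zero => simp [faults, hB.init, hS.init]
  | succ t ih =>
    have hfaults : faults r (t + 1) B ≤ faults r (t + 1) S := by
      have := ih (x := t + 1) (by lia) (by lia)
      have hself : requestedIn r t (t + 1) = {r t} := by simp [requestedIn]
      rw [faults_succ, faults_succ]
      by_cases hb : r t ∈ B t <;> by_cases hs : r t ∈ S t <;>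
        simp_all [Finset.inter_singleton_of_mem, Finset.inter_singleton_of_notMem]
    have hother := hS.faults_add_card_inter_le (x := x) (by lia) (Nat.lt_of_succ_le (htx.trans hx))
    rcases hB.card_inter_requestedIn (t := t) (by lia) hx with hstep | hfull
    · have := ih (x := x) (by lia) hx
      lia
    · have := card_inter_add_one_le (Q := requestedIn r (t + 1) x) (hS.mem_succ (t := t) (by lia))
      rw [hS.card_eq (t + 1) (htx.trans hx)] at this
      lia

theorem IsBeladyRun.faults_le (hB : IsBeladyRun r T A₀ B) (hS : IsLazyRun r T A₀ S) (ht : t ≤ T) :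
    faults r t B ≤ faults r t S := by
  simpa [requestedIn] using hB.faults_add_card_le hS le_rfl ht

theorem IsBeladyRun.mono {T' : ℕ} (h : IsBeladyRun r T A₀ B) (hT : T' ≤ T) :
    IsBeladyRun r T' A₀ B where
  init := h.init
  hit t ht := h.hit t (by lia)
  fault t ht hr := by
    obtain ⟨q, hq, hB⟩ := h.fault t (by lia) hr
    exact ⟨q, ⟨hq.1, fun p hp s hts hsT => hq.2 p hp s hts (by lia)⟩, hB⟩

theorem IsBeladyRun.congr {r' : ℕ → Page} (h : IsBeladyRun r T A₀ B) (hr : ∀ t < T, r' t = r t) :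
    IsBeladyRun r' T A₀ B where
  init := h.init
  hit t ht hmem := h.hit t ht (hr t ht ▸ hmem)
  fault t ht hmem := by
    rw [hr t ht] at hmem ⊢
    obtain ⟨q, hq, hB⟩ := h.fault t ht hmem
    refine ⟨q, ⟨hq.1, fun p hp s hts hsT hs => ?_⟩, hB⟩
    obtain ⟨s', hts', hs', hp'⟩ := hq.2 p hp s hts hsT (hr s hsT ▸ hs)
    exact ⟨s', hts', hs', by rw [hr s' (by lia), hp']⟩

theorem IsBeladyRun.notMem_iff {B' : ℕ → Finset Page} (h : IsBeladyRun r (t + 1) A₀ B)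
    (h' : IsBeladyRun r (t + 1) A₀ B') : r t ∉ B t ↔ r t ∉ B' t := by
  have heq {n : ℕ} (hn : n ≤ t + 1) : faults r n B = faults r n B' :=
    (h.faults_le h'.isLazyRun hn).antisymm (h'.faults_le h.isLazyRun hn)
  have hsucc := heq le_rfl
  rw [faults_succ, faults_succ, heq t.le_succ, Nat.add_left_cancel_iff] at hsucc
  by_cases r t ∈ B t <;> by_cases r t ∈ B' t <;> simp_all

open Classical in
/-- Whether Belady's algorithm, started with `A₀`, faults at the request `p` that follows the
requests `hist`. An online algorithm can compute this, since the answer depends neither on the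
future nor on the tie-breaking. -/
noncomputable def beladyFaults (A₀ : Finset Page) (hist : List Page) (p : Page) : Bool :=
  decide (∃ B, IsBeladyRun (fun i => hist.getD i p) (hist.length + 1) A₀ B ∧ p ∉ B hist.length)

theorem beladyFaults_eq (h : IsBeladyRun r T A₀ B) (ht : t < T) :
    beladyFaults A₀ ((List.range t).map r) (r t) = decide (r t ∉ B t) := by
  have hr : ∀ i < t + 1, ((List.range t).map r).getD i (r t) = r i := by
    intro i hi
    rcases Nat.lt_succ_iff_lt_or_eq.1 hi with hi | rfl <;> simp [List.getD, *]
  have hB := h.mono (T' := t + 1) ht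
  simp only [beladyFaults, decide_eq_decide, List.length_map, List.length_range]
  constructor
  · rintro ⟨B', hB', hmem⟩
    exact (hB.notMem_iff (hB'.congr fun i hi => (hr i hi).symm)).2 hmem
  · exact fun hmem => ⟨B, hB.congr hr, hmem⟩

end Belady

/-- The sum of `1 / m` over the numbers `m < μ` in `{1, …, k}`. -/
noncomputable def lowSum (k μ : ℕ) : ℝ :=
  ∑ m ∈ (Finset.Icc 1 k).filter (fun m => m < μ), (1 / m : ℝ)

/-- The sum of `1 / m` over the numbers `m ≥ μ` of level `n` in `{1, …, k}`. -/
noncomputable def levelSum (k : ℕ) (level : ℕ → ℕ) (μ n : ℕ) : ℝ :=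
  ∑ m ∈ (Finset.Icc 1 k).filter (fun m => μ ≤ m ∧ level m = n), (1 / m : ℝ)

theorem levelSum_nonneg (k : ℕ) (level : ℕ → ℕ) (μ n : ℕ) : 0 ≤ levelSum k level μ n :=
  Finset.sum_nonneg fun _ _ => by positivity

/-! ### Phases, windows and slots -/

section Phases

variable {Page : Type u} [DecidableEq Page]

/-- Bookkeeping of the marking phases. A phase ends when `k` pages are marked and an unmarked page
is requested. Phases are subdivided into windows. -/
structure Phase (Page : Type u) where
  /-- pages requested in the current phase -/
  marked : Finset Page
  /-- number of Belady's faults in the previous phase -/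
  prevFaults : ℕ
  /-- number of Belady's faults in the current phase so far -/
  curFaults : ℕ
  /-- number of the current phase -/
  idx : ℕ
  /-- number of the current window -/
  windowIdx : ℕ

namespace Phase

variable (k : ℕ) (level : ℕ → ℕ) (φ : Phase Page) (p : Page)

/-- The request `p` starts a new phase. -/
def Starts : Prop := p ∉ φ.marked ∧ φ.marked.card = k

instance : Decidable (φ.Starts k p) := inferInstanceAs (Decidable (_ ∧ _))

/-- The marked pages after the request `p`. -/
def mark : Finset Page := if φ.Starts k p then {p} else insert p φ.marked

/-- The request `p` starts a new window: it is the first request of a phase, or the level of the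
number of pages that remain to be marked drops. -/
def StartsWindow : Prop :=
  p ∉ φ.marked ∧ ((φ.mark k p).card = 1 ∨
    level (k + 1 - (φ.mark k p).card) < level (k + 2 - (φ.mark k p).card))

instance : Decidable (φ.StartsWindow k level p) := inferInstanceAs (Decidable (_ ∧ _))

/-- The bookkeeping after the request `p`, at which Belady's algorithm faults if `fault`. -/
def next (fault : Bool) : Phase Page where
  marked := φ.mark k p
  prevFaults := if φ.Starts k p then φ.curFaults else φ.prevFaults
  curFaults := (if φ.Starts k p then 0 else φ.curFaults) + fault.toNat
  idx := if φ.Starts k p then φ.idx + 1 else φ.idx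
  windowIdx := if φ.StartsWindow k level p then φ.windowIdx + 1 else φ.windowIdx

end Phase

/-- A request sequence with a run of Belady's algorithm and a predictor, together with the levels
that determine the windows. -/
structure Scenario (Page : Type u) [DecidableEq Page] where
  k : ℕ
  level : ℕ → ℕ
  r : ℕ → Page
  T : ℕ
  A₀ : Finset Page
  B : ℕ → Finset Page
  pred : Predictor Page k
  k_pos : 0 < k
  card_init : A₀.card = k
  belady : IsBeladyRun r T A₀ B
  level_mono : Monotone level

namespace Scenario

section Defs

variable (X : Scenario Page)

/-- Belady's algorithm faults at request `t`. -/
def fault (t : ℕ) : Bool := decide (X.r t ∉ X.B t)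

/-- Number of Belady's faults. -/
def opt : ℕ := faults X.r X.T X.B

/-- Error of the prediction with index `t`. -/
def predError (t : ℕ) : ℕ := (X.B t \ X.pred.state t).card

/-- The phase bookkeeping after `t` requests. -/
def phase : ℕ → Phase Page
  | 0 => ⟨∅, 0, 0, 0, 0⟩
  | t + 1 => (phase t).next X.k X.level (X.r t) (X.fault t)

/-- Marked pages after `t` requests. -/
def marked (t : ℕ) : Finset Page := (X.phase t).marked

/-- Request `t` starts a phase. -/
def Starts (t : ℕ) : Prop := (X.phase t).Starts X.k (X.r t)

instance (t : ℕ) : Decidable (X.Starts t) := inferInstanceAs (Decidable (Phase.Starts _ _ _))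

/-- Request `t` starts a window. -/
def StartsWindow (t : ℕ) : Prop := (X.phase t).StartsWindow X.k X.level (X.r t)

instance (t : ℕ) : Decidable (X.StartsWindow t) :=
  inferInstanceAs (Decidable (Phase.StartsWindow _ _ _ _))

/-- The phase of request `s`. -/
def phaseIdx (s : ℕ) : ℕ := (X.phase (s + 1)).idx

/-- The window of request `s`. -/
def windowIdx (s : ℕ) : ℕ := (X.phase (s + 1)).windowIdx

/-- Number of pages that remained to be marked in the phase just before the request `s`, if this
request marks a page. -/
def remaining (s : ℕ) : ℕ := X.k + 1 - (X.marked (s + 1)).card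

/-- Upper bound, known at time `t`, on the number of pages by which the caches differ. -/
def quota (t : ℕ) : ℕ := 2 * (X.phase (t + 1)).prevFaults + (X.phase (t + 1)).curFaults

/-- At request `t` a window starts, and the predictor is queried for this reason. -/
def Sync (t : ℕ) : Prop := X.StartsWindow t ∧ 0 < X.quota t

instance (t : ℕ) : Decidable (X.Sync t) := inferInstanceAs (Decidable (_ ∧ _))

/-- Belady's pages just before request `s` that have not been requested in the phase. -/
def fresh (s : ℕ) : Finset Page := X.B s \ (if X.Starts s then ∅ else X.marked s)

/-- Requests from time `t` on that are the first ones to their page in the phase and that are not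
faults of Belady's algorithm. -/
def slots (t : ℕ) : Finset ℕ := (Finset.Ico t X.T).filter fun s => X.r s ∈ X.fresh s

/-- Total quota of a phase. -/
def phaseQuota (i : ℕ) : ℕ :=
  2 * ((Finset.range X.T).filter fun τ => X.fault τ ∧ X.phaseIdx τ + 1 = i).card +
    ((Finset.range X.T).filter fun τ => X.fault τ ∧ X.phaseIdx τ = i).card

/-- Request `s` comes so late in its phase that the pages by which the caches differ may make up
more than half of the remaining ones. -/
def IsLate (s : ℕ) : Prop := X.remaining s < 2 * X.phaseQuota (X.phaseIdx s)

instance (s : ℕ) : Decidable (X.IsLate s) := inferInstanceAs (Decidable (_ < _))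

/-- Error of the query made at the start of a window. -/
def windowErr (v : ℕ) : ℕ :=
  ∑ τ ∈ (Finset.range X.T).filter (fun τ => X.Sync τ ∧ X.windowIdx τ = v), X.predError (τ + 1)

/-- Total error of the queries made at the starts of the windows. -/
def syncErr : ℕ := ∑ τ ∈ (Finset.range X.T).filter X.Sync, X.predError (τ + 1)

/-- The potential set aside for a slot of a future phase. -/
noncomputable def reserve (μ s : ℕ) : ℝ :=
  if X.IsLate s then 1
  else if X.remaining s < μ then 2 / X.remaining s * X.phaseQuota (X.phaseIdx s)
  else 2 / X.remaining s * (6 * X.windowErr (X.windowIdx s))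

end Defs

variable {X : Scenario Page} {s t u : ℕ}

theorem lazyRun (X : Scenario Page) : IsLazyRun X.r X.T X.A₀ X.B := X.belady.isLazyRun

theorem card_B (ht : t ≤ X.T) : (X.B t).card = X.k := by
  rw [X.lazyRun.card_eq t ht, X.card_init]

theorem opt_eq (X : Scenario Page) :
    X.opt = ((Finset.range X.T).filter fun τ => X.fault τ).card := by
  simp only [opt, faults, fault, decide_eq_true_eq]

theorem mem_slots : s ∈ X.slots t ↔ (t ≤ s ∧ s < X.T) ∧ X.r s ∈ X.fresh s := by
  rw [slots, Finset.mem_filter, Finset.mem_Ico]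

theorem reserve_nonneg (μ s : ℕ) : 0 ≤ X.reserve μ s := by
  unfold reserve
  split_ifs <;> positivity

theorem phase_idx_succ (t : ℕ) :
    (X.phase (t + 1)).idx = if X.Starts t then (X.phase t).idx + 1 else (X.phase t).idx := rfl

theorem phase_windowIdx_succ (t : ℕ) : (X.phase (t + 1)).windowIdx =
    if X.StartsWindow t then (X.phase t).windowIdx + 1 else (X.phase t).windowIdx := rfl

theorem phase_prevFaults_succ (t : ℕ) : (X.phase (t + 1)).prevFaults =
    if X.Starts t then (X.phase t).curFaults else (X.phase t).prevFaults := rfl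

theorem phase_curFaults_succ (t : ℕ) : (X.phase (t + 1)).curFaults =
    (if X.Starts t then 0 else (X.phase t).curFaults) + (X.fault t).toNat := rfl

theorem marked_succ_of_starts (h : X.Starts t) : X.marked (t + 1) = {X.r t} := if_pos h

theorem marked_succ_of_not_starts (h : ¬X.Starts t) :
    X.marked (t + 1) = insert (X.r t) (X.marked t) := if_neg h

theorem fresh_of_starts (h : X.Starts s) : X.fresh s = X.B s := by
  rw [fresh, if_pos h, Finset.sdiff_empty]

theorem fresh_of_not_starts (h : ¬X.Starts s) : X.fresh s = X.B s \ X.marked s := by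
  rw [fresh, if_neg h]

theorem mem_marked_succ (t : ℕ) : X.r t ∈ X.marked (t + 1) := by
  by_cases h : X.Starts t
  · rw [marked_succ_of_starts h]
    exact Finset.mem_singleton_self _
  · rw [marked_succ_of_not_starts h]
    exact Finset.mem_insert_self _ _

theorem card_marked_succ_pos (t : ℕ) : 0 < (X.marked (t + 1)).card :=
  Finset.card_pos.2 ⟨_, mem_marked_succ t⟩

theorem card_marked_le : ∀ t, (X.marked t).card ≤ X.k
  | 0 => Nat.zero_le _
  | t + 1 => by
    by_cases h : X.Starts t
    · rw [marked_succ_of_starts h, Finset.card_singleton]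
      exact X.k_pos
    · have hle := card_marked_le t
      rw [marked_succ_of_not_starts h]
      by_cases hm : X.r t ∈ X.marked t
      · rwa [Finset.insert_eq_self.2 hm]
      · have hne : (X.marked t).card ≠ X.k := fun heq => h ⟨hm, heq⟩
        rw [Finset.card_insert_of_notMem hm]
        lia

theorem remaining_pos (s : ℕ) : 0 < X.remaining s := by
  have := card_marked_le (X := X) (s + 1)
  unfold remaining
  lia

theorem remaining_le (s : ℕ) : X.remaining s ≤ X.k := by
  have := card_marked_succ_pos (X := X) s
  unfold remaining
  lia

theorem startsWindow_iff : X.StartsWindow t ↔ X.r t ∉ X.marked t ∧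
    (X.remaining t = X.k ∨ X.level (X.remaining t) < X.level (X.remaining t + 1)) := by
  have hle := card_marked_le (X := X) (t + 1)
  have hpos := card_marked_succ_pos (X := X) t
  have hdef : X.StartsWindow t ↔ X.r t ∉ X.marked t ∧ ((X.marked (t + 1)).card = 1 ∨
    X.level (X.k + 1 - (X.marked (t + 1)).card) < X.level (X.k + 2 - (X.marked (t + 1)).card)) :=
    Iff.rfl
  rw [hdef, remaining,
    show X.k + 1 - (X.marked (t + 1)).card + 1 = X.k + 2 - (X.marked (t + 1)).card by lia,
    show X.k + 1 - (X.marked (t + 1)).card = X.k ↔ (X.marked (t + 1)).card = 1 by lia]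

theorem Starts.startsWindow (h : X.Starts t) : X.StartsWindow t := by
  refine startsWindow_iff.2 ⟨h.1, Or.inl ?_⟩
  rw [remaining, marked_succ_of_starts h, Finset.card_singleton, Nat.add_sub_cancel]

theorem phase_idx_mono : Monotone fun t => (X.phase t).idx :=
  monotone_nat_of_le_succ fun t => by
    simp only [phase_idx_succ]
    split_ifs <;> lia

theorem phase_windowIdx_mono : Monotone fun t => (X.phase t).windowIdx :=
  monotone_nat_of_le_succ fun t => by
    simp only [phase_windowIdx_succ]
    split_ifs <;> lia

theorem phaseIdx_le (hst : s < t) : X.phaseIdx s ≤ (X.phase t).idx := phase_idx_mono hst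

theorem phaseIdx_of_starts (h : X.Starts t) : X.phaseIdx t = (X.phase t).idx + 1 := if_pos h

theorem phaseIdx_of_not_starts (h : ¬X.Starts t) : X.phaseIdx t = (X.phase t).idx := if_neg h

theorem not_starts_of_phaseIdx (hts : t ≤ s) (h : X.phaseIdx s = (X.phase t).idx) :
    ¬X.Starts s := fun hs => by
  have : (X.phase t).idx ≤ (X.phase s).idx := phase_idx_mono hts
  rw [phaseIdx_of_starts hs] at h
  lia

theorem phase_induction {P : ℕ → Prop} (base : P t)
    (step : ∀ s, t ≤ s → ¬X.Starts s → P s → P (s + 1)) (hts : t ≤ s)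
    (h : (X.phase s).idx = (X.phase t).idx) : P s := by
  induction s, hts using Nat.le_induction with
  | base => exact base
  | succ s hts ih =>
    have hns : ¬X.Starts s := not_starts_of_phaseIdx hts h
    exact step s hts hns (ih ((phaseIdx_of_not_starts hns).symm.trans h))

theorem marked_subset (hts : t ≤ s) (h : (X.phase s).idx = (X.phase t).idx) :
    X.marked t ⊆ X.marked s :=
  phase_induction (P := fun s => X.marked t ⊆ X.marked s) (Finset.Subset.refl _)
    (fun s _ hns ih => by
      rw [marked_succ_of_not_starts hns]
      exact ih.trans (Finset.subset_insert _ _)) hts h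

theorem B_succ_sdiff_marked_subset (ht : t < X.T) :
    X.B (t + 1) \ X.marked (t + 1) ⊆ X.fresh t := by
  intro p hp
  obtain ⟨hpB, hpm⟩ := Finset.mem_sdiff.1 hp
  have hne : p ≠ X.r t := fun h => hpm (h ▸ mem_marked_succ t)
  have hpB' := (Finset.mem_insert.1 (X.lazyRun.succ_subset ht hpB)).resolve_left hne
  by_cases h : X.Starts t
  · rwa [fresh_of_starts h]
  · rw [marked_succ_of_not_starts h] at hpm
    rw [fresh_of_not_starts h]
    exact Finset.mem_sdiff.2 ⟨hpB', mt Finset.mem_insert_of_mem hpm⟩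

theorem fresh_subset (hts : t ≤ s) (hs : s < X.T) (h : X.phaseIdx s = (X.phase t).idx) :
    X.fresh s ⊆ X.B t \ X.marked t := by
  have hns := not_starts_of_phaseIdx hts h
  have hsub : s ≤ X.T → X.B s \ X.marked s ⊆ X.B t \ X.marked t :=
    phase_induction (P := fun s => s ≤ X.T → X.B s \ X.marked s ⊆ X.B t \ X.marked t)
      (fun _ => subset_rfl)
      (fun s _ hns ih hs =>
        (fresh_of_not_starts hns ▸ B_succ_sdiff_marked_subset hs).trans (ih (Nat.le_of_succ_le hs)))
      hts ((phaseIdx_of_not_starts hns).symm.trans h)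
  rw [fresh_of_not_starts hns]
  exact hsub hs.le

theorem fresh_subset_erase (hts : t < s) (hs : s < X.T) (h : X.phaseIdx s = X.phaseIdx t) :
    X.fresh s ⊆ (X.fresh t).erase (X.r t) := by
  have hsub := fresh_subset (t := t + 1) hts hs h
  refine Finset.subset_erase.2
    ⟨hsub.trans (B_succ_sdiff_marked_subset (hts.trans hs)), fun hmem => ?_⟩
  exact (Finset.mem_sdiff.1 (hsub hmem)).2 (mem_marked_succ t)

theorem notMem_marked_of_mem_fresh (hns : ¬X.Starts s) (h : X.r s ∈ X.fresh s) :
    X.r s ∉ X.marked s := by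
  rw [fresh_of_not_starts hns] at h
  exact (Finset.mem_sdiff.1 h).2

theorem remaining_le_card_fresh (hs : s < X.T) (h : X.r s ∈ X.fresh s) :
    X.remaining s ≤ (X.fresh s).card := by
  by_cases hss : X.Starts s
  · rw [fresh_of_starts hss, card_B hs.le]
    exact remaining_le s
  · have hm := notMem_marked_of_mem_fresh hss h
    have := Finset.le_card_sdiff (X.marked s) (X.B s)
    rw [card_B hs.le] at this
    rw [remaining, marked_succ_of_not_starts hss, fresh_of_not_starts hss,
      Finset.card_insert_of_notMem hm]
    lia

theorem remaining_lt_remaining (hts : t < s) (h : X.phaseIdx s = X.phaseIdx t)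
    (hm : X.r s ∉ X.marked s) : X.remaining s < X.remaining t := by
  have hns : ¬X.Starts s := not_starts_of_phaseIdx (t := t + 1) hts h
  have hsub := Finset.card_le_card
    (marked_subset (X := X) (t := t + 1) hts ((phaseIdx_of_not_starts hns).symm.trans h))
  have hle := card_marked_le (X := X) (s + 1)
  rw [marked_succ_of_not_starts hns, Finset.card_insert_of_notMem hm] at hle
  rw [remaining, marked_succ_of_not_starts hns, Finset.card_insert_of_notMem hm, remaining]
  lia

theorem remaining_strictAntiOn (i : ℕ) :
    StrictAntiOn X.remaining {s | X.r s ∈ X.fresh s ∧ X.phaseIdx s = i} :=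
  fun t ht s hs hts => by
    have h := hs.2.trans ht.2.symm
    have hns : ¬X.Starts s := not_starts_of_phaseIdx (t := t + 1) hts h
    exact remaining_lt_remaining hts h (notMem_marked_of_mem_fresh hns hs.1)

theorem curFaults_eq (t : ℕ) : (X.phase t).curFaults =
    ((Finset.range t).filter fun τ => X.fault τ ∧ X.phaseIdx τ = (X.phase t).idx).card := by
  induction t with
  | zero => rfl
  | succ t ih =>
    have hself : X.phaseIdx t = (X.phase (t + 1)).idx := rfl
    rw [Finset.range_add_one, Finset.filter_insert, phase_curFaults_succ]
    by_cases hs : X.Starts t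
    · have hnone : (Finset.range t).filter
          (fun τ => X.fault τ ∧ X.phaseIdx τ = (X.phase (t + 1)).idx) = ∅ := by
        refine Finset.filter_eq_empty_iff.2 fun τ hτ hτi => ?_
        have := phaseIdx_le (X := X) (Finset.mem_range.1 hτ)
        rw [hτi.2, phase_idx_succ, if_pos hs] at this
        lia
      rw [hnone]
      cases hf : X.fault t <;> simp [hself, hs]
    · have hidx : (X.phase (t + 1)).idx = (X.phase t).idx := if_neg hs
      rw [hidx, if_neg hs, ih]
      cases hf : X.fault t <;> simp [hself, hidx]

theorem prevFaults_eq (t : ℕ) : (X.phase t).prevFaults =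
    ((Finset.range t).filter fun τ => X.fault τ ∧ X.phaseIdx τ + 1 = (X.phase t).idx).card := by
  induction t with
  | zero => rfl
  | succ t ih =>
    have hself : ¬(X.fault t ∧ X.phaseIdx t + 1 = (X.phase (t + 1)).idx) :=
      fun h => absurd h.2 (Nat.succ_ne_self _)
    rw [Finset.range_add_one, Finset.filter_insert, phase_prevFaults_succ, if_neg hself]
    by_cases hs : X.Starts t
    · simp only [if_pos hs, curFaults_eq, phase_idx_succ, Nat.add_right_cancel_iff]
    · simp only [if_neg hs, ih, phase_idx_succ]

theorem quota_le_phaseQuota (ht : t < X.T) : X.quota t ≤ X.phaseQuota (X.phaseIdx t) := by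
  have hsub (P : ℕ → Prop) [DecidablePred P] :
      ((Finset.range (t + 1)).filter P).card ≤ ((Finset.range X.T).filter P).card :=
    Finset.card_le_card (Finset.filter_subset_filter _ (Finset.range_subset_range.2 ht))
  rw [quota, phaseQuota, curFaults_eq, prevFaults_eq]
  exact add_le_add (Nat.mul_le_mul_left _ (hsub _)) (hsub _)

theorem card_marked_sdiff_B (ht : t ≤ X.T) :
    (X.marked t \ X.B t).card ≤ (X.phase t).curFaults := by
  induction t with
  | zero => simp [marked, phase]
  | succ t ih =>
    have hr := X.lazyRun.mem_succ ht
    rw [phase_curFaults_succ]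
    by_cases hs : X.Starts t
    · rw [marked_succ_of_starts hs,
        Finset.sdiff_eq_empty_iff_subset.2 (Finset.singleton_subset_iff.2 hr)]
      exact Nat.zero_le _
    · have hsub : X.marked (t + 1) \ X.B (t + 1) ⊆
          (X.marked t \ X.B t) ∪ (X.B t \ X.B (t + 1)) := by
        rw [marked_succ_of_not_starts hs, Finset.insert_sdiff_of_mem _ hr]
        grind
      calc (X.marked (t + 1) \ X.B (t + 1)).card
          ≤ (X.marked t \ X.B t).card + (X.B t \ X.B (t + 1)).card :=
            (Finset.card_le_card hsub).trans (Finset.card_union_le _ _)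
        _ ≤ (X.phase t).curFaults + (X.fault t).toNat :=
            add_le_add (ih (Nat.le_of_succ_le ht)) (X.lazyRun.card_sdiff_succ_le ht)
        _ = (if X.Starts t then 0 else (X.phase t).curFaults) + (X.fault t).toNat := by
            rw [if_neg hs]

theorem level_remaining_succ (h : ¬X.StartsWindow (t + 1)) :
    X.level (X.remaining (t + 1)) = X.level (X.remaining t) := by
  have hns : ¬X.Starts (t + 1) := mt Starts.startsWindow h
  have hmarked := marked_succ_of_not_starts hns
  by_cases hm : X.r (t + 1) ∈ X.marked (t + 1)
  · rw [remaining, hmarked, Finset.insert_eq_self.2 hm, remaining]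
  · have hpos := remaining_pos (X := X) (t + 1)
    have hrem : X.remaining (t + 1) + 1 = X.remaining t := by
      unfold remaining at hpos ⊢
      rw [hmarked, Finset.card_insert_of_notMem hm] at hpos ⊢
      lia
    have hlevel := (not_or.1 (not_and.1 (mt startsWindow_iff.2 h) hm)).2
    rw [hrem, not_lt] at hlevel
    exact (X.level_mono (by lia)).antisymm hlevel

theorem eq_of_windowIdx_eq (h : X.windowIdx s = X.windowIdx t) :
    X.phaseIdx s = X.phaseIdx t ∧ X.level (X.remaining s) = X.level (X.remaining t) := by
  wlog hts : t ≤ s generalizing s t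
  · exact (this h.symm (le_of_not_ge hts)).imp Eq.symm Eq.symm
  induction s, hts using Nat.le_induction with
  | base => exact ⟨rfl, rfl⟩
  | succ s hts ih =>
    have hle : X.windowIdx t ≤ X.windowIdx s := phase_windowIdx_mono (Nat.succ_le_succ hts)
    have hsucc : X.windowIdx (s + 1) =
      if X.StartsWindow (s + 1) then X.windowIdx s + 1 else X.windowIdx s := rfl
    have hw : ¬X.StartsWindow (s + 1) := fun hw => by
      rw [if_pos hw] at hsucc
      lia
    obtain ⟨hidx, hlevel⟩ := ih (by rw [← h, hsucc, if_neg hw])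
    exact ⟨(phaseIdx_of_not_starts (mt Starts.startsWindow hw)).trans hidx,
      (level_remaining_succ hw).trans hlevel⟩

section Sums

variable {S : Finset ℕ} {i v μ : ℕ} {c w : ℝ}

/-- In one phase, different slots have different numbers of remaining pages. -/
theorem sum_one_div_remaining_le_sum {R : Finset ℕ}
    (hS : ∀ s ∈ S, X.r s ∈ X.fresh s ∧ X.phaseIdx s = i) (hR : ∀ s ∈ S, X.remaining s ∈ R) :
    ∑ s ∈ S, (1 / X.remaining s : ℝ) ≤ ∑ m ∈ R, (1 / m : ℝ) := by
  rw [← Finset.sum_image (f := fun m : ℕ => (1 / m : ℝ))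
    fun s hs t ht h => (remaining_strictAntiOn i).injOn (hS s hs) (hS t ht) h]
  exact Finset.sum_le_sum_of_subset_of_nonneg (Finset.image_subset_iff.2 hR)
    fun m _ _ => by positivity

theorem sum_one_div_remaining_le_lowSum
    (hS : ∀ s ∈ S, X.r s ∈ X.fresh s ∧ X.phaseIdx s = i ∧ X.remaining s < μ) :
    ∑ s ∈ S, (1 / X.remaining s : ℝ) ≤ lowSum X.k μ :=
  sum_one_div_remaining_le_sum (fun s hs => ⟨(hS s hs).1, (hS s hs).2.1⟩) fun s hs =>
    Finset.mem_filter.2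
      ⟨Finset.mem_Icc.2 ⟨remaining_pos s, remaining_le s⟩, (hS s hs).2.2⟩

theorem sum_one_div_remaining_le_of_levelSum_le (hw : ∀ n, levelSum X.k X.level μ n ≤ w)
    (hS : ∀ s ∈ S, X.r s ∈ X.fresh s ∧ X.windowIdx s = v ∧ μ ≤ X.remaining s) :
    ∑ s ∈ S, (1 / X.remaining s : ℝ) ≤ w := by
  rcases S.eq_empty_or_nonempty with rfl | ⟨s₀, hs₀⟩
  · exact (levelSum_nonneg _ _ _ _).trans (hw 0)
  have heq (s) (hs : s ∈ S) := eq_of_windowIdx_eq ((hS s hs).2.1.trans (hS s₀ hs₀).2.1.symm)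
  refine (sum_one_div_remaining_le_sum (fun s hs => ⟨(hS s hs).1, (heq s hs).1⟩)
    fun s hs => ?_).trans (hw (X.level (X.remaining s₀)))
  exact Finset.mem_filter.2
    ⟨Finset.mem_Icc.2 ⟨remaining_pos s, remaining_le s⟩, (hS s hs).2.2, (heq s hs).2⟩

theorem sum_phaseQuota_le (I : Finset ℕ) : ∑ i ∈ I, X.phaseQuota i ≤ 3 * X.opt := by
  have hfiber (g : ℕ → ℕ) :
      ∑ i ∈ I, ((Finset.range X.T).filter fun τ => X.fault τ ∧ g τ = i).card ≤ X.opt := by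
    simp_rw [← Finset.filter_filter]
    rw [Finset.sum_card_fiberwise_eq_card_filter, opt_eq]
    exact Finset.card_filter_le _ _
  simp only [phaseQuota, Finset.sum_add_distrib, ← Finset.mul_sum]
  have hprev := hfiber fun τ => X.phaseIdx τ + 1
  have hcur := hfiber X.phaseIdx
  lia

theorem sum_mul_phaseQuota_le (F : ℕ → ℝ) (hc : 0 ≤ c)
    (h : ∀ i, ∑ s ∈ S with X.phaseIdx s = i, F s ≤ c) :
    ∑ s ∈ S, F s * X.phaseQuota (X.phaseIdx s) ≤ 3 * c * X.opt := by
  have hquota : ((∑ i ∈ S.image X.phaseIdx, X.phaseQuota i : ℕ) : ℝ) ≤ (3 * X.opt : ℕ) :=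
    Nat.cast_le.2 (sum_phaseQuota_le _)
  calc ∑ s ∈ S, F s * X.phaseQuota (X.phaseIdx s)
      = ∑ i ∈ S.image X.phaseIdx, (∑ s ∈ S with X.phaseIdx s = i, F s) * X.phaseQuota i := by
        rw [← Finset.sum_fiberwise_of_maps_to fun s hs => Finset.mem_image_of_mem X.phaseIdx hs]
        refine Finset.sum_congr rfl fun i _ => ?_
        rw [Finset.sum_mul]
        exact Finset.sum_congr rfl fun s hs => by rw [(Finset.mem_filter.1 hs).2]
    _ ≤ ∑ i ∈ S.image X.phaseIdx, c * X.phaseQuota i :=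
        Finset.sum_le_sum fun i _ => mul_le_mul_of_nonneg_right (h i) (Nat.cast_nonneg _)
    _ ≤ 3 * c * X.opt := by
        push_cast at hquota
        rw [← Finset.mul_sum]
        linarith [mul_le_mul_of_nonneg_left hquota hc]

theorem sum_windowErr_le (V : Finset ℕ) : ∑ v ∈ V, X.windowErr v ≤ X.syncErr := by
  simp_rw [windowErr, ← Finset.filter_filter]
  rw [Finset.sum_fiberwise_eq_sum_filter, syncErr]
  exact Finset.sum_le_sum_of_subset (Finset.filter_subset _ _)

theorem sum_mul_windowErr_le (F : ℕ → ℝ) (hc : 0 ≤ c)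
    (h : ∀ v, ∑ s ∈ S with X.windowIdx s = v, F s ≤ c) :
    ∑ s ∈ S, F s * X.windowErr (X.windowIdx s) ≤ c * X.syncErr := by
  have herr : ((∑ v ∈ S.image X.windowIdx, X.windowErr v : ℕ) : ℝ) ≤ X.syncErr :=
    Nat.cast_le.2 (sum_windowErr_le _)
  calc ∑ s ∈ S, F s * X.windowErr (X.windowIdx s)
      = ∑ v ∈ S.image X.windowIdx, (∑ s ∈ S with X.windowIdx s = v, F s) * X.windowErr v := by
        rw [← Finset.sum_fiberwise_of_maps_to fun s hs => Finset.mem_image_of_mem X.windowIdx hs]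
        refine Finset.sum_congr rfl fun v _ => ?_
        rw [Finset.sum_mul]
        exact Finset.sum_congr rfl fun s hs => by rw [(Finset.mem_filter.1 hs).2]
    _ ≤ ∑ v ∈ S.image X.windowIdx, c * X.windowErr v :=
        Finset.sum_le_sum fun v _ => mul_le_mul_of_nonneg_right (h v) (Nat.cast_nonneg _)
    _ ≤ c * X.syncErr := by
        push_cast at herr
        rw [← Finset.mul_sum]
        exact mul_le_mul_of_nonneg_left herr hc

theorem card_startsWindow_le (i : ℕ) :
    ((Finset.range X.T).filter fun τ => X.StartsWindow τ ∧ X.phaseIdx τ = i).card ≤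
      X.level X.k + 1 := by
  have hanti : StrictAntiOn (fun τ => X.level (X.remaining τ))
      {τ | X.StartsWindow τ ∧ X.phaseIdx τ = i} := fun τ hτ s hs hτs => by
    obtain ⟨hm, hlevel⟩ := startsWindow_iff.1 hs.1
    have hlt := remaining_lt_remaining hτs (hs.2.trans hτ.2.symm) hm
    have hle := remaining_le (X := X) τ
    exact (hlevel.resolve_left (by lia)).trans_le (X.level_mono hlt)
  refine (Finset.card_le_card_of_injOn (t := Finset.range (X.level X.k + 1)) _ (fun τ _ => ?_)
    (hanti.injOn.mono fun τ hτ => (Finset.mem_filter.1 hτ).2)).trans_eq (Finset.card_range _)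
  exact Finset.mem_range.2 (Nat.lt_succ_of_le (X.level_mono (remaining_le τ)))

theorem sum_quota_le : ∑ τ ∈ Finset.range X.T with X.Sync τ, X.quota τ ≤
    3 * (X.level X.k + 1) * X.opt := by
  have hquota : ∑ τ ∈ Finset.range X.T with X.Sync τ, (1 : ℝ) * X.phaseQuota (X.phaseIdx τ) ≤
      3 * (X.level X.k + 1) * X.opt :=
    sum_mul_phaseQuota_le _ (by positivity) fun i => by
      rw [Finset.sum_const, nsmul_one, Finset.filter_filter]
      refine mod_cast (Finset.card_le_card fun τ => ?_).trans (card_startsWindow_le i)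
      simp only [Finset.mem_filter]
      exact And.imp_right fun h => ⟨h.1.1, h.2⟩
  simp only [one_mul] at hquota
  exact (Finset.sum_le_sum fun τ hτ =>
    quota_le_phaseQuota (Finset.mem_range.1 (Finset.mem_filter.1 hτ).1)).trans (mod_cast hquota)

theorem card_late_slots_le : ((X.slots 0).filter X.IsLate).card ≤ 6 * X.opt := by
  have hfiber (i : ℕ) : (((X.slots 0).filter X.IsLate).filter fun s => X.phaseIdx s = i).card ≤
      2 * X.phaseQuota i := by
    refine (Finset.card_le_card_of_injOn (t := Finset.range (2 * X.phaseQuota i)) X.remaining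
      (fun s hs => ?_) ((remaining_strictAntiOn i).injOn.mono fun s hs => ?_)).trans_eq
      (Finset.card_range _)
    all_goals obtain ⟨hs, hi⟩ := Finset.mem_filter.1 hs
    · exact Finset.mem_range.2 (hi ▸ (Finset.mem_filter.1 hs).2)
    · exact ⟨(mem_slots.1 (Finset.mem_filter.1 hs).1).2, hi⟩
  rw [Finset.card_eq_sum_card_image X.phaseIdx]
  calc _ ≤ ∑ i ∈ ((X.slots 0).filter X.IsLate).image X.phaseIdx, 2 * X.phaseQuota i :=
        Finset.sum_le_sum fun i _ => hfiber i
    _ ≤ 6 * X.opt := by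
        rw [← Finset.mul_sum]
        have := sum_phaseQuota_le (X := X) (((X.slots 0).filter X.IsLate).image X.phaseIdx)
        lia

theorem sum_reserve_le (hw : ∀ n, levelSum X.k X.level μ n ≤ w) :
    ∑ s ∈ X.slots 0, X.reserve μ s ≤
      6 * X.opt + 6 * lowSum X.k μ * X.opt + 12 * w * X.syncErr := by
  have hw₀ : 0 ≤ w := (levelSum_nonneg _ _ _ _).trans (hw 0)
  have hlow₀ : 0 ≤ lowSum X.k μ := Finset.sum_nonneg fun _ _ => by positivity
  have hlate : (((X.slots 0).filter X.IsLate).card : ℝ) ≤ 6 * X.opt := mod_cast card_late_slots_le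
  simp only [reserve]
  rw [Finset.sum_ite, Finset.sum_ite, Finset.sum_const, nsmul_one]
  set S := (X.slots 0).filter fun s => ¬X.IsLate s
  have hS {s : ℕ} (hs : s ∈ S) : X.r s ∈ X.fresh s := (mem_slots.1 (Finset.mem_filter.1 hs).1).2
  have hlow : ∑ s ∈ S with X.remaining s < μ, 2 / X.remaining s * (X.phaseQuota (X.phaseIdx s) : ℝ)
      ≤ 3 * (2 * lowSum X.k μ) * X.opt := by
    refine sum_mul_phaseQuota_le _ (by positivity) fun i => ?_
    simp only [← mul_one_div (2 : ℝ), ← Finset.mul_sum]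
    refine mul_le_mul_of_nonneg_left (sum_one_div_remaining_le_lowSum (i := i) fun s hs => ?_)
      zero_le_two
    simp only [Finset.mem_filter] at hs
    exact ⟨hS hs.1.1, hs.2, hs.1.2⟩
  have hhigh : ∑ s ∈ S with ¬X.remaining s < μ,
      2 / X.remaining s * (6 * X.windowErr (X.windowIdx s) : ℝ) ≤ 12 * w * X.syncErr := by
    simp only [← mul_assoc]
    refine sum_mul_windowErr_le _ (by positivity) fun v => ?_
    simp only [div_mul_eq_mul_div, ← mul_one_div (2 * 6 : ℝ), ← Finset.mul_sum]
    refine (mul_le_mul_of_nonneg_left (sum_one_div_remaining_le_of_levelSum_le (v := v) hw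
      fun s hs => ?_) (by norm_num)).trans_eq (by norm_num)
    simp only [Finset.mem_filter, not_lt] at hs
    exact ⟨hS hs.1.1, hs.2, hs.1.2⟩
  linarith

end Sums

end Scenario

end Phases

/-! ### The algorithm -/

section Algorithm

variable {Page : Type u} [DecidableEq Page]

/-- The memory of the algorithm. -/
structure Memory (Page : Type u) where
  /-- initial cache content -/
  init : Finset Page
  /-- requests so far -/
  hist : List Page
  phase : Phase Page
  /-- own cache content -/
  cache : Finset Page
  /-- candidates for eviction, as reported by the predictor -/
  candidates : Finset Page
  /-- candidates that were evicted in this phase and not loaded again -/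
  dropped : Finset Page
  /-- number of Belady's faults since the last query -/
  pending : ℕ
  /-- index of the prediction and number of requested pages, for the queries of this window -/
  log : List (ℕ × ℕ)
  /-- whether there was a fault in this phase that Belady's algorithm avoided -/
  avoidable : Bool

namespace Memory

/-- Evict `q` in favour of the request `p`. -/
def evict (m : Memory Page) (p q : Page) (dropped : Finset Page) (fault : Bool) : Memory Page :=
  { m with
    cache := insert p (m.cache.erase q)
    candidates := m.candidates.erase q
    dropped := dropped
    avoidable := m.avoidable || !fault }

/-- Bookkeeping before the request `p` is served. A new phase that follows a phase with avoidable
faults starts with the pages requested in the latter. -/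
def advance (k : ℕ) (level : ℕ → ℕ) (m : Memory Page) (p : Page) (fault : Bool) : Memory Page :=
  { m with
    hist := m.hist ++ [p]
    phase := m.phase.next k level p fault
    cache := if m.phase.Starts k p ∧ m.avoidable = true then m.phase.marked else m.cache
    candidates := m.candidates.erase p
    dropped := if m.phase.Starts k p then ∅ else m.dropped
    pending := m.pending + fault.toNat
    avoidable := if m.phase.Starts k p then false else m.avoidable }

/-- Replace the candidates for eviction. -/
def refresh (m : Memory Page) (candidates : Finset Page) (log : List (ℕ × ℕ)) : Memory Page :=
  { m with candidates := candidates, pending := 0, log := log }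

/-- Number of pages to ask for at the start of a window. -/
def quota (m : Memory Page) : ℕ := 2 * m.phase.prevFaults + m.phase.curFaults

/-- An additional query is due because of Belady's faults since the last query. -/
def NeedsPatch (m : Memory Page) (p : Page) : Prop :=
  p ∉ m.cache ∧ 1 ≤ m.pending ∧ m.candidates.card ≤ m.pending

instance (m : Memory Page) (p : Page) : Decidable (m.NeedsPatch p) :=
  inferInstanceAs (Decidable (_ ∧ _))

/-- The request `p` is served by evicting a candidate. -/
def UsesCandidate (m : Memory Page) (p : Page) (fault : Bool) : Prop :=
  m.candidates.Nonempty ∧ (fault = true ∨ p ∉ m.dropped)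

instance (m : Memory Page) (p : Page) (fault : Bool) : Decidable (m.UsesCandidate p fault) :=
  inferInstanceAs (Decidable (_ ∧ _))

/-- The pages among which the page to be evicted is chosen. -/
def victims (m : Memory Page) (p : Page) (fault : Bool) : Finset Page :=
  if m.UsesCandidate p fault then m.candidates else m.cache \ m.phase.marked

/-- The memory after the request `p` was served by evicting `q`. -/
def serveBy (m : Memory Page) (p : Page) (fault : Bool) (q : Page) : Memory Page :=
  m.evict p q
    (if m.UsesCandidate p fault then insert q (m.dropped.erase p) else m.dropped.erase p) fault

end Memory

variable {Mem : Type u}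

/-- Continue with a uniformly random element of `S`. -/
noncomputable def draw (S : Finset Page) (next : Page → Prog Page Mem) (d : Prog Page Mem) :
    Prog Page Mem :=
  if h : S.Nonempty then
    .toss (S.card - 1) fun i =>
      next (S.equivFin.symm (Fin.cast (Nat.sub_add_cancel (Finset.card_pos.2 h)) i))
  else d

/-- Perform the given swaps. -/
def swapAll (l : List (Page × Page)) (next : Prog Page Mem) : Prog Page Mem :=
  l.foldr (fun x acc => .swap x.1 x.2 acc) next

/-- Serve the request `p`. -/
noncomputable def serve (m : Memory Page) (p : Page) (fault : Bool) : Prog Page (Memory Page) :=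
  if p ∈ m.cache then .done m
  else draw (m.victims p fault) (fun q => .swap p q (.done (m.serveBy p fault q))) (.done m)

/-- The swaps that make `M` the cache content. -/
noncomputable def cleanup (A M : Finset Page) : List (Page × Page) :=
  List.zip (M \ A).toList (A \ M).toList

/-- Query the predictor if necessary, and serve the request `p`. -/
noncomputable def queryAndServe (windowStart : Bool) (m : Memory Page) (p : Page) (fault : Bool) :
    Prog Page (Memory Page) :=
  if windowStart = true then
    if m.quota = 0 then serve (m.refresh ∅ []) p fault
    else .query m.quota fun R => serve (m.refresh R [(m.hist.length, m.quota)]) p fault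
  else if m.NeedsPatch p then
    .query (m.candidates.card + m.pending) fun R =>
      serve (m.refresh R ((m.hist.length, m.candidates.card + m.pending) :: m.log)) p fault
  else serve m p fault

/-- The caching algorithm for `k` pages; `level` determines the windows. -/
noncomputable def follower (Page : Type u) [DecidableEq Page] (k : ℕ) (level : ℕ → ℕ) :
    OnlineAlgorithm Page where
  Mem := Memory Page
  init A₀ := ⟨A₀, [], ⟨∅, 0, 0, 0, 0⟩, A₀, ∅, ∅, 0, [], false⟩
  step m p :=
    swapAll (if m.phase.Starts k p ∧ m.avoidable = true then cleanup m.cache m.phase.marked else [])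
      (queryAndServe (decide (m.phase.StartsWindow k level p))
        (m.advance k level p (beladyFaults m.init m.hist p)) p (beladyFaults m.init m.hist p))

/-- Expectation of a quantity with values in `[0, ∞]`. -/
noncomputable def mean {α : Type*} (μ : PMF α) (φ : α → ℝ≥0∞) : ℝ≥0∞ := ∑' a, μ a * φ a

theorem mean_pure {α : Type*} (a : α) (φ : α → ℝ≥0∞) : mean (PMF.pure a) φ = φ a :=
  (tsum_eq_single a fun b hb => by simp [hb]).trans (by simp)

theorem mean_bind {α β : Type*} (μ : PMF α) (ν : α → PMF β) (φ : β → ℝ≥0∞) :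
    mean (μ.bind ν) φ = mean μ fun a => mean (ν a) φ := by
  unfold mean
  simp_rw [PMF.bind_apply, ← ENNReal.tsum_mul_right, ← ENNReal.tsum_mul_left]
  rw [ENNReal.tsum_comm]
  simp_rw [mul_assoc]

theorem mean_map {α β : Type*} (μ : PMF α) (h : α → β) (φ : β → ℝ≥0∞) :
    mean (μ.map h) φ = mean μ fun a => φ (h a) := by
  rw [← PMF.bind_pure_comp, mean_bind]
  simp [mean_pure]

theorem mean_mono {α : Type*} {μ : PMF α} {φ ψ : α → ℝ≥0∞} (h : ∀ a ∈ μ.support, φ a ≤ ψ a) :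
    mean μ φ ≤ mean μ ψ := by
  refine ENNReal.tsum_le_tsum fun a => ?_
  by_cases ha : μ a = 0
  · simp [ha]
  · exact mul_le_mul_right (h a ((PMF.mem_support_iff _ _).2 ha)) _

theorem mean_const {α : Type*} (μ : PMF α) (c : ℝ≥0∞) : mean μ (fun _ => c) = c := by
  simp [mean, ENNReal.tsum_mul_right, μ.tsum_coe]

theorem mean_add {α : Type*} (μ : PMF α) (φ ψ : α → ℝ≥0∞) :
    mean μ (fun a => φ a + ψ a) = mean μ φ + mean μ ψ := by
  simp only [mean, mul_add, ENNReal.tsum_add]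

theorem mean_const_mul {α : Type*} (μ : PMF α) (c : ℝ≥0∞) (φ : α → ℝ≥0∞) :
    mean μ (fun a => c * φ a) = c * mean μ φ := by
  unfold mean
  rw [← ENNReal.tsum_mul_left]
  simp_rw [mul_left_comm]

variable {k : ℕ} (pred : Predictor Page k) (t : ℕ)

theorem mean_exec_toss (n : ℕ) (next : Fin (n + 1) → Prog Page Mem) (c : Config Page)
    (φ : Mem × Config Page → ℝ≥0∞) :
    mean (exec pred t (.toss n next) c) φ =
      (∑ i, mean (exec pred t (next i) c) φ) / (n + 1 : ℕ) := by
  rw [exec, mean_bind, mean, tsum_fintype]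
  simp_rw [PMF.uniformOfFintype_apply, Fintype.card_fin]
  rw [← Finset.mul_sum, ENNReal.div_eq_inv_mul]

theorem mean_exec_draw {S : Finset Page} (hS : S.Nonempty) (next : Page → Prog Page Mem)
    (d : Prog Page Mem) (c : Config Page) (φ : Mem × Config Page → ℝ≥0∞) :
    mean (exec pred t (draw S next d) c) φ =
      (∑ q ∈ S, mean (exec pred t (next q) c) φ) / S.card := by
  have hcard : S.card - 1 + 1 = S.card := Nat.sub_add_cancel (Finset.card_pos.2 hS)
  rw [draw, dif_pos hS, mean_exec_toss, ← Finset.sum_coe_sort S]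
  congr 1
  · exact Fintype.sum_equiv ((finCongr hcard).trans S.equivFin.symm) _ _ fun i => rfl
  · rw [hcard]

theorem mem_support_exec_draw {S : Finset Page} (hS : S.Nonempty) {next : Page → Prog Page Mem}
    {d : Prog Page Mem} {c : Config Page} {y : Mem × Config Page}
    (hy : y ∈ (exec pred t (draw S next d) c).support) :
    ∃ q ∈ S, y ∈ (exec pred t (next q) c).support := by
  rw [draw, dif_pos hS, exec, PMF.mem_support_bind_iff] at hy
  obtain ⟨i, -, hy⟩ := hy
  exact ⟨_, Subtype.property _, hy⟩

theorem exec_swapAll {l : List (Page × Page)} (next : Prog Page Mem) {c : Config Page}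
    (hload : (l.map Prod.fst).Nodup) (hevict : (l.map Prod.snd).Nodup)
    (hout : ∀ p ∈ l.map Prod.fst, p ∉ c.cache) (hin : ∀ q ∈ l.map Prod.snd, q ∈ c.cache) :
    exec pred t (swapAll l next) c = exec pred t next
      { c with
        cache := (c.cache \ (l.map Prod.snd).toFinset) ∪ (l.map Prod.fst).toFinset
        cost := c.cost + l.length } := by
  induction l generalizing c with
  | nil => simp [swapAll]
  | cons x l ih =>
    simp only [List.map_cons, List.nodup_cons, List.forall_mem_cons] at hload hevict hout hin
    have hcons : swapAll (x :: l) next = .swap x.1 x.2 (swapAll l next) := rfl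
    rw [hcons, exec, if_pos ⟨hout.1, hin.1⟩, ih hload.2 hevict.2]
    · congr 2
      · ext y
        simp only [List.map_cons, List.toFinset_cons, Finset.mem_union, Finset.mem_sdiff,
          Finset.mem_insert, Finset.mem_erase, List.mem_toFinset]
        grind
      · simp only [List.length_cons]
        lia
    · exact fun p hp hmem => (Finset.mem_insert.1 hmem).elim (fun h => hload.1 (h ▸ hp))
        fun h => hout.2 p hp (Finset.mem_of_mem_erase h)
    · exact fun q hq => Finset.mem_insert_of_mem
        (Finset.mem_erase.2 ⟨fun h => hevict.1 (h ▸ hq), hin.2 q hq⟩)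

theorem exec_cleanup {A M : Finset Page} (hcard : M.card = A.card) (next : Prog Page Mem)
    {c : Config Page} (hA : c.cache = A) :
    exec pred t (swapAll (cleanup A M) next) c =
      exec pred t next { c with cache := M, cost := c.cost + (M \ A).card } := by
  have hdiff : (M \ A).card = (A \ M).card := Finset.card_sdiff_comm hcard
  have hfst : (cleanup A M).map Prod.fst = (M \ A).toList := List.map_fst_zip (by simp [hdiff])
  have hsnd : (cleanup A M).map Prod.snd = (A \ M).toList := List.map_snd_zip (by simp [hdiff])
  have hlength : (cleanup A M).length = (M \ A).card := by
    rw [← List.length_map (f := Prod.fst), hfst, Finset.length_toList]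
  have hcache : A \ (A \ M) ∪ M \ A = M := by grind
  rw [exec_swapAll]
  · rw [hfst, hsnd, hA, Finset.toList_toFinset, Finset.toList_toFinset, hlength, hcache]
  · exact hfst ▸ Finset.nodup_toList _
  · exact hsnd ▸ Finset.nodup_toList _
  · simp only [hfst, hA, Finset.mem_toList, Finset.mem_sdiff]
    exact fun p hp => hp.2
  · simp only [hsnd, hA, Finset.mem_toList, Finset.mem_sdiff]
    exact fun p hp => hp.1

end Algorithm

/-! ### The potential of the slots -/

section Potential

variable {Page : Type u} [DecidableEq Page]

namespace Scenario

variable (X : Scenario Page)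

/-- Potential of a slot `s` of the current phase, when the cache content is `A`, the pages of `D`
were evicted on the advice of the predictor, and faults at `s` are paid for in advance up to `θ`
missing pages. -/
noncomputable def slotPot (s : ℕ) (A D : Finset Page) (θ : ℕ) : ℝ :=
  if X.IsLate s then 1
  else if (X.fresh s \ A).card ≤ θ then
    (if X.r s ∉ A ∪ D then 1 else 0) + 2 / X.remaining s * (θ - (X.fresh s \ A).card)
  else 0

/-- The number of missing pages up to which a fault at the slot `s` is paid for in advance, when the
queries of the current window `cw` have error `e`. -/
def threshold (μ s cw e : ℕ) : ℕ :=
  if X.remaining s < μ then X.phaseQuota (X.phaseIdx s)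
  else min (X.phaseQuota (X.phaseIdx s))
    (6 * if X.windowIdx s = cw then e else X.windowErr (X.windowIdx s))

/-- Potential of the slot `s` when the current phase is `cp` and the current window is `cw`. -/
noncomputable def slotValue (μ cp cw : ℕ) (A D : Finset Page) (e s : ℕ) : ℝ :=
  if X.phaseIdx s = cp then X.slotPot s A D (X.threshold μ s cw e) else X.reserve μ s

/-- Potential of the slots from time `t` on, in phase `cp` and window `cw`. -/
noncomputable def pot (μ t cp cw : ℕ) (A D : Finset Page) (e : ℕ) : ℝ :=
  ∑ s ∈ X.slots t, X.slotValue μ cp cw A D e s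

variable {X}
variable {s t μ cp cp' cw cw' e e' θ θ' : ℕ} {A A' D D' U : Finset Page} {p q : Page}

theorem slotPot_of_isLate (h : X.IsLate s) : X.slotPot s A D θ = 1 := if_pos h

theorem slotPot_of_le (h : ¬X.IsLate s) (hθ : (X.fresh s \ A).card ≤ θ) : X.slotPot s A D θ =
    (if X.r s ∉ A ∪ D then 1 else 0) + 2 / X.remaining s * (θ - (X.fresh s \ A).card) := by
  rw [slotPot, if_neg h, if_pos hθ]

theorem slotPot_of_lt (h : ¬X.IsLate s) (hθ : θ < (X.fresh s \ A).card) :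
    X.slotPot s A D θ = 0 := by
  rw [slotPot, if_neg h, if_neg hθ.not_ge]

theorem slotPot_nonneg (s : ℕ) (A D : Finset Page) (θ : ℕ) : 0 ≤ X.slotPot s A D θ := by
  unfold slotPot
  split_ifs with _ hθ
  · exact zero_le_one
  all_goals
    try have hsub : (0 : ℝ) ≤ θ - (X.fresh s \ A).card := sub_nonneg.2 (mod_cast hθ)
    positivity

theorem slotPot_mono (h : θ ≤ θ') : X.slotPot s A D θ ≤ X.slotPot s A D θ' := by
  by_cases hl : X.IsLate s
  · rw [slotPot_of_isLate hl, slotPot_of_isLate hl]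
  rcases le_or_gt (X.fresh s \ A).card θ with hθ | hθ
  · rw [slotPot_of_le hl hθ, slotPot_of_le hl (hθ.trans h)]
    gcongr
  · rw [slotPot_of_lt hl hθ]
    exact slotPot_nonneg s A D θ'

theorem threshold_le_phaseQuota (μ s cw e : ℕ) :
    X.threshold μ s cw e ≤ X.phaseQuota (X.phaseIdx s) := by
  unfold threshold
  split_ifs <;> grind

theorem threshold_le (hw : X.windowIdx s ≠ cw) : X.threshold μ s cw e ≤
    if X.remaining s < μ then X.phaseQuota (X.phaseIdx s) else 6 * X.windowErr (X.windowIdx s) := by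
  rw [threshold, if_neg hw]
  split_ifs
  · exact le_rfl
  · exact min_le_right _ _

theorem slotPot_le_reserve (hw : X.windowIdx s ≠ cw) :
    X.slotPot s A D (X.threshold μ s cw e) ≤ (if X.r s ∉ A then 1 else 0) + X.reserve μ s := by
  have hfault : (if X.r s ∉ A ∪ D then 1 else 0 : ℝ) ≤ if X.r s ∉ A then 1 else 0 := by
    split_ifs <;> simp_all
  have hfault0 : (0 : ℝ) ≤ if X.r s ∉ A then 1 else 0 := by positivity
  by_cases hl : X.IsLate s
  · rw [slotPot_of_isLate hl, reserve, if_pos hl]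
    exact le_add_of_nonneg_left hfault0
  rcases le_or_gt (X.fresh s \ A).card (X.threshold μ s cw e) with hθ | hθ
  · have hreserve : X.reserve μ s = 2 / X.remaining s * ((if X.remaining s < μ then
        X.phaseQuota (X.phaseIdx s) else 6 * X.windowErr (X.windowIdx s) : ℕ) : ℝ) := by
      rw [reserve, if_neg hl]
      split_ifs <;> push_cast <;> rfl
    rw [slotPot_of_le hl hθ, hreserve]
    gcongr
    exact (sub_le_self _ (Nat.cast_nonneg _)).trans (mod_cast threshold_le hw)
  · rw [slotPot_of_lt hl hθ]
    exact add_nonneg hfault0 (reserve_nonneg μ s)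

theorem card_fresh_sdiff_evict (hp : p ∉ X.fresh s) (hq : q ∈ A) :
    (X.fresh s \ insert p (A.erase q)).card =
      (X.fresh s \ A).card + if q ∈ X.fresh s then 1 else 0 := by
  split_ifs with h
  · rw [← Finset.card_insert_of_notMem (a := q) (by simp [hq])]
    congr 1
    grind
  · congr 1
    grind

theorem slotPot_evict_candidate (hp : p ∉ X.fresh s) (hq : q ∈ A) (hqD : q ∈ D')
    (hD : D.erase p ⊆ D') :
    X.slotPot s (insert p (A.erase q)) D' θ ≤ X.slotPot s A D θ := by
  have hcard := card_fresh_sdiff_evict hp hq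
  by_cases hl : X.IsLate s
  · rw [slotPot_of_isLate hl, slotPot_of_isLate hl]
  rcases le_or_gt (X.fresh s \ insert p (A.erase q)).card θ with hθ | hθ
  · have hle : (X.fresh s \ A).card ≤ (X.fresh s \ insert p (A.erase q)).card :=
      hcard ▸ Nat.le_add_right _ _
    have hmem : X.r s ∈ A ∪ D → X.r s ∈ insert p (A.erase q) ∪ D' := by grind
    rw [slotPot_of_le hl hθ, slotPot_of_le hl (hle.trans hθ)]
    gcongr
    split_ifs <;> simp_all
  · rw [slotPot_of_lt hl hθ]
    exact slotPot_nonneg s A D θ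

theorem ite_evict_le (hs : X.r s ≠ p) :
    (if X.r s ∉ insert p (A.erase q) ∪ D.erase p then (1 : ℝ) else 0) ≤
      (if X.r s ∉ A ∪ D then 1 else 0) + if q = X.r s then 1 else 0 := by
  by_cases hq : q = X.r s
  · split_ifs <;> norm_num
  · have : X.r s ∉ insert p (A.erase q) ∪ D.erase p ↔ X.r s ∉ A ∪ D := by grind
    simp only [this, if_neg hq, add_zero, le_refl]

theorem slotPot_evict_le_of_lt (hl : ¬X.IsLate s) (hs : X.r s ∈ X.fresh s) (hp : p ∉ X.fresh s)
    (hq : q ∈ A) (hθ : (X.fresh s \ A).card < θ) :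
    X.slotPot s (insert p (A.erase q)) (D.erase p) θ ≤ X.slotPot s A D θ +
      ((if q = X.r s then 1 else 0) - 2 / X.remaining s * if q ∈ X.fresh s then 1 else 0) := by
  have hcard := card_fresh_sdiff_evict hp hq
  have hle : (X.fresh s \ insert p (A.erase q)).card ≤ θ := by split_ifs at hcard <;> lia
  have hfault := ite_evict_le (X := X) (A := A) (D := D) (q := q) (ne_of_mem_of_not_mem hs hp)
  rw [slotPot_of_le hl hθ.le, slotPot_of_le hl hle, hcard]
  push_cast
  linarith

theorem slotPot_evict_le_of_ge (hl : ¬X.IsLate s) (hs : X.r s ∈ X.fresh s) (hp : p ∉ X.fresh s)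
    (hq : q ∈ A) (hθ : θ ≤ (X.fresh s \ A).card) :
    X.slotPot s (insert p (A.erase q)) (D.erase p) θ ≤ X.slotPot s A D θ := by
  have hcard := card_fresh_sdiff_evict hp hq
  rcases hθ.lt_or_eq with hθ | rfl
  · rw [slotPot_of_lt hl (by lia)]
    exact slotPot_nonneg s A D θ
  by_cases hf : q ∈ X.fresh s
  · rw [if_pos hf] at hcard
    rw [slotPot_of_lt hl (by lia)]
    exact slotPot_nonneg s A D _
  · rw [if_neg hf, add_zero] at hcard
    have hfault := ite_evict_le (X := X) (A := A) (D := D) (q := q) (ne_of_mem_of_not_mem hs hp)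
    rw [if_neg fun h : q = X.r s => hf (h ▸ hs), add_zero] at hfault
    rw [slotPot_of_le hl hcard.le, slotPot_of_le hl le_rfl, hcard]
    gcongr

-- As long as the slot is not late and few pages are missing, half of the remaining pages are in the
-- cache, so that a random eviction hits `r s` with probability at most `2 / remaining s` times the
-- probability that it increases the number of missing pages.
theorem one_le_two_div_remaining_mul (hl : ¬X.IsLate s) (hsT : s < X.T) (hs : X.r s ∈ X.fresh s)
    (hU : X.fresh s ∩ A ⊆ U) (hA : (X.fresh s \ A).card ≤ X.phaseQuota (X.phaseIdx s)) :
    (1 : ℝ) ≤ 2 / X.remaining s * (U.filter (· ∈ X.fresh s)).card := by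
  have hsub : X.fresh s ∩ A ⊆ U.filter (· ∈ X.fresh s) := fun y hy =>
    Finset.mem_filter.2 ⟨hU hy, (Finset.mem_inter.1 hy).1⟩
  have hcard := Finset.card_le_card hsub
  have hsplit := Finset.card_inter_add_card_sdiff (X.fresh s) A
  have hrem := remaining_le_card_fresh hsT hs
  have hpos : (0 : ℝ) < X.remaining s := mod_cast remaining_pos s
  unfold IsLate at hl
  rw [div_mul_eq_mul_div, one_le_div₀ hpos]
  exact_mod_cast (by lia : X.remaining s ≤ 2 * (U.filter (· ∈ X.fresh s)).card)

theorem slotPot_evict_random (hs : X.r s ∈ X.fresh s) (hsT : s < X.T) (hp : p ∉ X.fresh s)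
    (hUA : U ⊆ A) (hU : X.fresh s ∩ A ⊆ U) (hθ : θ ≤ X.phaseQuota (X.phaseIdx s)) :
    ∑ u ∈ U, X.slotPot s (insert p (A.erase u)) (D.erase p) θ ≤ U.card * X.slotPot s A D θ := by
  rw [← nsmul_eq_mul, ← Finset.sum_const]
  by_cases hl : X.IsLate s
  · simp only [slotPot_of_isLate hl, le_refl]
  rcases le_or_gt θ (X.fresh s \ A).card with hc | hc
  · exact Finset.sum_le_sum fun u hu => slotPot_evict_le_of_ge hl hs hp (hUA hu) hc
  refine (Finset.sum_le_sum fun u hu => slotPot_evict_le_of_lt hl hs hp (hUA hu) hc).trans ?_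
  have hhit : ((U.filter (· = X.r s)).card : ℝ) ≤ 1 := by
    rw [Finset.filter_eq']
    split_ifs <;> simp
  have hmiss := one_le_two_div_remaining_mul hl hsT hs hU (hc.le.trans hθ)
  rw [Finset.sum_add_distrib, Finset.sum_sub_distrib, ← Finset.mul_sum, Finset.sum_boole,
    Finset.sum_boole]
  linarith

theorem slotPot_raise (h : θ ≤ θ') :
    X.slotPot s A D θ' ≤ X.slotPot s A D θ + (2 / X.remaining s * (θ' - θ : ℕ) +
      if X.r s ∉ A ∧ (X.fresh s \ A).card ∈ Finset.Ioc θ θ' then 1 else 0) := by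
  have hpos : (0 : ℝ) ≤ if X.r s ∉ A ∧ (X.fresh s \ A).card ∈ Finset.Ioc θ θ' then 1 else 0 := by
    positivity
  have hmul : (0 : ℝ) ≤ 2 / X.remaining s * (θ' - θ : ℕ) := by positivity
  by_cases hl : X.IsLate s
  · rw [slotPot_of_isLate hl, slotPot_of_isLate hl]
    linarith
  rcases le_or_gt (X.fresh s \ A).card θ with hc | hc
  · rw [slotPot_of_le hl hc, slotPot_of_le hl (hc.trans h), Nat.cast_sub h]
    linarith
  rcases le_or_gt (X.fresh s \ A).card θ' with hc' | hc'
  · have hfault : (if X.r s ∉ A ∪ D then 1 else 0 : ℝ) ≤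
        if X.r s ∉ A ∧ (X.fresh s \ A).card ∈ Finset.Ioc θ θ' then 1 else 0 := by
      split_ifs <;> simp_all
    have hgap : (2 : ℝ) / X.remaining s * (θ' - (X.fresh s \ A).card) ≤
        2 / X.remaining s * (θ' - θ : ℕ) := by
      rw [Nat.cast_sub h]
      gcongr
    rw [slotPot_of_lt hl hc, slotPot_of_le hl hc']
    linarith
  · rw [slotPot_of_lt hl hc']
    linarith [slotPot_nonneg (X := X) s A D θ]

theorem slotValue_of_phaseIdx_eq (h : X.phaseIdx s = cp) :
    X.slotValue μ cp cw A D e s = X.slotPot s A D (X.threshold μ s cw e) := if_pos h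

theorem slotValue_of_phaseIdx_ne (h : X.phaseIdx s ≠ cp) :
    X.slotValue μ cp cw A D e s = X.reserve μ s := if_neg h

theorem slotValue_nonneg (μ cp cw : ℕ) (A D : Finset Page) (e s : ℕ) :
    0 ≤ X.slotValue μ cp cw A D e s := by
  unfold slotValue
  split_ifs
  · exact slotPot_nonneg _ _ _ _
  · exact reserve_nonneg _ _

theorem pot_nonneg (μ t cp cw : ℕ) (A D : Finset Page) (e : ℕ) : 0 ≤ X.pot μ t cp cw A D e :=
  Finset.sum_nonneg fun s _ => slotValue_nonneg μ cp cw A D e s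

theorem slots_succ_subset (t : ℕ) : X.slots (t + 1) ⊆ X.slots t :=
  Finset.filter_subset_filter _ (Finset.Ico_subset_Ico_left t.le_succ)

theorem pot_succ_le (μ t cp cw : ℕ) (A D : Finset Page) (e : ℕ) :
    X.pot μ (t + 1) cp cw A D e ≤ X.pot μ t cp cw A D e :=
  Finset.sum_le_sum_of_subset_of_nonneg (slots_succ_subset t) fun s _ _ =>
    slotValue_nonneg μ cp cw A D e s

theorem pot_succ_add_slotPot_le (A D : Finset Page) (e : ℕ) (ht : t ∈ X.slots t) :
    X.pot μ (t + 1) (X.phaseIdx t) cw A D e + X.slotPot t A D (X.threshold μ t cw e) ≤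
      X.pot μ t (X.phaseIdx t) cw A D e := by
  have hnotMem : t ∉ X.slots (t + 1) := fun h => t.not_succ_le_self (mem_slots.1 h).1.1
  rw [← slotValue_of_phaseIdx_eq (μ := μ) (e := e) rfl, pot, add_comm,
    ← Finset.sum_insert (f := X.slotValue μ (X.phaseIdx t) cw A D e) hnotMem]
  exact Finset.sum_le_sum_of_subset_of_nonneg
    (Finset.insert_subset ht (slots_succ_subset t)) fun s _ _ => slotValue_nonneg _ _ _ _ _ _ _

theorem notMem_fresh_of_mem_slots_succ (hs : s ∈ X.slots (t + 1))
    (hi : X.phaseIdx s = X.phaseIdx t) : X.r t ∉ X.fresh s := fun h =>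
  have ⟨⟨hts, hsT⟩, _⟩ := mem_slots.1 hs
  (Finset.mem_erase.1 (fresh_subset_erase hts hsT hi h)).1 rfl

theorem pot_evict_candidate (hq : q ∈ A) (hqD : q ∈ D') (hD : D.erase (X.r t) ⊆ D') :
    X.pot μ (t + 1) (X.phaseIdx t) cw (insert (X.r t) (A.erase q)) D' e ≤
      X.pot μ (t + 1) (X.phaseIdx t) cw A D e := by
  refine Finset.sum_le_sum fun s hs => ?_
  unfold slotValue
  split_ifs with hi
  · exact slotPot_evict_candidate (notMem_fresh_of_mem_slots_succ hs hi) hq hqD hD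
  · exact le_rfl

theorem pot_evict_random (μ t cw e : ℕ) (A D : Finset Page) :
    ∑ u ∈ A \ X.marked (t + 1),
      X.pot μ (t + 1) (X.phaseIdx t) cw (insert (X.r t) (A.erase u)) (D.erase (X.r t)) e ≤
        (A \ X.marked (t + 1)).card * X.pot μ (t + 1) (X.phaseIdx t) cw A D e := by
  unfold pot
  rw [Finset.sum_comm, Finset.mul_sum]
  refine Finset.sum_le_sum fun s hs => ?_
  unfold slotValue
  split_ifs with hi
  · obtain ⟨⟨hts, hsT⟩, hfresh⟩ := mem_slots.1 hs
    refine slotPot_evict_random hfresh hsT (notMem_fresh_of_mem_slots_succ hs hi)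
      Finset.sdiff_subset (fun y hy => ?_) (threshold_le_phaseQuota _ _ _ _)
    obtain ⟨hyf, hyA⟩ := Finset.mem_inter.1 hy
    exact Finset.mem_sdiff.2
      ⟨hyA, (Finset.mem_sdiff.1 (fresh_subset (t := t + 1) hts hsT hi hyf)).2⟩
  · rw [Finset.sum_const, nsmul_eq_mul]

theorem pot_refresh_le (h : ∀ s, t ≤ s → X.windowIdx s ≠ cw) (he : e' ≤ X.windowErr cw') :
    X.pot μ t cp cw' A D e' ≤ X.pot μ t cp cw A D e := by
  refine Finset.sum_le_sum fun s hs => ?_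
  unfold slotValue
  split_ifs
  · refine slotPot_mono ?_
    unfold threshold
    rw [if_neg (h s (mem_slots.1 hs).1.1)]
    split_ifs with _ hw
    · exact le_rfl
    · rw [hw]
      exact min_le_min le_rfl (Nat.mul_le_mul_left _ he)
    · exact le_rfl
  · exact le_rfl

theorem injOn_request_slots (i : ℕ) : Set.InjOn X.r {s | s ∈ X.slots t ∧ X.phaseIdx s = i} := by
  have hne {s s' : ℕ} (hs' : s' ∈ X.slots t) (hi : X.phaseIdx s' = X.phaseIdx s)
      (hlt : s < s') : X.r s' ≠ X.r s :=
    (Finset.mem_erase.1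
      (fresh_subset_erase hlt (mem_slots.1 hs').1.2 hi (mem_slots.1 hs').2)).1
  intro s hs s' hs' heq
  by_contra hss
  rcases lt_or_gt_of_ne hss with hlt | hlt
  · exact hne hs'.1 (hs'.2.trans hs.2.symm) hlt heq.symm
  · exact hne hs.1 (hs.2.trans hs'.2.symm) hlt heq

theorem pot_new_phase_le (h : ∀ s, t ≤ s → X.phaseIdx s ≠ cp)
    (hw : ∀ s, t ≤ s → X.windowIdx s ≠ cw)
    (hB : ∀ s ∈ X.slots t, X.phaseIdx s = cp' → X.r s ∈ X.B t) :
    X.pot μ t cp' cw A' D' e ≤ X.pot μ t cp cw A D e + (X.B t \ A').card := by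
  have hle : X.pot μ t cp' cw A' D' e ≤ ∑ s ∈ X.slots t,
      ((if X.phaseIdx s = cp' ∧ X.r s ∉ A' then 1 else 0) + X.reserve μ s) := by
    refine Finset.sum_le_sum fun s hs => ?_
    by_cases hi : X.phaseIdx s = cp'
    · rw [slotValue_of_phaseIdx_eq hi]
      simpa only [hi, true_and] using slotPot_le_reserve (hw s (mem_slots.1 hs).1.1)
    · rw [slotValue_of_phaseIdx_ne hi, if_neg fun h => hi h.1, zero_add]
  have hreserve : X.pot μ t cp cw A D e = ∑ s ∈ X.slots t, X.reserve μ s :=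
    Finset.sum_congr rfl fun s hs => slotValue_of_phaseIdx_ne (h s (mem_slots.1 hs).1.1)
  have hcard : ((X.slots t).filter fun s => X.phaseIdx s = cp' ∧ X.r s ∉ A').card ≤
      (X.B t \ A').card := by
    refine Finset.card_le_card_of_injOn X.r (fun s hs => ?_)
      ((injOn_request_slots (t := t) cp').mono fun s hs => ?_)
    all_goals obtain ⟨hs, hi, hA⟩ := Finset.mem_filter.1 hs
    · exact Finset.mem_sdiff.2 ⟨hB s hs hi, hA⟩
    · exact ⟨hs, hi⟩
  rw [Finset.sum_add_distrib, Finset.sum_boole] at hle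
  rw [hreserve]
  linarith [show (((X.slots t).filter fun s => X.phaseIdx s = cp' ∧ X.r s ∉ A').card : ℝ) ≤
    (X.B t \ A').card from mod_cast hcard]

theorem strictAntiOn_card_fresh_sdiff (i : ℕ) (A : Finset Page) :
    StrictAntiOn (fun s => (X.fresh s \ A).card)
      {s | s ∈ X.slots t ∧ X.phaseIdx s = i ∧ X.r s ∉ A} := by
  intro s hs s' hs' hlt
  have hsub := fresh_subset_erase hlt (mem_slots.1 hs'.1).1.2 (hs'.2.1.trans hs.2.1.symm)
  refine Finset.card_lt_card ((Finset.ssubset_iff_of_subset fun y hy => ?_).2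
    ⟨X.r s, Finset.mem_sdiff.2 ⟨(mem_slots.1 hs.1).2, hs.2.2⟩, fun h => ?_⟩)
  · obtain ⟨hyf, hyA⟩ := Finset.mem_sdiff.1 hy
    exact Finset.mem_sdiff.2 ⟨Finset.mem_of_mem_erase (hsub hyf), hyA⟩
  · exact (Finset.mem_erase.1 (hsub (Finset.mem_sdiff.1 h).1)).1 rfl

theorem card_slots_threshold_le (t i : ℕ) (A : Finset Page) (θ θ' : ℕ) :
    ((X.slots t).filter fun s => X.phaseIdx s = i ∧ X.r s ∉ A ∧
      (X.fresh s \ A).card ∈ Finset.Ioc θ θ').card ≤ θ' - θ := by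
  rw [← Nat.card_Ioc]
  refine Finset.card_le_card_of_injOn (fun s => (X.fresh s \ A).card)
    (fun s hs => (Finset.mem_filter.1 hs).2.2.2)
    ((strictAntiOn_card_fresh_sdiff (t := t) i A).injOn.mono fun s hs => ?_)
  obtain ⟨hs, hi, hA, -⟩ := Finset.mem_filter.1 hs
  exact ⟨hs, hi, hA⟩

-- Only the slots of the current window outside the lowest levels see the new error, by an increase
-- of the threshold by at most `6 * d`.
theorem slotValue_raise_le (d : ℕ) : X.slotValue μ cp cw A D (e + d) s ≤
    X.slotValue μ cp cw A D e s +
      ((if X.windowIdx s = cw ∧ μ ≤ X.remaining s then (2 / X.remaining s * (6 * d) : ℝ) else 0) +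
        if X.phaseIdx s = cp ∧ X.r s ∉ A ∧ (X.fresh s \ A).card ∈
          Finset.Ioc (min (X.phaseQuota cp) (6 * e)) (min (X.phaseQuota cp) (6 * (e + d)))
        then 1 else 0) := by
  by_cases hi : X.phaseIdx s = cp
  swap
  · rw [slotValue_of_phaseIdx_ne hi, slotValue_of_phaseIdx_ne hi]
    exact le_add_of_nonneg_right (by positivity)
  rw [slotValue_of_phaseIdx_eq hi, slotValue_of_phaseIdx_eq hi]
  by_cases hc : X.windowIdx s = cw ∧ μ ≤ X.remaining s
  · have hthreshold (e : ℕ) : X.threshold μ s cw e = min (X.phaseQuota cp) (6 * e) := by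
      rw [threshold, if_neg hc.2.not_gt, if_pos hc.1, hi]
    have hle : min (X.phaseQuota cp) (6 * e) ≤ min (X.phaseQuota cp) (6 * (e + d)) := by lia
    have hgap : ((min (X.phaseQuota cp) (6 * (e + d)) - min (X.phaseQuota cp) (6 * e) : ℕ) : ℝ) ≤
        6 * d := mod_cast (by lia)
    simp only [hthreshold, if_pos hc, hi, true_and]
    refine (slotPot_raise hle).trans ?_
    gcongr
  · have hthreshold : X.threshold μ s cw (e + d) = X.threshold μ s cw e := by
      unfold threshold
      grind
    rw [hthreshold]
    exact le_add_of_nonneg_right (by positivity)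

theorem pot_raise_le {w : ℝ} (hw : ∀ n, levelSum X.k X.level μ n ≤ w) (t cp cw e d : ℕ)
    (A D : Finset Page) :
    X.pot μ t cp cw A D (e + d) ≤ X.pot μ t cp cw A D e + 6 * d * (1 + 2 * w) := by
  refine (Finset.sum_le_sum fun s _ => slotValue_raise_le d).trans ?_
  rw [Finset.sum_add_distrib, Finset.sum_add_distrib, Finset.sum_boole, ← Finset.sum_filter]
  have hcount : (((X.slots t).filter fun s => X.phaseIdx s = cp ∧ X.r s ∉ A ∧
      (X.fresh s \ A).card ∈ Finset.Ioc (min (X.phaseQuota cp) (6 * e))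
        (min (X.phaseQuota cp) (6 * (e + d)))).card : ℝ) ≤ 6 * d :=
    mod_cast (card_slots_threshold_le t cp A _ _).trans (by lia)
  have hharmonic : ∑ s ∈ (X.slots t).filter fun s => X.windowIdx s = cw ∧ μ ≤ X.remaining s,
      (1 / X.remaining s : ℝ) ≤ w :=
    sum_one_div_remaining_le_of_levelSum_le hw fun s hs =>
      have ⟨hslot, hs⟩ := Finset.mem_filter.1 hs
      ⟨(mem_slots.1 hslot).2, hs⟩
  have hgap : ∑ s ∈ (X.slots t).filter fun s => X.windowIdx s = cw ∧ μ ≤ X.remaining s,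
      2 / X.remaining s * (6 * d : ℝ) ≤ 12 * d * w := by
    calc _ = 12 * d * ∑ s ∈ (X.slots t).filter fun s => X.windowIdx s = cw ∧ μ ≤ X.remaining s,
          (1 / X.remaining s : ℝ) := by
          rw [Finset.mul_sum]
          exact Finset.sum_congr rfl fun s _ => by ring
      _ ≤ 12 * d * w := by gcongr
  unfold pot
  linarith

end Scenario

end Potential

/-! ### Invariants of an execution -/

section Invariants

variable {Page : Type u} [DecidableEq Page]

namespace Scenario

section Defs

variable (X : Scenario Page)

/-- Total error of logged queries, where the error of a query is capped by its size. -/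
def logErr (l : List (ℕ × ℕ)) : ℕ := (l.map fun x => min (X.predError x.1) x.2).sum

/-- Total error of the predictions that were not queried. -/
def credit (c : Config Page) : ℕ := ∑ τ ∈ Finset.Icc 1 X.T \ c.queryTimes, X.predError τ

/-- Number of Belady's faults from time `t` on. -/
def faultsFrom (t : ℕ) : ℕ := ((Finset.Ico t X.T).filter fun τ => X.fault τ).card

/-- Number of pages asked for at the starts of the windows until time `t`. -/
def asked (t : ℕ) : ℕ := ∑ τ ∈ (Finset.range t).filter X.Sync, X.quota τ

/-- Memory and configuration are those of an execution that has seen `t` requests. -/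
structure Tracks (t : ℕ) (m : Memory Page) (c : Config Page) : Prop where
  init : m.init = X.A₀
  hist : m.hist = (List.range t).map X.r
  phase : m.phase = X.phase t
  cache : c.cache = m.cache
  card : m.cache.card = X.k
  served : c.unserved = 0

/-- Accounting of the queries: those at the starts of windows before time `n`, and additional ones
that are paid for by Belady's faults before time `t`. -/
structure Accounts (n t : ℕ) (m : Memory Page) (c : Config Page) : Prop where
  times : c.queryTimes ⊆ Finset.Icc 1 n
  log : ∀ x ∈ m.log, x.1 ∈ c.queryTimes
  syncs : ∀ τ < n, X.Sync τ → τ + 1 ∈ c.queryTimes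
  queries : c.queries + m.pending ≤ X.asked n + faults X.r t X.B
  indices : c.indices + 2 * m.pending ≤ X.asked n + 2 * faults X.r t X.B

/-- The candidates are the pages that are absent from the cache of Belady's algorithm at time `t`,
up to its faults since the last query and the errors of the queries. -/
structure CandidateInv (t : ℕ) (m : Memory Page) : Prop where
  candidates_subset : m.candidates ⊆ m.cache
  missed : ((m.cache \ X.B t) \ m.candidates).card ≤ m.pending + X.logErr m.log
  wrong : (m.candidates ∩ X.B t).card ≤ X.logErr m.log

/-- The execution agrees with Belady's algorithm after `t` requests. -/
structure Agrees (t : ℕ) (m : Memory Page) (c : Config Page) : Prop where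
  cache : m.cache = X.B t
  cost : c.cost = faults X.r t X.B
  avoidable : m.avoidable = false

/-- The invariant of an execution after `t` requests. -/
structure Inv (t : ℕ) (m : Memory Page) (c : Config Page) : Prop extends
    X.Tracks t m c, X.Accounts t t m c, X.CandidateInv t m where
  diff : (m.cache \ X.B t).card ≤ 2 * (X.phase t).prevFaults + (X.phase t).curFaults
  marked : X.marked t \ m.cache ⊆ m.dropped
  good : m.avoidable = false → (X.marked t \ m.cache).card ≤ (X.phase t).curFaults
  exact : receivedError X.pred X.B c = 0 → X.Agrees t m c

/-- The part of the invariant while request `t` is processed that does not depend on the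
candidates. -/
structure PendingInv (t : ℕ) (m : Memory Page) (c : Config Page) : Prop extends
    X.Tracks (t + 1) m c where
  diff : (m.cache \ X.B (t + 1)).card ≤ X.quota t
  marked : (X.marked (t + 1)).erase (X.r t) \ m.cache ⊆ m.dropped
  again : ¬X.Starts t → X.r t ∈ X.marked t → X.r t ∉ m.cache → X.r t ∈ m.dropped
  good : m.avoidable = false →
    ((X.marked (t + 1)).erase (X.r t) \ m.cache).card + (X.fault t).toNat ≤
      (X.phase (t + 1)).curFaults

/-- What holds after the bookkeeping for request `t`. -/
structure AdvInv (t : ℕ) (m : Memory Page) (c : Config Page) : Prop extends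
    X.PendingInv t m c, X.Accounts t (t + 1) m c where
  candidateInv : ¬X.StartsWindow t → X.CandidateInv (t + 1) m
  pending : (X.fault t).toNat ≤ m.pending
  exact : receivedError X.pred X.B c = 0 →
    X.Agrees t m c ∧ (¬X.StartsWindow t → m.candidates = ∅)

/-- What holds just before request `t` is served. -/
structure MidInv (t : ℕ) (m : Memory Page) (c : Config Page) : Prop extends
    X.PendingInv t m c, X.Accounts (t + 1) (t + 1) m c, X.CandidateInv (t + 1) m where
  pending : X.r t ∉ m.cache → m.pending ≤ m.candidates.card
  exact : receivedError X.pred X.B c = 0 → X.Agrees t m c ∧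
    (X.fault t = true → m.candidates.Nonempty ∧ m.candidates ⊆ X.B t \ X.B (t + 1))

/-- The potential after `t` requests, including the cost so far. -/
noncomputable def potential (μ : ℕ) (w : ℝ) (t : ℕ) (m : Memory Page) (c : Config Page) : ℝ :=
  c.cost + 6 * (m.cache \ X.B t).card + m.dropped.card + (X.marked t \ m.cache).card +
    36 * m.pending + 18 * (X.phase t).curFaults +
    3 * X.pot μ t (X.phase t).idx (X.phase t).windowIdx m.cache m.dropped (X.logErr m.log) +
    36 * w * X.credit c + 63 * X.faultsFrom t

/-- The potential while request `t` is processed; `cw` is the window up to which the candidates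
were refreshed. -/
noncomputable def midPotential (μ : ℕ) (w : ℝ) (t cw : ℕ) (m : Memory Page) (c : Config Page) :
    ℝ :=
  c.cost + 6 * (m.cache \ X.B (t + 1)).card + m.dropped.card +
    ((X.marked (t + 1)).erase (X.r t) \ m.cache).card +
    36 * m.pending + 18 * (X.phase (t + 1)).curFaults +
    3 * X.pot μ t (X.phaseIdx t) cw m.cache m.dropped (X.logErr m.log) +
    36 * w * X.credit c + 63 * X.faultsFrom (t + 1) + 3 * (X.fault t).toNat

/-- The memory after the bookkeeping for request `t`. -/
noncomputable def adv (t : ℕ) (m : Memory Page) : Memory Page :=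
  m.advance X.k X.level (X.r t) (X.fault t)

/-- The configuration after the bookkeeping for request `t`. -/
def advCfg (t : ℕ) (m : Memory Page) (c : Config Page) : Config Page :=
  if X.Starts t ∧ m.avoidable = true then
    { c with cache := X.marked t, cost := c.cost + (X.marked t \ m.cache).card } else c

/-- The configuration after a query for `n` pages. -/
def queryCfg (t : ℕ) (c : Config Page) (n : ℕ) : Config Page :=
  { c with
    queries := c.queries + 1
    indices := c.indices + (X.pred.report (t + 1) c.cache n).card
    queryTimes := insert (t + 1) c.queryTimes }

end Defs

variable {X : Scenario Page} {t n μ : ℕ} {w : ℝ} {m : Memory Page} {c : Config Page}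
  {A : Finset Page} {l : List (ℕ × ℕ)}

theorem fault_eq_false_iff : X.fault t = false ↔ X.r t ∈ X.B t := by
  simp [fault]

theorem fault_eq_true_iff : X.fault t = true ↔ X.r t ∉ X.B t := by
  simp [fault]

theorem faults_fault_succ (t : ℕ) :
    faults X.r (t + 1) X.B = faults X.r t X.B + (X.fault t).toNat := faults_succ _ _ _

theorem faultsFrom_eq (ht : t < X.T) :
    X.faultsFrom t = X.faultsFrom (t + 1) + (X.fault t).toNat := by
  unfold faultsFrom
  rw [← Finset.insert_Ico_succ_left_eq_Ico ht, Finset.filter_insert]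
  cases X.fault t <;> simp

theorem asked_succ_of_sync (h : X.Sync t) : X.asked (t + 1) = X.asked t + X.quota t := by
  unfold asked
  rw [Finset.range_add_one, Finset.filter_insert, if_pos h, Finset.sum_insert (by simp), add_comm]

theorem asked_succ_of_not_sync (h : ¬X.Sync t) : X.asked (t + 1) = X.asked t := by
  unfold asked
  rw [Finset.range_add_one, Finset.filter_insert, if_neg h]

theorem card_sdiff_B_succ_le (ht : t < X.T) (A : Finset Page) :
    (A \ X.B (t + 1)).card ≤ (A \ X.B t).card + (X.fault t).toNat :=
  calc (A \ X.B (t + 1)).card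
      ≤ ((A \ X.B t) ∪ (X.B t \ X.B (t + 1))).card := Finset.card_le_card (by grind)
    _ ≤ (A \ X.B t).card + (X.B t \ X.B (t + 1)).card := Finset.card_union_le _ _
    _ ≤ (A \ X.B t).card + (X.fault t).toNat :=
      Nat.add_le_add_left (X.lazyRun.card_sdiff_succ_le ht) _

theorem phaseIdx_ne_of_starts {s : ℕ} (h : X.Starts t) (hts : t ≤ s) :
    X.phaseIdx s ≠ (X.phase t).idx := by
  have hmono : X.phaseIdx t ≤ X.phaseIdx s := phase_idx_mono (Nat.succ_le_succ hts)
  rw [phaseIdx_of_starts h] at hmono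
  lia

theorem windowIdx_ne_of_startsWindow {s : ℕ} (h : X.StartsWindow t) (hts : t ≤ s) :
    X.windowIdx s ≠ (X.phase t).windowIdx := by
  have hmono : X.windowIdx t ≤ X.windowIdx s := phase_windowIdx_mono (Nat.succ_le_succ hts)
  rw [windowIdx, phase_windowIdx_succ, if_pos h] at hmono
  lia

theorem windowIdx_of_not_startsWindow (h : ¬X.StartsWindow t) :
    X.windowIdx t = (X.phase t).windowIdx := if_neg h

theorem erase_marked_succ_of_starts (h : X.Starts t) : (X.marked (t + 1)).erase (X.r t) = ∅ := by
  simp [marked_succ_of_starts h]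

theorem erase_marked_succ_sdiff_subset (h : ¬X.Starts t) (A : Finset Page) :
    (X.marked (t + 1)).erase (X.r t) \ A ⊆ X.marked t \ A := by
  rw [marked_succ_of_not_starts h]
  exact Finset.sdiff_subset_sdiff (Finset.erase_insert_subset _ _) le_rfl

theorem logErr_cons (x : ℕ × ℕ) (l : List (ℕ × ℕ)) :
    X.logErr (x :: l) = min (X.predError x.1) x.2 + X.logErr l := rfl

theorem receivedError_eq_zero_iff :
    receivedError X.pred X.B c = 0 ↔ ∀ τ ∈ c.queryTimes, X.predError τ = 0 :=
  Finset.sum_eq_zero_iff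

theorem Accounts.logErr_eq_zero {n t : ℕ} (h : X.Accounts n t m c)
    (he : receivedError X.pred X.B c = 0) : X.logErr m.log = 0 := by
  refine List.sum_eq_zero fun e hmem => ?_
  obtain ⟨x, hx, rfl⟩ := List.mem_map.1 hmem
  simp [receivedError_eq_zero_iff.1 he _ (h.log x hx)]

theorem CandidateInv.card_cache_sdiff_le (h : X.CandidateInv t m) :
    (m.cache \ X.B t).card ≤ m.candidates.card + m.pending + X.logErr m.log := by
  have := Finset.le_card_sdiff m.candidates (m.cache \ X.B t)
  have := h.missed
  lia

theorem adv_cache (h : X.Tracks t m c) : (X.adv t m).cache =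
    if X.Starts t ∧ m.avoidable = true then X.marked t else m.cache := by
  simp only [adv, Memory.advance, h.phase]; rfl

theorem adv_cache_of_not_starts (h : X.Tracks t m c) (hs : ¬X.Starts t) :
    (X.adv t m).cache = m.cache := by
  rw [adv_cache h, if_neg fun hb => hs hb.1]

theorem adv_dropped (h : X.Tracks t m c) :
    (X.adv t m).dropped = if X.Starts t then ∅ else m.dropped := by
  simp only [adv, Memory.advance, h.phase]; rfl

theorem adv_avoidable (h : X.Tracks t m c) :
    (X.adv t m).avoidable = if X.Starts t then false else m.avoidable := by
  simp only [adv, Memory.advance, h.phase]; rfl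

theorem advCfg_of_not_starts (hs : ¬X.Starts t) : X.advCfg t m c = c := if_neg fun hb => hs hb.1

theorem advCfg_counters (t : ℕ) (m : Memory Page) (c : Config Page) :
    (X.advCfg t m c).queryTimes = c.queryTimes ∧ (X.advCfg t m c).queries = c.queries ∧
    (X.advCfg t m c).indices = c.indices ∧ (X.advCfg t m c).unserved = c.unserved := by
  unfold advCfg; split_ifs <;> simp

theorem Tracks.adv (h : X.Tracks t m c) : X.Tracks (t + 1) (X.adv t m) (X.advCfg t m c) where
  init := h.init
  hist := by simp [Scenario.adv, Memory.advance, h.hist, List.range_succ]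
  phase := by simp only [Scenario.adv, Memory.advance, h.phase]; rfl
  cache := by
    rw [adv_cache h, advCfg]
    split_ifs
    exacts [rfl, h.cache]
  card := by
    rw [adv_cache h]
    split_ifs with hb
    exacts [hb.1.2, h.card]
  served := (advCfg_counters t m c).2.2.2.trans h.served

theorem Accounts.adv (h : X.Accounts t t m c) :
    X.Accounts t (t + 1) (X.adv t m) (X.advCfg t m c) := by
  obtain ⟨htimes, hqueries, hindices, -⟩ := advCfg_counters (X := X) t m c
  have hpending : (X.adv t m).pending = m.pending + (X.fault t).toNat := rfl
  exact
    { times := htimes ▸ h.times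
      log := htimes ▸ h.log
      syncs := htimes ▸ h.syncs
      queries := by have := h.queries; rw [hqueries, hpending, faults_fault_succ]; lia
      indices := by have := h.indices; rw [hindices, hpending, faults_fault_succ]; lia }

theorem CandidateInv.adv (h : X.CandidateInv t m) (htracks : X.Tracks t m c) (ht : t < X.T)
    (hs : ¬X.Starts t) : X.CandidateInv (t + 1) (X.adv t m) where
  candidates_subset := by
    rw [adv_cache_of_not_starts htracks hs]
    exact (Finset.erase_subset _ _).trans h.candidates_subset
  missed := by
    have hsub : (m.cache \ X.B (t + 1)) \ (X.adv t m).candidates ⊆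
        ((m.cache \ X.B t) \ m.candidates) ∪ (X.B t \ X.B (t + 1)) := by
      have := X.lazyRun.mem_succ ht
      simp only [Scenario.adv, Memory.advance]
      grind
    have hloss : (X.B t \ X.B (t + 1)).card ≤ (X.fault t).toNat := X.lazyRun.card_sdiff_succ_le ht
    calc (((X.adv t m).cache \ X.B (t + 1)) \ (X.adv t m).candidates).card
        ≤ ((m.cache \ X.B t) \ m.candidates).card + (X.B t \ X.B (t + 1)).card := by
          rw [adv_cache_of_not_starts htracks hs]
          exact (Finset.card_le_card hsub).trans (Finset.card_union_le _ _)
      _ ≤ (m.pending + X.logErr m.log) + (X.fault t).toNat := add_le_add h.missed hloss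
      _ = (m.pending + (X.fault t).toNat) + X.logErr m.log := by ring
  wrong := by
    refine (Finset.card_le_card fun x hx => ?_).trans h.wrong
    obtain ⟨hx, hxB⟩ := Finset.mem_inter.1 hx
    obtain ⟨hne, hx⟩ := Finset.mem_erase.1 hx
    exact Finset.mem_inter.2
      ⟨hx, (Finset.mem_insert.1 (X.lazyRun.succ_subset ht hxB)).resolve_left hne⟩

/-- When the last phase had no avoidable fault, the cache contains its marked pages up to Belady's
faults; otherwise the cache is replaced by the marked pages. -/
theorem Inv.card_adv_cache_sdiff_le (h : X.Inv t m c) (ht : t < X.T) (hs : X.Starts t) :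
    ((X.adv t m).cache \ X.B t).card ≤ 2 * (X.phase t).curFaults := by
  have hmarked : (X.marked t \ X.B t).card ≤ (X.phase t).curFaults := card_marked_sdiff_B ht.le
  have hcomm : (m.cache \ X.marked t).card = (X.marked t \ m.cache).card :=
    Finset.card_sdiff_comm (h.card.trans hs.2.symm)
  rw [adv_cache h.toTracks]
  split_ifs with hb
  · lia
  · calc (m.cache \ X.B t).card
        ≤ ((m.cache \ X.marked t) ∪ (X.marked t \ X.B t)).card := Finset.card_le_card (by grind)
      _ ≤ (X.marked t \ m.cache).card + (X.marked t \ X.B t).card := by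
          rw [← hcomm]
          exact Finset.card_union_le _ _
      _ ≤ 2 * (X.phase t).curFaults := by
          have := h.good (by simpa [hs] using hb)
          lia

theorem Inv.card_adv_cache_sdiff_le_quota (h : X.Inv t m c) (ht : t < X.T) :
    ((X.adv t m).cache \ X.B (t + 1)).card ≤ X.quota t := by
  refine (card_sdiff_B_succ_le ht _).trans ?_
  rw [quota, phase_prevFaults_succ, phase_curFaults_succ]
  by_cases hs : X.Starts t
  · have := h.card_adv_cache_sdiff_le ht hs
    rw [if_pos hs, if_pos hs]
    lia
  · have := h.diff
    rw [adv_cache_of_not_starts h.toTracks hs, if_neg hs, if_neg hs]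
    lia

theorem Inv.pendingInv_adv (h : X.Inv t m c) (ht : t < X.T) :
    X.PendingInv t (X.adv t m) (X.advCfg t m c) where
  toTracks := h.toTracks.adv
  diff := h.card_adv_cache_sdiff_le_quota ht
  marked := by
    by_cases hs : X.Starts t
    · simp [erase_marked_succ_of_starts hs]
    · rw [adv_cache_of_not_starts h.toTracks hs, adv_dropped h.toTracks, if_neg hs]
      exact (erase_marked_succ_sdiff_subset hs _).trans h.marked
  again hs hmem hr := by
    rw [adv_cache_of_not_starts h.toTracks hs] at hr
    rw [adv_dropped h.toTracks, if_neg hs]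
    exact h.marked (Finset.mem_sdiff.2 ⟨hmem, hr⟩)
  good hb := by
    rw [phase_curFaults_succ]
    by_cases hs : X.Starts t
    · simp [erase_marked_succ_of_starts hs]
    · rw [adv_avoidable h.toTracks, if_neg hs] at hb
      rw [adv_cache_of_not_starts h.toTracks hs, if_neg hs]
      exact Nat.add_le_add_right ((Finset.card_le_card (erase_marked_succ_sdiff_subset hs _)).trans
        (h.good hb)) _

theorem Inv.candidates_eq_empty (h : X.Inv t m c) (he : receivedError X.pred X.B c = 0) :
    m.candidates = ∅ := by
  have hwrong := h.wrong
  rwa [h.logErr_eq_zero he, Nat.le_zero, Finset.card_eq_zero, ← (h.exact he).cache,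
    Finset.inter_eq_left.2 h.candidates_subset] at hwrong

theorem Inv.agrees_adv (h : X.Inv t m c) (he : receivedError X.pred X.B c = 0) :
    X.Agrees t (X.adv t m) (X.advCfg t m c) := by
  have hagrees := h.exact he
  have hb : ¬(X.Starts t ∧ m.avoidable = true) := by simp [hagrees.avoidable]
  exact
    { cache := by rw [adv_cache h.toTracks, if_neg hb, hagrees.cache]
      cost := by rw [advCfg, if_neg hb, hagrees.cost]
      avoidable := by rw [adv_avoidable h.toTracks, hagrees.avoidable, ite_self] }

theorem Inv.advInv (h : X.Inv t m c) (ht : t < X.T) :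
    X.AdvInv t (X.adv t m) (X.advCfg t m c) where
  toPendingInv := h.pendingInv_adv ht
  toAccounts := h.toAccounts.adv
  candidateInv hw := h.toCandidateInv.adv h.toTracks ht fun hs => hw hs.startsWindow
  pending := Nat.le_add_left _ _
  exact he := by
    rw [receivedError, (advCfg_counters t m c).1] at he
    refine ⟨h.agrees_adv he, fun _ => ?_⟩
    simp only [Scenario.adv, Memory.advance, h.candidates_eq_empty he, Finset.erase_empty]

theorem credit_advCfg (t : ℕ) (m : Memory Page) (c : Config Page) :
    X.credit (X.advCfg t m c) = X.credit c := by
  rw [credit, (advCfg_counters t m c).1, credit]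

theorem Inv.midPotential_adv_le_of_not_starts (h : X.Inv t m c) (ht : t < X.T) (hs : ¬X.Starts t)
    (μ : ℕ) (w : ℝ) :
    X.midPotential μ w t (X.phase t).windowIdx (X.adv t m) (X.advCfg t m c) ≤
      X.potential μ w t m c := by
  have hdiff : ((m.cache \ X.B (t + 1)).card : ℝ) ≤
      (m.cache \ X.B t).card + (X.fault t).toNat := mod_cast card_sdiff_B_succ_le ht _
  have hmarked : (((X.marked (t + 1)).erase (X.r t) \ m.cache).card : ℝ) ≤
      (X.marked t \ m.cache).card :=
    mod_cast Finset.card_le_card (erase_marked_succ_sdiff_subset hs _)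
  have hpending : (X.adv t m).pending = m.pending + (X.fault t).toNat := rfl
  have hlog : (X.adv t m).log = m.log := rfl
  unfold midPotential potential
  rw [faultsFrom_eq ht, hpending, hlog, phase_curFaults_succ, advCfg_of_not_starts hs,
    adv_cache_of_not_starts h.toTracks hs, adv_dropped h.toTracks, if_neg hs, if_neg hs,
    phaseIdx_of_not_starts hs]
  push_cast
  linarith

theorem Inv.pot_adv_le_of_starts (h : X.Inv t m c) (ht : t < X.T) (hs : X.Starts t) (μ e : ℕ) :
    X.pot μ t (X.phaseIdx t) (X.phase t).windowIdx (X.adv t m).cache (X.adv t m).dropped e ≤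
      X.pot μ t (X.phase t).idx (X.phase t).windowIdx m.cache m.dropped e +
        2 * (X.phase t).curFaults := by
  have hB : (((X.B t) \ (X.adv t m).cache).card : ℝ) ≤ 2 * (X.phase t).curFaults := by
    rw [Finset.card_sdiff_comm ((X.card_B ht.le).trans h.toTracks.adv.card.symm)]
    exact_mod_cast h.card_adv_cache_sdiff_le ht hs
  refine (pot_new_phase_le (cp := (X.phase t).idx) (A := m.cache) (D := m.dropped)
    (fun s hts => phaseIdx_ne_of_starts hs hts)
    (fun s hts => windowIdx_ne_of_startsWindow hs.startsWindow hts) fun s hmem hi => ?_).trans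
    (add_le_add_right hB _)
  obtain ⟨⟨hts, hsT⟩, hr⟩ := mem_slots.1 hmem
  rcases hts.eq_or_lt with rfl | hts
  · exact (Finset.mem_sdiff.1 hr).1
  · exact (Finset.mem_sdiff.1 (Finset.mem_of_mem_erase (fresh_subset_erase hts hsT hi hr))).1

theorem cost_advCfg_le (t : ℕ) (m : Memory Page) (c : Config Page) :
    (X.advCfg t m c).cost ≤ c.cost + (X.marked t \ m.cache).card := by
  unfold advCfg
  split_ifs
  exacts [le_rfl, Nat.le_add_right _ _]

theorem Inv.midPotential_adv_le_of_starts (h : X.Inv t m c) (ht : t < X.T) (hs : X.Starts t)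
    (μ : ℕ) (w : ℝ) :
    X.midPotential μ w t (X.phase t).windowIdx (X.adv t m) (X.advCfg t m c) ≤
      X.potential μ w t m c := by
  have hcost : ((X.advCfg t m c).cost : ℝ) ≤ c.cost + (X.marked t \ m.cache).card :=
    mod_cast cost_advCfg_le t m c
  have hdiff : (((X.adv t m).cache \ X.B (t + 1)).card : ℝ) ≤
      2 * (X.phase t).curFaults + (X.fault t).toNat :=
    mod_cast (card_sdiff_B_succ_le ht _).trans
      (Nat.add_le_add_right (h.card_adv_cache_sdiff_le ht hs) _)
  have hpot := h.pot_adv_le_of_starts ht hs μ (X.logErr m.log)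
  have hdropped : (X.adv t m).dropped.card = 0 := by
    rw [adv_dropped h.toTracks, if_pos hs, Finset.card_empty]
  have hpending : (X.adv t m).pending = m.pending + (X.fault t).toNat := rfl
  have hlog : (X.adv t m).log = m.log := rfl
  unfold midPotential potential
  rw [faultsFrom_eq ht, hpending, hlog, credit_advCfg, phase_curFaults_succ, if_pos hs, hdropped,
    erase_marked_succ_of_starts hs, Finset.empty_sdiff, Finset.card_empty]
  push_cast
  linarith [(m.cache \ X.B t).card.cast_nonneg (α := ℝ), m.dropped.card.cast_nonneg (α := ℝ)]

theorem Inv.midPotential_adv_le (h : X.Inv t m c) (ht : t < X.T) (μ : ℕ) (w : ℝ) :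
    X.midPotential μ w t (X.phase t).windowIdx (X.adv t m) (X.advCfg t m c) ≤
      X.potential μ w t m c := by
  by_cases hs : X.Starts t
  exacts [h.midPotential_adv_le_of_starts ht hs μ w, h.midPotential_adv_le_of_not_starts ht hs μ w]

theorem card_report_le (t : ℕ) (A : Finset Page) (n : ℕ) : (X.pred.report t A n).card ≤ n :=
  (X.pred.card_report t A n).trans_le (min_le_left _ _)

theorem card_report_inter_B_le (t : ℕ) (A : Finset Page) (n : ℕ) :
    (X.pred.report t A n ∩ X.B t).card ≤ min (X.predError t) n := by
  refine le_min (Finset.card_le_card fun x hx => ?_)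
    ((Finset.card_le_card Finset.inter_subset_left).trans (card_report_le t A n))
  obtain ⟨hx, hxB⟩ := Finset.mem_inter.1 hx
  exact Finset.mem_sdiff.2 ⟨hxB, (Finset.mem_sdiff.1 (X.pred.report_subset t A n hx)).2⟩

theorem card_sdiff_report_le {e : ℕ} (ht : t ≤ X.T) (hn : (A \ X.B t).card ≤ n + e) :
    ((A \ X.B t) \ X.pred.report t A n).card ≤ e + min (X.predError t) n := by
  set R := X.pred.report t A n
  have hsub : R ⊆ A \ X.pred.state t := X.pred.report_subset t A n
  have hcard : R.card = min n (A \ X.pred.state t).card := X.pred.card_report t A n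
  have hle : ((A \ X.B t) \ R).card ≤ (A \ X.B t).card := Finset.card_le_card Finset.sdiff_subset
  rcases le_total n (A \ X.pred.state t).card with hc | hc
  · have hsplit : ((A \ X.B t) \ R).card + (R \ X.B t).card = (A \ X.B t).card := by
      rw [show (A \ X.B t) \ R = (A \ X.B t) \ (R \ X.B t) by grind]
      exact Finset.card_sdiff_add_card_eq_card (by grind)
    have hwrong : (R ∩ X.B t).card ≤ min (X.predError t) n := card_report_inter_B_le t A n
    have := Finset.card_inter_add_card_sdiff R (X.B t)
    lia
  · have hall : R = A \ X.pred.state t := Finset.eq_of_subset_of_card_le hsub (by lia)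
    have herror : (X.pred.state t \ X.B t).card = X.predError t :=
      Finset.card_sdiff_comm ((X.pred.card_state t).trans (X.card_B ht).symm)
    have : ((A \ X.B t) \ R).card ≤ (X.pred.state t \ X.B t).card :=
      Finset.card_le_card (by grind)
    lia

theorem credit_queryCfg (ht : t < X.T) (h : c.queryTimes ⊆ Finset.Icc 1 t) (n : ℕ) :
    X.credit (X.queryCfg t c n) + X.predError (t + 1) = X.credit c := by
  have hnotMem : t + 1 ∉ c.queryTimes := fun hmem => by grind
  have hmem : t + 1 ∈ Finset.Icc 1 X.T \ c.queryTimes := by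
    simpa [hnotMem] using ht
  simp only [credit, queryCfg, Finset.sdiff_insert]
  exact Finset.sum_erase_add _ _ hmem

theorem PendingInv.refresh {c' : Config Page} (h : X.PendingInv t m c) (R : Finset Page)
    (l : List (ℕ × ℕ)) (hcache : c'.cache = c.cache) (hserved : c'.unserved = c.unserved) :
    X.PendingInv t (m.refresh R l) c' where
  init := h.init
  hist := h.hist
  phase := h.phase
  cache := hcache.trans h.cache
  card := h.card
  served := hserved.trans h.served
  diff := h.diff
  marked := h.marked
  again := h.again
  good := h.good

theorem Accounts.query (h : X.Accounts t (t + 1) m c) (hl : l ⊆ m.log) (R : Finset Page)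
    (hqueries : X.asked t + 1 ≤ X.asked (t + 1) + m.pending)
    (hindices : X.asked t + n ≤ X.asked (t + 1) + 2 * m.pending) :
    X.Accounts (t + 1) (t + 1) (m.refresh R ((t + 1, n) :: l)) (X.queryCfg t c n) where
  times := Finset.insert_subset (by simp)
    (h.times.trans (Finset.Icc_subset_Icc_right t.le_succ))
  log := List.forall_mem_cons.2 ⟨Finset.mem_insert_self _ _,
    fun x hx => Finset.mem_insert_of_mem (h.log x (hl hx))⟩
  syncs τ hτ hs := (Nat.lt_succ_iff_lt_or_eq.1 hτ).elim
    (fun hτ => Finset.mem_insert_of_mem (h.syncs τ hτ hs)) (fun hτ => by simp [queryCfg, hτ])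
  queries := by have := h.queries; simp only [Memory.refresh, queryCfg]; lia
  indices := by
    have := h.indices
    have := card_report_le (X := X) (t + 1) c.cache n
    simp only [Memory.refresh, queryCfg]
    lia

theorem Accounts.skip {m' : Memory Page} (h : X.Accounts t (t + 1) m c) (hs : ¬X.Sync t)
    (hlog : m'.log ⊆ m.log) (hpending : m'.pending ≤ m.pending) :
    X.Accounts (t + 1) (t + 1) m' c where
  times := h.times.trans (Finset.Icc_subset_Icc_right t.le_succ)
  log x hx := h.log x (hlog hx)
  syncs τ hτ hτs := (Nat.lt_succ_iff_lt_or_eq.1 hτ).elim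
    (fun hτ => h.syncs τ hτ hτs) (fun hτ => absurd (hτ ▸ hτs) hs)
  queries := by have := h.queries; rw [asked_succ_of_not_sync hs]; lia
  indices := by have := h.indices; rw [asked_succ_of_not_sync hs]; lia

theorem candidateInv_query (ht : t < X.T)
    (hn : (m.cache \ X.B (t + 1)).card ≤ n + X.logErr l) :
    X.CandidateInv (t + 1)
      (m.refresh (X.pred.report (t + 1) m.cache n) ((t + 1, n) :: l)) where
  candidates_subset := (X.pred.report_subset _ _ _).trans Finset.sdiff_subset
  missed := by
    simp only [Memory.refresh, logErr_cons]
    exact (card_sdiff_report_le ht hn).trans (by lia)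
  wrong := by
    simp only [Memory.refresh, logErr_cons]
    exact (card_report_inter_B_le _ _ _).trans (by lia)

/-- An error-free prediction reports the page evicted by Belady's algorithm. -/
theorem report_B (ht : t < X.T) (he : X.predError (t + 1) = 0) (hf : X.fault t = true)
    (hn : 0 < n) : (X.pred.report (t + 1) (X.B t) n).Nonempty ∧
      X.pred.report (t + 1) (X.B t) n ⊆ X.B t \ X.B (t + 1) := by
  have hstate : X.B (t + 1) = X.pred.state (t + 1) :=
    Finset.eq_of_subset_of_card_le
      (Finset.sdiff_eq_empty_iff_subset.1 (Finset.card_eq_zero.1 he))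
      ((X.pred.card_state _).trans (X.card_B ht).symm).le
  have hloss : 0 < (X.B t \ X.B (t + 1)).card := by
    rw [Finset.card_sdiff_comm ((X.card_B ht.le).trans (X.card_B ht).symm)]
    exact Finset.card_pos.2
      ⟨X.r t, Finset.mem_sdiff.2 ⟨X.lazyRun.mem_succ ht, fault_eq_true_iff.1 hf⟩⟩
  refine ⟨Finset.card_pos.1 ?_, hstate ▸ X.pred.report_subset _ _ _⟩
  rw [X.pred.card_report, ← hstate]
  exact lt_min hn hloss

theorem AdvInv.midInv_query (h : X.AdvInv t m c) (ht : t < X.T) (hn : 0 < n) (hl : l ⊆ m.log)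
    (hdiff : (m.cache \ X.B (t + 1)).card ≤ n + X.logErr l)
    (hqueries : X.asked t + 1 ≤ X.asked (t + 1) + m.pending)
    (hindices : X.asked t + n ≤ X.asked (t + 1) + 2 * m.pending) :
    X.MidInv t (m.refresh (X.pred.report (t + 1) m.cache n) ((t + 1, n) :: l))
      (X.queryCfg t c n) where
  toPendingInv := h.toPendingInv.refresh _ _ rfl rfl
  toAccounts := h.toAccounts.query hl _ hqueries hindices
  toCandidateInv := candidateInv_query ht hdiff
  pending _ := Nat.zero_le _
  exact he := by
    obtain ⟨hnow, hearlier⟩ := (Finset.forall_mem_insert _ _ _).1 (receivedError_eq_zero_iff.1 he)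
    obtain ⟨hagrees, -⟩ := h.exact (receivedError_eq_zero_iff.2 hearlier)
    exact ⟨⟨hagrees.cache, hagrees.cost, hagrees.avoidable⟩,
      fun hf => hagrees.cache ▸ report_B ht hnow hf hn⟩

theorem AdvInv.midInv_of_quota_eq_zero (h : X.AdvInv t m c) (hquota : X.quota t = 0) :
    X.MidInv t (m.refresh ∅ []) c where
  toPendingInv := h.toPendingInv.refresh _ _ rfl rfl
  toAccounts := h.toAccounts.skip (fun hs => hs.2.ne' hquota) (List.nil_subset _) (Nat.zero_le _)
  candidates_subset := Finset.empty_subset _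
  missed := by
    have hcard : (m.cache \ X.B (t + 1)).card = 0 := Nat.le_zero.1 (h.diff.trans_eq hquota)
    simp [Memory.refresh, Finset.card_eq_zero.1 hcard]
  wrong := by simp [Memory.refresh]
  pending _ := Nat.zero_le _
  exact he := by
    obtain ⟨hagrees, -⟩ := h.exact he
    refine ⟨⟨hagrees.cache, hagrees.cost, hagrees.avoidable⟩, fun hf => ?_⟩
    rw [quota, phase_curFaults_succ, hf, Bool.toNat_true] at hquota
    lia

theorem AdvInv.midInv_of_not_needsPatch (h : X.AdvInv t m c) (hw : ¬X.StartsWindow t)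
    (hpatch : ¬m.NeedsPatch (X.r t)) : X.MidInv t m c where
  toPendingInv := h.toPendingInv
  toAccounts := h.toAccounts.skip (fun hs => hw hs.1) (List.Subset.refl _) le_rfl
  toCandidateInv := h.candidateInv hw
  pending hr := by
    by_contra! hlt
    exact hpatch ⟨hr, by lia, hlt.le⟩
  exact he := by
    obtain ⟨hagrees, hcandidates⟩ := h.exact he
    refine ⟨hagrees, fun hf => absurd ⟨?_, ?_, ?_⟩ hpatch⟩
    · exact hagrees.cache ▸ fault_eq_true_iff.1 hf
    · simpa [hf] using h.pending
    · simp [hcandidates hw]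

theorem AdvInv.midInv_patch (h : X.AdvInv t m c) (ht : t < X.T) (hw : ¬X.StartsWindow t)
    (hpatch : m.NeedsPatch (X.r t)) (hn : n = m.candidates.card + m.pending) :
    X.MidInv t (m.refresh (X.pred.report (t + 1) m.cache n) ((t + 1, n) :: m.log))
      (X.queryCfg t c n) := by
  have hasked : X.asked (t + 1) = X.asked t := asked_succ_of_not_sync fun hs => hw hs.1
  obtain ⟨-, hpending, hcard⟩ := hpatch
  exact h.midInv_query ht (by lia) (List.Subset.refl _)
    (hn ▸ (h.candidateInv hw).card_cache_sdiff_le) (by lia) (by lia)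

theorem AdvInv.midInv_sync (h : X.AdvInv t m c) (ht : t < X.T) (hs : X.Sync t) :
    X.MidInv t (m.refresh (X.pred.report (t + 1) m.cache (X.quota t)) [(t + 1, X.quota t)])
      (X.queryCfg t c (X.quota t)) := by
  have hasked := asked_succ_of_sync hs
  have hpos := hs.2
  exact h.midInv_query ht hpos (List.nil_subset _) h.diff (by lia) (by lia)

theorem predError_le_windowErr (ht : t < X.T) (hs : X.Sync t) :
    X.predError (t + 1) ≤ X.windowErr (X.windowIdx t) :=
  Finset.single_le_sum (f := fun τ => X.predError (τ + 1)) (fun _ _ => Nat.zero_le _)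
    (by simp [ht, hs])

theorem midPotential_refresh_le_of_startsWindow {c' : Config Page} (hw₀ : 0 ≤ w)
    (hw : X.StartsWindow t) (hl : X.logErr l ≤ X.windowErr (X.windowIdx t))
    (hcost : c'.cost = c.cost) (hcredit : X.credit c' ≤ X.credit c) (μ : ℕ) (R : Finset Page) :
    X.midPotential μ w t (X.windowIdx t) (m.refresh R l) c' ≤
      X.midPotential μ w t (X.phase t).windowIdx m c := by
  have hpot := pot_refresh_le (μ := μ) (cp := X.phaseIdx t) (A := m.cache) (D := m.dropped)
    (e := X.logErr m.log) (fun s hts => windowIdx_ne_of_startsWindow hw hts) hl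
  have hcredit : 36 * w * X.credit c' ≤ 36 * w * X.credit c := by gcongr
  have hpending : ((m.refresh R l).pending : ℝ) = 0 := Nat.cast_zero
  simp only [midPotential, hcost, hpending]
  simp only [Memory.refresh]
  linarith [m.pending.cast_nonneg (α := ℝ)]

theorem AdvInv.midPotential_patch_le (h : X.AdvInv t m c) (ht : t < X.T)
    (hw : ∀ j, levelSum X.k X.level μ j ≤ w) (hpatch : m.NeedsPatch (X.r t))
    (hn : n = m.candidates.card + m.pending) (R : Finset Page) :
    X.midPotential μ w t (X.windowIdx t) (m.refresh R ((t + 1, n) :: m.log)) (X.queryCfg t c n) ≤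
      X.midPotential μ w t (X.windowIdx t) m c := by
  have hw₀ : 0 ≤ w := (levelSum_nonneg _ _ _ _).trans (hw 0)
  set d := min (X.predError (t + 1)) n
  have hpot := pot_raise_le hw t (X.phaseIdx t) (X.windowIdx t) (X.logErr m.log) d m.cache m.dropped
  have hlog : X.logErr ((t + 1, n) :: m.log) = X.logErr m.log + d := add_comm _ _
  have hcredit : (X.credit (X.queryCfg t c n) : ℝ) + X.predError (t + 1) = X.credit c :=
    mod_cast credit_queryCfg ht h.times n
  have hdpending : (d : ℝ) ≤ 2 * m.pending := by
    have := hpatch.2.2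
    exact_mod_cast (by lia : d ≤ 2 * m.pending)
  have hderror : 36 * w * d ≤ 36 * w * X.predError (t + 1) := by
    gcongr
    exact min_le_left _ _
  simp only [midPotential, Memory.refresh, Nat.cast_zero, hlog, ← hcredit]
  simp only [queryCfg] at hpot ⊢
  linarith

theorem exec_query_of_tracks (h : X.Tracks (t + 1) m c)
    (next : Finset Page → Prog Page (Memory Page)) (n : ℕ) :
    exec X.pred (t + 1) (.query n next) c =
      exec X.pred (t + 1) (next (X.pred.report (t + 1) m.cache n)) (X.queryCfg t c n) := by
  rw [exec, queryCfg, h.cache]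

/-- The query at the start of a window and the additional queries preserve the invariant and do not
raise the potential. -/
theorem AdvInv.exists_midInv (h : X.AdvInv t m c) (ht : t < X.T) :
    ∃ m' c', exec X.pred (t + 1)
        (queryAndServe (decide (X.StartsWindow t)) m (X.r t) (X.fault t)) c =
        exec X.pred (t + 1) (serve m' (X.r t) (X.fault t)) c' ∧ X.MidInv t m' c' ∧
      ∀ μ w, (∀ j, levelSum X.k X.level μ j ≤ w) →
        X.midPotential μ w t (X.windowIdx t) m' c' ≤
          X.midPotential μ w t (X.phase t).windowIdx m c := by
  have hlength : m.hist.length = t + 1 := by simp [h.hist]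
  have hquota : m.quota = X.quota t := by simp only [Memory.quota, h.phase, quota]
  unfold queryAndServe
  by_cases hw : X.StartsWindow t
  · rw [decide_eq_true hw, if_pos rfl, hquota]
    split_ifs with hzero
    · exact ⟨_, _, rfl, h.midInv_of_quota_eq_zero hzero, fun μ w hsum =>
        midPotential_refresh_le_of_startsWindow ((levelSum_nonneg _ _ _ _).trans (hsum 0)) hw
          (Nat.zero_le _) rfl le_rfl _ _⟩
    · have hs : X.Sync t := ⟨hw, Nat.pos_of_ne_zero hzero⟩
      rw [exec_query_of_tracks h.toTracks, hlength]
      refine ⟨_, _, rfl, h.midInv_sync ht hs, fun μ w hsum =>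
        midPotential_refresh_le_of_startsWindow (m := m) (c := c)
          (c' := X.queryCfg t c (X.quota t))
          ((levelSum_nonneg _ _ _ _).trans (hsum 0)) hw ?_ rfl ?_ _ _⟩
      · exact (min_le_left _ _).trans (predError_le_windowErr ht hs)
      · exact (Nat.le_add_right _ _).trans_eq (credit_queryCfg ht h.times _)
  · rw [decide_eq_false hw, if_neg Bool.false_ne_true, windowIdx_of_not_startsWindow hw]
    split_ifs with hpatch
    · rw [exec_query_of_tracks h.toTracks, hlength]
      exact ⟨_, _, rfl, h.midInv_patch ht hw hpatch rfl, fun μ w hsum =>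
        windowIdx_of_not_startsWindow hw ▸ h.midPotential_patch_le ht hsum hpatch rfl _⟩
    · exact ⟨_, _, rfl, h.midInv_of_not_needsPatch hw hpatch, fun _ _ _ => le_rfl⟩

theorem Inv.exec_step (h : X.Inv t m c) (ht : t < X.T) :
    exec X.pred (t + 1) ((follower Page X.k X.level).step m (X.r t)) c =
      exec X.pred (t + 1) (queryAndServe (decide (X.StartsWindow t)) (X.adv t m) (X.r t)
        (X.fault t)) (X.advCfg t m c) := by
  have hfault : beladyFaults m.init m.hist (X.r t) = X.fault t := by
    rw [h.init, h.hist]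
    exact beladyFaults_eq X.belady ht
  have hwindow : decide (m.phase.StartsWindow X.k X.level (X.r t)) = decide (X.StartsWindow t) :=
    decide_eq_decide.2 (by rw [h.phase]; rfl)
  have hmarked : m.phase.marked = X.marked t := by rw [h.phase]; rfl
  have hcleanup : (m.phase.Starts X.k (X.r t) ∧ m.avoidable = true) =
      (X.Starts t ∧ m.avoidable = true) := by rw [h.phase]; rfl
  simp only [follower, hfault, hwindow, hmarked, hcleanup, advCfg]
  split_ifs with hb
  · exact exec_cleanup X.pred (t + 1) (hb.1.2.trans h.card.symm) _ h.cache
  · rfl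

theorem Inv.exists_midInv (h : X.Inv t m c) (ht : t < X.T) :
    ∃ m' c', exec X.pred (t + 1) ((follower Page X.k X.level).step m (X.r t)) c =
        exec X.pred (t + 1) (serve m' (X.r t) (X.fault t)) c' ∧ X.MidInv t m' c' ∧
      ∀ μ w, (∀ j, levelSum X.k X.level μ j ≤ w) →
        X.midPotential μ w t (X.windowIdx t) m' c' ≤ X.potential μ w t m c := by
  obtain ⟨m', c', hexec, hmid, hpot⟩ := (h.advInv ht).exists_midInv ht
  exact ⟨m', c', (h.exec_step ht).trans hexec, hmid,
    fun μ w hw => (hpot μ w hw).trans (h.midPotential_adv_le ht μ w)⟩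

end Scenario

end Invariants

/-! ### Serving a request -/

section Serving

variable {Page : Type u} [DecidableEq Page]

namespace Scenario

/-- The configuration after request `t` was served by evicting `q`. -/
def serveCfg (X : Scenario Page) (t : ℕ) (c : Config Page) (q : Page) : Config Page :=
  { c with cache := insert (X.r t) (c.cache.erase q), cost := c.cost + 1 }

variable {X : Scenario Page} {t n μ : ℕ} {w : ℝ} {m : Memory Page} {c : Config Page}
  {A M : Finset Page} {p q : Page}

theorem potential_nonneg (hw : 0 ≤ w) (t : ℕ) (m : Memory Page) (c : Config Page) :
    0 ≤ X.potential μ w t m c := by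
  have := pot_nonneg (X := X) μ t (X.phase t).idx (X.phase t).windowIdx m.cache m.dropped
    (X.logErr m.log)
  unfold potential
  positivity

theorem sdiff_eq_erase_sdiff (hp : p ∈ A) : M \ A = M.erase p \ A := by grind

theorem sdiff_evict_subset : M \ insert p (A.erase q) ⊆ insert q (M.erase p \ A) := by grind

theorem sdiff_evict_subset_of_notMem (hq : q ∉ M) :
    M \ insert p (A.erase q) ⊆ M.erase p \ A := by grind

theorem card_evict_sdiff (hp : p ∈ M) (hq : q ∈ A) :
    (insert p (A.erase q) \ M).card + (if q ∈ M then 0 else 1) = (A \ M).card := by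
  rw [show insert p (A.erase q) \ M = (A \ M).erase q by grind]
  split_ifs with hqM
  · rw [Finset.erase_eq_of_notMem (by simp [hqM]), add_zero]
  · exact Finset.card_erase_add_one (Finset.mem_sdiff.2 ⟨hq, hqM⟩)

theorem Agrees.succ_of_hit (h : X.Agrees t m c) (ht : t < X.T) (hr : X.r t ∈ m.cache) :
    X.Agrees (t + 1) m c where
  cache := h.cache.trans (X.lazyRun.hit t ht (h.cache ▸ hr)).symm
  cost := by rw [h.cost, faults_fault_succ, fault_eq_false_iff.2 (h.cache ▸ hr)]; rfl
  avoidable := h.avoidable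

theorem Agrees.succ_of_miss (h : X.Agrees t m c) (ht : t < X.T) (hr : X.r t ∉ m.cache)
    (hq : q ∈ X.B t \ X.B (t + 1)) :
    X.Agrees (t + 1) (m.serveBy (X.r t) (X.fault t) q) (X.serveCfg t c q) where
  cache := by
    obtain ⟨hqB, hqB'⟩ := Finset.mem_sdiff.1 hq
    have hsub : X.B (t + 1) ⊆ insert (X.r t) ((X.B t).erase q) := by
      have := X.lazyRun.succ_subset ht
      grind
    have hcard : (insert (X.r t) ((X.B t).erase q)).card = (X.B (t + 1)).card := by
      rw [card_insert_erase (h.cache ▸ hr) hqB, X.card_B ht.le, X.card_B ht]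
    exact (congrArg (fun A => insert (X.r t) (A.erase q)) h.cache).trans
      (Finset.eq_of_subset_of_card_le hsub hcard.le).symm
  cost := by
    rw [serveCfg, h.cost, faults_fault_succ, fault_eq_true_iff.2 (h.cache ▸ hr), Bool.toNat_true]
  avoidable := by
    simp [Memory.serveBy, Memory.evict, h.avoidable, fault_eq_true_iff.2 (h.cache ▸ hr)]

theorem MidInv.inv_of_hit (h : X.MidInv t m c) (ht : t < X.T) (hr : X.r t ∈ m.cache) :
    X.Inv (t + 1) m c where
  toTracks := h.toTracks
  toAccounts := h.toAccounts
  toCandidateInv := h.toCandidateInv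
  diff := h.diff
  marked := sdiff_eq_erase_sdiff hr ▸ h.marked
  good hb := sdiff_eq_erase_sdiff hr ▸ (Nat.le_add_right _ _).trans (h.good hb)
  exact he := (h.exact he).1.succ_of_hit ht hr

theorem potential_succ_le_midPotential (hr : X.r t ∈ m.cache) (μ : ℕ) (w : ℝ) (c : Config Page) :
    X.potential μ w (t + 1) m c ≤ X.midPotential μ w t (X.windowIdx t) m c := by
  have hpot := pot_succ_le (X := X) μ t (X.phaseIdx t) (X.windowIdx t) m.cache m.dropped
    (X.logErr m.log)
  simp only [phaseIdx, windowIdx] at hpot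
  rw [potential, sdiff_eq_erase_sdiff hr, midPotential]
  simp only [phaseIdx, windowIdx]
  linarith

theorem MidInv.victims_of_not_usesCandidate (h : X.MidInv t m c)
    (hu : ¬m.UsesCandidate (X.r t) (X.fault t)) :
    m.victims (X.r t) (X.fault t) = m.cache \ X.marked (t + 1) := by
  rw [Memory.victims, if_neg hu, h.phase]
  rfl

theorem MidInv.victims_subset (h : X.MidInv t m c) :
    m.victims (X.r t) (X.fault t) ⊆ m.cache := by
  unfold Memory.victims
  split_ifs
  exacts [h.candidates_subset, Finset.sdiff_subset]

theorem MidInv.victims_nonempty (h : X.MidInv t m c) (hr : X.r t ∉ m.cache) :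
    (m.victims (X.r t) (X.fault t)).Nonempty := by
  by_cases hu : m.UsesCandidate (X.r t) (X.fault t)
  · rw [Memory.victims, if_pos hu]
    exact hu.1
  · rw [h.victims_of_not_usesCandidate hu, Finset.sdiff_nonempty]
    intro hsub
    have heq : m.cache = X.marked (t + 1) :=
      Finset.eq_of_subset_of_card_le hsub ((card_marked_le _).trans_eq h.card.symm)
    exact hr (heq ▸ mem_marked_succ t)

theorem Tracks.serve (h : X.Tracks n m c) (hr : X.r t ∉ m.cache) (hq : q ∈ m.cache) :
    X.Tracks n (m.serveBy (X.r t) (X.fault t) q) (X.serveCfg t c q) where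
  init := h.init
  hist := h.hist
  phase := h.phase
  cache := by rw [serveCfg, h.cache]; rfl
  card := (card_insert_erase hr hq).trans h.card
  served := h.served

theorem CandidateInv.serve (h : X.CandidateInv (t + 1) m) (ht : t < X.T) (q : Page) :
    X.CandidateInv (t + 1) (m.serveBy (X.r t) (X.fault t) q) where
  candidates_subset :=
    (Finset.erase_subset_erase q h.candidates_subset).trans (Finset.subset_insert _ _)
  missed := by
    refine (Finset.card_le_card ?_).trans h.missed
    have := X.lazyRun.mem_succ ht
    simp only [Memory.serveBy, Memory.evict]
    grind
  wrong := (Finset.card_le_card (Finset.inter_subset_inter_right (Finset.erase_subset _ _))).trans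
    h.wrong

theorem MidInv.marked_serve (h : X.MidInv t m c) (hq : q ∈ m.victims (X.r t) (X.fault t)) :
    X.marked (t + 1) \ (m.serveBy (X.r t) (X.fault t) q).cache ⊆
      (m.serveBy (X.r t) (X.fault t) q).dropped := by
  have hkeep : (X.marked (t + 1)).erase (X.r t) \ m.cache ⊆ m.dropped.erase (X.r t) :=
    Finset.subset_erase.2 ⟨h.marked, by simp⟩
  simp only [Memory.serveBy, Memory.evict]
  split_ifs with hu
  · exact sdiff_evict_subset.trans (Finset.insert_subset_insert q hkeep)
  · rw [h.victims_of_not_usesCandidate hu] at hq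
    exact (sdiff_evict_subset_of_notMem (Finset.mem_sdiff.1 hq).2).trans hkeep

theorem MidInv.card_marked_serve_le (h : X.MidInv t m c)
    (hgood : (m.serveBy (X.r t) (X.fault t) q).avoidable = false) :
    (X.marked (t + 1) \ (m.serveBy (X.r t) (X.fault t) q).cache).card ≤
      (X.phase (t + 1)).curFaults := by
  simp only [Memory.serveBy, Memory.evict, Bool.or_eq_false_iff, Bool.not_eq_false'] at hgood
  have hle := h.good hgood.1
  rw [hgood.2, Bool.toNat_true] at hle
  exact (Finset.card_le_card sdiff_evict_subset).trans ((Finset.card_insert_le _ _).trans hle)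

theorem MidInv.agrees_serve (h : X.MidInv t m c) (ht : t < X.T) (hr : X.r t ∉ m.cache)
    (hq : q ∈ m.victims (X.r t) (X.fault t)) (he : receivedError X.pred X.B c = 0) :
    X.Agrees (t + 1) (m.serveBy (X.r t) (X.fault t) q) (X.serveCfg t c q) := by
  obtain ⟨hagrees, hcandidates⟩ := h.exact he
  have hf : X.fault t = true := fault_eq_true_iff.2 (hagrees.cache ▸ hr)
  obtain ⟨hne, hsub⟩ := hcandidates hf
  rw [Memory.victims, if_pos ⟨hne, Or.inl hf⟩] at hq
  exact hagrees.succ_of_miss ht hr (hsub hq)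

theorem MidInv.inv_of_miss (h : X.MidInv t m c) (ht : t < X.T) (hr : X.r t ∉ m.cache)
    (hq : q ∈ m.victims (X.r t) (X.fault t)) :
    X.Inv (t + 1) (m.serveBy (X.r t) (X.fault t) q) (X.serveCfg t c q) where
  toTracks := h.toTracks.serve hr (h.victims_subset hq)
  toAccounts := { h.toAccounts with }
  toCandidateInv := h.toCandidateInv.serve ht q
  diff := (Nat.le_of_add_right_le
    (card_evict_sdiff (X.lazyRun.mem_succ ht) (h.victims_subset hq)).le).trans h.diff
  marked := h.marked_serve hq
  good := h.card_marked_serve_le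
  exact := h.agrees_serve ht hr hq

theorem MidInv.card_fresh_sdiff_le_threshold (h : X.MidInv t m c) (ht : t < X.T)
    (hB : X.B (t + 1) = X.B t)
    (hc : X.remaining t < μ ∨ (m.cache \ X.B (t + 1)).card ≤ 6 * X.logErr m.log) :
    (X.fresh t \ m.cache).card ≤ X.threshold μ t (X.windowIdx t) (X.logErr m.log) := by
  have hcomm : (X.B t \ m.cache).card = (m.cache \ X.B (t + 1)).card :=
    hB.symm ▸ Finset.card_sdiff_comm ((X.card_B ht.le).trans h.card.symm)
  have hfresh : (X.fresh t \ m.cache).card ≤ (m.cache \ X.B (t + 1)).card :=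
    hcomm ▸ Finset.card_le_card (Finset.sdiff_subset_sdiff Finset.sdiff_subset le_rfl)
  have hquota := hfresh.trans (h.diff.trans (quota_le_phaseQuota ht))
  rw [threshold, if_pos rfl]
  split_ifs with hμ
  · exact hquota
  · exact le_min hquota (hfresh.trans (hc.resolve_left hμ))

/-- A fault that Belady's algorithm avoids is paid for by the potential of its slot if the caches
differ in few pages. -/
theorem MidInv.pot_succ_add_one_le (h : X.MidInv t m c) (ht : t < X.T) (hr : X.r t ∉ m.cache)
    (hf : X.fault t = false) (hd : X.r t ∉ m.dropped)
    (hc : X.remaining t < μ ∨ (m.cache \ X.B (t + 1)).card ≤ 6 * X.logErr m.log) :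
    X.pot μ (t + 1) (X.phaseIdx t) (X.windowIdx t) m.cache m.dropped (X.logErr m.log) + 1 ≤
      X.pot μ t (X.phaseIdx t) (X.windowIdx t) m.cache m.dropped (X.logErr m.log) := by
  have hrB : X.r t ∈ X.B t := fault_eq_false_iff.1 hf
  have hfresh : X.r t ∈ X.fresh t := by
    refine Finset.mem_sdiff.2 ⟨hrB, ?_⟩
    split_ifs with hs
    · simp
    · exact fun hm => hd (h.again hs hm hr)
  refine le_trans ?_ (pot_succ_add_slotPot_le m.cache m.dropped (X.logErr m.log)
    (mem_slots.2 ⟨⟨le_rfl, ht⟩, hfresh⟩))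
  gcongr
  have hθ := h.card_fresh_sdiff_le_threshold ht (X.lazyRun.hit t ht hrB) hc
  by_cases hl : X.IsLate t
  · exact (slotPot_of_isLate hl).ge
  · rw [slotPot_of_le hl hθ, if_pos (by simp [hr, hd])]
    refine le_add_of_nonneg_right (mul_nonneg (by positivity) (sub_nonneg.2 (mod_cast hθ)))

theorem MidInv.potential_candidate_le (h : X.MidInv t m c) (ht : t < X.T)
    (hu : m.UsesCandidate (X.r t) (X.fault t)) (hq : q ∈ m.candidates) :
    X.potential μ w (t + 1) (m.serveBy (X.r t) (X.fault t) q) (X.serveCfg t c q) ≤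
      X.midPotential μ w t (X.windowIdx t) m c +
        (3 - 3 * (X.fault t).toNat - 6 * (if q ∈ X.B (t + 1) then 0 else 1) +
          3 * (X.pot μ (t + 1) (X.phaseIdx t) (X.windowIdx t) m.cache m.dropped (X.logErr m.log) -
            X.pot μ t (X.phaseIdx t) (X.windowIdx t) m.cache m.dropped (X.logErr m.log))) := by
  have hqA := h.candidates_subset hq
  have hpot := pot_evict_candidate (X := X) (μ := μ) (t := t) (cw := X.windowIdx t)
    (e := X.logErr m.log) hqA (Finset.mem_insert_self q (m.dropped.erase (X.r t)))
    (Finset.subset_insert _ _)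
  have hdiff : ((insert (X.r t) (m.cache.erase q) \ X.B (t + 1)).card : ℝ) +
      (if q ∈ X.B (t + 1) then 0 else 1) = (m.cache \ X.B (t + 1)).card :=
    mod_cast card_evict_sdiff (X.lazyRun.mem_succ ht) hqA
  have hdropped : ((insert q (m.dropped.erase (X.r t))).card : ℝ) ≤ m.dropped.card + 1 :=
    mod_cast (Finset.card_insert_le _ _).trans (Nat.succ_le_succ Finset.card_erase_le)
  have hmarked : ((X.marked (t + 1) \ insert (X.r t) (m.cache.erase q)).card : ℝ) ≤
      ((X.marked (t + 1)).erase (X.r t) \ m.cache).card + 1 :=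
    mod_cast (Finset.card_le_card sdiff_evict_subset).trans (Finset.card_insert_le _ _)
  have hcost : ((X.serveCfg t c q).cost : ℝ) = c.cost + 1 := Nat.cast_succ _
  have hcredit : X.credit (X.serveCfg t c q) = X.credit c := rfl
  simp only [phaseIdx, windowIdx] at hpot
  simp only [potential, midPotential, Memory.serveBy, Memory.evict, if_pos hu, hcredit, hcost,
    phaseIdx, windowIdx]
  linarith

/-- If the caches differ in more than six pages per error, then at most half of the candidates are
pages of Belady's algorithm: errors and unreported faults account for all other differences. -/
theorem MidInv.card_candidates_le (h : X.MidInv t m c) (hr : X.r t ∉ m.cache)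
    (hc : 6 * X.logErr m.log < (m.cache \ X.B (t + 1)).card) :
    m.candidates.card ≤ 2 * (m.candidates \ X.B (t + 1)).card := by
  have := h.card_cache_sdiff_le
  have := h.wrong
  have := h.pending hr
  have := Finset.card_inter_add_card_sdiff m.candidates (X.B (t + 1))
  lia

theorem MidInv.paid_or_card_candidates_le (h : X.MidInv t m c) (ht : t < X.T)
    (hr : X.r t ∉ m.cache) (hu : m.UsesCandidate (X.r t) (X.fault t)) (μ : ℕ) :
    1 ≤ ((X.fault t).toNat : ℝ) +
        (X.pot μ t (X.phaseIdx t) (X.windowIdx t) m.cache m.dropped (X.logErr m.log) -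
          X.pot μ (t + 1) (X.phaseIdx t) (X.windowIdx t) m.cache m.dropped (X.logErr m.log)) ∨
      m.candidates.card ≤ 2 * (m.candidates \ X.B (t + 1)).card := by
  refine or_iff_not_imp_right.2 fun hcard => ?_
  have hfew : (m.cache \ X.B (t + 1)).card ≤ 6 * X.logErr m.log :=
    not_lt.1 fun hc => hcard (h.card_candidates_le hr hc)
  cases hf : X.fault t
  · have hd : X.r t ∉ m.dropped := hu.2.resolve_left (by simp [hf])
    rw [Bool.toNat_false, Nat.cast_zero]
    linarith [h.pot_succ_add_one_le (μ := μ) ht hr hf hd (Or.inr hfew)]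
  · rw [Bool.toNat_true, Nat.cast_one]
    linarith [pot_succ_le (X := X) μ t (X.phaseIdx t) (X.windowIdx t) m.cache m.dropped
      (X.logErr m.log)]

theorem MidInv.sum_potential_candidates_le (h : X.MidInv t m c) (ht : t < X.T)
    (hr : X.r t ∉ m.cache) (hu : m.UsesCandidate (X.r t) (X.fault t)) :
    ∑ q ∈ m.candidates,
        X.potential μ w (t + 1) (m.serveBy (X.r t) (X.fault t) q) (X.serveCfg t c q) ≤
      m.candidates.card * X.midPotential μ w t (X.windowIdx t) m c := by
  have hpot := pot_succ_le (X := X) μ t (X.phaseIdx t) (X.windowIdx t) m.cache m.dropped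
    (X.logErr m.log)
  rcases h.paid_or_card_candidates_le ht hr hu μ with hpaid | hhalf
  · rw [← nsmul_eq_mul]
    refine Finset.sum_le_card_nsmul _ _ _ fun q hq => (h.potential_candidate_le ht hu hq).trans ?_
    have hindicator : (0 : ℝ) ≤ if q ∈ X.B (t + 1) then 0 else 1 := by positivity
    linarith
  · have hhalf : (m.candidates.card : ℝ) ≤ 2 * (m.candidates \ X.B (t + 1)).card := mod_cast hhalf
    have hsum : ∑ q ∈ m.candidates, (if q ∈ X.B (t + 1) then (0 : ℝ) else 1) =
        (m.candidates \ X.B (t + 1)).card := by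
      simp_rw [← ite_not (p := _ ∈ X.B (t + 1))]
      rw [Finset.sum_boole, Finset.sdiff_eq_filter]
    calc ∑ q ∈ m.candidates,
          X.potential μ w (t + 1) (m.serveBy (X.r t) (X.fault t) q) (X.serveCfg t c q)
        ≤ ∑ q ∈ m.candidates, (X.midPotential μ w t (X.windowIdx t) m c +
            (3 - 6 * if q ∈ X.B (t + 1) then 0 else 1)) := by
          refine Finset.sum_le_sum fun q hq => (h.potential_candidate_le ht hu hq).trans ?_
          linarith
      _ = m.candidates.card * X.midPotential μ w t (X.windowIdx t) m c +
            (m.candidates.card * 3 - 6 * (m.candidates \ X.B (t + 1)).card) := by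
          rw [Finset.sum_add_distrib, Finset.sum_sub_distrib, ← Finset.mul_sum, hsum,
            Finset.sum_const, Finset.sum_const, nsmul_eq_mul, nsmul_eq_mul]
      _ ≤ m.candidates.card * X.midPotential μ w t (X.windowIdx t) m c := by linarith

theorem potential_unmarked_le (ht : t < X.T)
    (hu : ¬m.UsesCandidate (X.r t) (X.fault t)) (hq : q ∈ m.cache \ X.marked (t + 1)) :
    X.potential μ w (t + 1) (m.serveBy (X.r t) (X.fault t) q) (X.serveCfg t c q) ≤
      X.midPotential μ w t (X.windowIdx t) m c +
        (1 + (m.dropped.erase (X.r t)).card - m.dropped.card - 3 * (X.fault t).toNat +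
          3 * (X.pot μ (t + 1) (X.phaseIdx t) (X.windowIdx t) (insert (X.r t) (m.cache.erase q))
              (m.dropped.erase (X.r t)) (X.logErr m.log) -
            X.pot μ t (X.phaseIdx t) (X.windowIdx t) m.cache m.dropped (X.logErr m.log))) := by
  obtain ⟨hqA, hqM⟩ := Finset.mem_sdiff.1 hq
  have hdiff : ((insert (X.r t) (m.cache.erase q) \ X.B (t + 1)).card : ℝ) ≤
      (m.cache \ X.B (t + 1)).card :=
    mod_cast Nat.le_of_add_right_le (card_evict_sdiff (X.lazyRun.mem_succ ht) hqA).le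
  have hmarked : ((X.marked (t + 1) \ insert (X.r t) (m.cache.erase q)).card : ℝ) ≤
      ((X.marked (t + 1)).erase (X.r t) \ m.cache).card :=
    mod_cast Finset.card_le_card (sdiff_evict_subset_of_notMem hqM)
  have hcost : ((X.serveCfg t c q).cost : ℝ) = c.cost + 1 := Nat.cast_succ _
  have hcredit : X.credit (X.serveCfg t c q) = X.credit c := rfl
  simp only [potential, midPotential, Memory.serveBy, Memory.evict, if_neg hu, hcredit, hcost,
    phaseIdx, windowIdx]
  linarith

/-- A fault served by a random eviction is Belady's fault, or on a dropped page, or has a slot. -/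
theorem MidInv.unmarked_paid (h : X.MidInv t m c) (ht : t < X.T) (hr : X.r t ∉ m.cache)
    (hu : ¬m.UsesCandidate (X.r t) (X.fault t)) (μ : ℕ) :
    1 + ((m.dropped.erase (X.r t)).card : ℝ) - m.dropped.card - 3 * (X.fault t).toNat +
      3 * (X.pot μ (t + 1) (X.phaseIdx t) (X.windowIdx t) m.cache m.dropped (X.logErr m.log) -
        X.pot μ t (X.phaseIdx t) (X.windowIdx t) m.cache m.dropped (X.logErr m.log)) ≤ 0 := by
  have hpot := pot_succ_le (X := X) μ t (X.phaseIdx t) (X.windowIdx t) m.cache m.dropped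
    (X.logErr m.log)
  by_cases hd : X.r t ∈ m.dropped
  · have hcard : ((m.dropped.erase (X.r t)).card : ℝ) + 1 = m.dropped.card :=
      mod_cast Finset.card_erase_add_one hd
    linarith [(X.fault t).toNat.cast_nonneg (α := ℝ)]
  rw [Finset.erase_eq_of_notMem hd]
  cases hf : X.fault t
  · have hcandidates : m.candidates = ∅ :=
      Finset.not_nonempty_iff_eq_empty.1 fun hne => hu ⟨hne, Or.inr hd⟩
    have hfew : (m.cache \ X.B (t + 1)).card ≤ 6 * X.logErr m.log := by
      have := h.card_cache_sdiff_le
      have := h.pending hr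
      rw [hcandidates, Finset.card_empty] at *
      lia
    have := h.pot_succ_add_one_le (μ := μ) ht hr hf hd (Or.inr hfew)
    rw [Bool.toNat_false, Nat.cast_zero]
    linarith
  · rw [Bool.toNat_true, Nat.cast_one]
    linarith

theorem MidInv.sum_potential_unmarked_le (h : X.MidInv t m c) (ht : t < X.T)
    (hr : X.r t ∉ m.cache) (hu : ¬m.UsesCandidate (X.r t) (X.fault t)) :
    ∑ q ∈ m.cache \ X.marked (t + 1),
        X.potential μ w (t + 1) (m.serveBy (X.r t) (X.fault t) q) (X.serveCfg t c q) ≤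
      (m.cache \ X.marked (t + 1)).card * X.midPotential μ w t (X.windowIdx t) m c := by
  refine (Finset.sum_le_sum fun q hq => potential_unmarked_le ht hu hq).trans ?_
  have hpot := pot_evict_random (X := X) μ t (X.windowIdx t) (X.logErr m.log) m.cache m.dropped
  have hpaid := mul_nonpos_of_nonneg_of_nonpos (Nat.cast_nonneg (m.cache \ X.marked (t + 1)).card)
    (h.unmarked_paid ht hr hu μ)
  simp only [Finset.sum_add_distrib, ← Finset.mul_sum, Finset.sum_sub_distrib, Finset.sum_const,
    nsmul_eq_mul]
  linarith

theorem MidInv.sum_potential_le (h : X.MidInv t m c) (ht : t < X.T) (hr : X.r t ∉ m.cache) :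
    ∑ q ∈ m.victims (X.r t) (X.fault t),
        X.potential μ w (t + 1) (m.serveBy (X.r t) (X.fault t) q) (X.serveCfg t c q) ≤
      (m.victims (X.r t) (X.fault t)).card * X.midPotential μ w t (X.windowIdx t) m c := by
  by_cases hu : m.UsesCandidate (X.r t) (X.fault t)
  · rw [Memory.victims, if_pos hu]
    exact h.sum_potential_candidates_le ht hr hu
  · rw [h.victims_of_not_usesCandidate hu]
    exact h.sum_potential_unmarked_le ht hr hu

theorem MidInv.exec_swap (h : X.MidInv t m c) (hr : X.r t ∉ m.cache)
    (hq : q ∈ m.victims (X.r t) (X.fault t)) :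
    exec X.pred (t + 1)
      (.swap (X.r t) q (.done (m.serveBy (X.r t) (X.fault t) q)) : Prog Page (Memory Page)) c =
      PMF.pure (m.serveBy (X.r t) (X.fault t) q, X.serveCfg t c q) := by
  rw [exec, if_pos ⟨h.cache ▸ hr, h.cache ▸ h.victims_subset hq⟩, exec]
  rfl

theorem MidInv.mean_potential_le (h : X.MidInv t m c) (ht : t < X.T) (hw : 0 ≤ w) :
    mean (exec X.pred (t + 1) (serve m (X.r t) (X.fault t)) c)
        (fun y => ENNReal.ofReal (X.potential μ w (t + 1) y.1 y.2)) ≤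
      ENNReal.ofReal (X.midPotential μ w t (X.windowIdx t) m c) := by
  unfold serve
  split_ifs with hr
  · rw [exec, mean_pure]
    exact ENNReal.ofReal_le_ofReal (potential_succ_le_midPotential hr μ w c)
  have hne := h.victims_nonempty hr
  have hpos : (0 : ℝ) < (m.victims (X.r t) (X.fault t)).card := mod_cast Finset.card_pos.2 hne
  rw [mean_exec_draw X.pred (t + 1) hne,
    Finset.sum_congr rfl fun q hq => by rw [h.exec_swap hr hq, mean_pure],
    ← ENNReal.ofReal_sum_of_nonneg fun q _ => potential_nonneg hw _ _ _,
    ← ENNReal.ofReal_natCast, ← ENNReal.ofReal_div_of_pos hpos]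
  refine ENNReal.ofReal_le_ofReal ?_
  rw [div_le_iff₀' hpos]
  exact h.sum_potential_le ht hr

theorem MidInv.inv_of_mem_support (h : X.MidInv t m c) (ht : t < X.T)
    {y : Memory Page × Config Page}
    (hy : y ∈ (exec X.pred (t + 1) (serve m (X.r t) (X.fault t)) c).support) :
    X.Inv (t + 1) y.1 y.2 ∧ X.r t ∈ y.2.cache := by
  unfold serve at hy
  split_ifs at hy with hr
  · rw [exec, PMF.mem_support_pure_iff] at hy
    subst hy
    exact ⟨h.inv_of_hit ht hr, h.cache ▸ hr⟩
  · obtain ⟨q, hq, hy⟩ := mem_support_exec_draw X.pred (t + 1) (h.victims_nonempty hr) hy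
    rw [h.exec_swap hr hq, PMF.mem_support_pure_iff] at hy
    subst hy
    exact ⟨h.inv_of_miss ht hr hq, Finset.mem_insert_self _ _⟩

end Scenario

end Serving

/-! ### Expected cost -/

section Run

theorem map_eq_self_of_mem_support {α : Type*} {ν : PMF α} {g : α → α}
    (h : ∀ a ∈ ν.support, g a = a) : ν.map g = ν := by
  ext b
  rw [← PMF.bind_pure_comp, PMF.bind_apply]
  nth_rewrite 2 [← PMF.bind_pure ν]
  rw [PMF.bind_apply]
  refine tsum_congr fun a => ?_
  by_cases ha : ν a = 0
  · rw [ha, zero_mul, zero_mul]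
  · rw [Function.comp_apply, h a ((PMF.mem_support_iff _ _).2 ha)]

variable {Page : Type u} [DecidableEq Page]

namespace Scenario

section Defs

variable (X : Scenario Page)

/-- The distribution of memory and configuration after `t` requests. -/
noncomputable def execution (t : ℕ) : PMF (Memory Page × Config Page) :=
  (follower Page X.k X.level).run X.pred X.A₀ X.r t

/-- The distribution of the configuration after all requests. -/
noncomputable def outcome : PMF (Config Page) :=
  (follower Page X.k X.level).outcome X.pred X.A₀ X.r X.T

/-- The distribution of memory and configuration after request `t`, given those before it. -/
noncomputable def stepDist (t : ℕ) (m : Memory Page) (c : Config Page) :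
    PMF (Memory Page × Config Page) :=
  (exec X.pred (t + 1) ((follower Page X.k X.level).step m (X.r t)) c).map fun y =>
    (y.1, { y.2 with unserved := y.2.unserved + if X.r t ∈ y.2.cache then 0 else 1 })

/-- The initial memory. -/
noncomputable def initMem : Memory Page := (follower Page X.k X.level).init X.A₀

/-- The initial configuration. -/
def initCfg : Config Page := ⟨X.A₀, 0, 0, 0, ∅, 0⟩

/-- Total error of all predictions. -/
def totalErr : ℕ := ∑ τ ∈ Finset.Icc 1 X.T, X.predError τ

end Defs

variable {X : Scenario Page} {t μ : ℕ} {w : ℝ} {m : Memory Page} {c : Config Page}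

theorem execution_zero : X.execution 0 = PMF.pure (X.initMem, X.initCfg) := rfl

theorem execution_succ (t : ℕ) :
    X.execution (t + 1) = (X.execution t).bind fun x => X.stepDist t x.1 x.2 := rfl

theorem inv_init : X.Inv 0 X.initMem X.initCfg := by
  have hB : X.B 0 = X.A₀ := X.belady.init
  refine ⟨⟨?_, ?_, ?_, ?_, ?_, ?_⟩, ⟨?_, ?_, ?_, ?_, ?_⟩, ⟨?_, ?_, ?_⟩, ?_, ?_, ?_,
    fun _ => ⟨?_, ?_, ?_⟩⟩
  all_goals
    simp [initMem, initCfg, follower, phase, marked, hB, X.card_init, asked, faults]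

theorem Inv.exists_stepDist_eq (h : X.Inv t m c) (ht : t < X.T) :
    ∃ m' c', X.stepDist t m c = exec X.pred (t + 1) (serve m' (X.r t) (X.fault t)) c' ∧
      X.MidInv t m' c' ∧ ∀ μ w, (∀ j, levelSum X.k X.level μ j ≤ w) →
        X.midPotential μ w t (X.windowIdx t) m' c' ≤ X.potential μ w t m c := by
  obtain ⟨m', c', hexec, hmid, hpot⟩ := h.exists_midInv ht
  refine ⟨m', c', ?_, hmid, hpot⟩
  rw [stepDist, hexec]
  refine map_eq_self_of_mem_support fun y hy => ?_
  simp only [if_pos (hmid.inv_of_mem_support ht hy).2, add_zero]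
  rfl

theorem inv_of_mem_support_execution (ht : t ≤ X.T) {x : Memory Page × Config Page}
    (hx : x ∈ (X.execution t).support) : X.Inv t x.1 x.2 := by
  induction t generalizing x with
  | zero =>
    rw [execution_zero, PMF.mem_support_pure_iff] at hx
    exact hx ▸ inv_init
  | succ t ih =>
    rw [execution_succ, PMF.mem_support_bind_iff] at hx
    obtain ⟨y, hy, hx⟩ := hx
    obtain ⟨m', c', hstep, hmid, -⟩ := (ih (Nat.le_of_succ_le ht) hy).exists_stepDist_eq ht
    exact (hmid.inv_of_mem_support ht (hstep ▸ hx)).1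

theorem mean_potential_le (hw : ∀ n, levelSum X.k X.level μ n ≤ w) (ht : t ≤ X.T) :
    mean (X.execution t) (fun x => ENNReal.ofReal (X.potential μ w t x.1 x.2)) ≤
      ENNReal.ofReal (X.potential μ w 0 X.initMem X.initCfg) := by
  have hw₀ : 0 ≤ w := (levelSum_nonneg _ _ _ _).trans (hw 0)
  induction t with
  | zero => rw [execution_zero, mean_pure]
  | succ t ih =>
    rw [execution_succ, mean_bind]
    refine (mean_mono fun x hx => ?_).trans (ih (Nat.le_of_succ_le ht))
    obtain ⟨m', c', hstep, hmid, hpot⟩ :=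
      (inv_of_mem_support_execution (Nat.le_of_succ_le ht) hx).exists_stepDist_eq ht
    rw [hstep]
    exact (hmid.mean_potential_le ht hw₀).trans (ENNReal.ofReal_le_ofReal (hpot μ w hw))

theorem startsWindow_zero : X.StartsWindow 0 := by
  refine ⟨Finset.notMem_empty _, Or.inl ?_⟩
  simp [Phase.mark, phase]

theorem pot_init_le (μ : ℕ) :
    X.pot μ 0 (X.phase 0).idx (X.phase 0).windowIdx X.A₀ ∅ 0 ≤ ∑ s ∈ X.slots 0, X.reserve μ s := by
  refine Finset.sum_le_sum fun s hs => ?_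
  obtain ⟨⟨hs₀, hsT⟩, hfresh⟩ := mem_slots.1 hs
  unfold slotValue
  split_ifs with hphase
  · have hmem := X.belady.init ▸ (Finset.mem_sdiff.1 (fresh_subset hs₀ hsT hphase hfresh)).1
    refine (slotPot_le_reserve (windowIdx_ne_of_startsWindow startsWindow_zero hs₀)).trans_eq ?_
    rw [if_neg (not_not_intro hmem), zero_add]
  · exact le_rfl

theorem potential_init_le (hw : ∀ n, levelSum X.k X.level μ n ≤ w) :
    X.potential μ w 0 X.initMem X.initCfg ≤
      (81 + 18 * lowSum X.k μ) * X.opt + 36 * w * X.syncErr + 36 * w * X.totalErr := by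
  have hpot := (pot_init_le (X := X) μ).trans (sum_reserve_le hw)
  have hfaults : X.faultsFrom 0 = X.opt := by rw [opt_eq, faultsFrom, Finset.range_eq_Ico]
  have hcredit : X.credit X.initCfg = X.totalErr := by simp [credit, initCfg, totalErr]
  have hB : X.B 0 = X.A₀ := X.belady.init
  have hrest : X.potential μ w 0 X.initMem X.initCfg =
      3 * X.pot μ 0 (X.phase 0).idx (X.phase 0).windowIdx X.A₀ ∅ 0 + 36 * w * X.totalErr +
        63 * X.opt := by
    rw [potential, hfaults, hcredit, hB]
    simp [initMem, initCfg, follower, phase, marked, logErr]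
  rw [hrest]
  linarith

theorem Inv.credit_add_receivedError (h : X.Inv X.T m c) :
    X.credit c + receivedError X.pred X.B c = X.totalErr :=
  Finset.sum_sdiff h.times

theorem Inv.syncErr_le (h : X.Inv X.T m c) : X.syncErr ≤ receivedError X.pred X.B c := by
  rw [syncErr, ← Finset.sum_image (g := (· + 1)) (f := X.predError)
    (add_left_injective 1).injOn]
  refine Finset.sum_le_sum_of_subset (Finset.image_subset_iff.2 fun τ hτ => ?_)
  exact h.syncs τ (Finset.mem_range.1 (Finset.mem_filter.1 hτ).1) (Finset.mem_filter.1 hτ).2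

theorem Inv.cost_add_totalErr_le (h : X.Inv X.T m c) :
    c.cost + 36 * w * X.totalErr ≤
      X.potential μ w X.T m c + 36 * w * receivedError X.pred X.B c := by
  have hpot := pot_nonneg (X := X) μ X.T (X.phase X.T).idx (X.phase X.T).windowIdx m.cache
    m.dropped (X.logErr m.log)
  rw [← h.credit_add_receivedError, potential]
  push_cast
  linarith

theorem expect_outcome (φ : Config Page → ℕ) :
    expect X.outcome φ = mean (X.execution X.T) fun x => (φ x.2 : ℝ≥0∞) :=
  mean_map _ _ _

theorem exists_inv_of_mem_support_outcome (hc : c ∈ X.outcome.support) : ∃ m, X.Inv X.T m c := by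
  obtain ⟨x, hx, rfl⟩ := (PMF.mem_support_map_iff _ _ _).1 hc
  exact ⟨x.1, inv_of_mem_support_execution le_rfl hx⟩

theorem syncErr_le_expect :
    (X.syncErr : ℝ≥0∞) ≤ expect X.outcome (receivedError X.pred X.B) := by
  rw [expect_outcome, ← mean_const (X.execution X.T) (X.syncErr : ℝ≥0∞)]
  exact mean_mono fun x hx => mod_cast (inv_of_mem_support_execution le_rfl hx).syncErr_le

theorem expect_cost_add_totalErr_le (hw : ∀ n, levelSum X.k X.level μ n ≤ w) :
    expect X.outcome Config.cost + ENNReal.ofReal (36 * w) * X.totalErr ≤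
      ENNReal.ofReal (X.potential μ w 0 X.initMem X.initCfg) +
        ENNReal.ofReal (36 * w) * expect X.outcome (receivedError X.pred X.B) := by
  have hw₀ : 0 ≤ w := (levelSum_nonneg _ _ _ _).trans (hw 0)
  refine le_trans ?_ (add_le_add_left (mean_potential_le hw le_rfl) _)
  rw [expect_outcome, expect_outcome, ← mean_const_mul, ← mean_add,
    ← mean_const (X.execution X.T) (_ * _), ← mean_add]
  refine mean_mono fun x hx => ?_
  rw [← ENNReal.ofReal_natCast, ← ENNReal.ofReal_natCast, ← ENNReal.ofReal_natCast,
    ← ENNReal.ofReal_mul (by positivity), ← ENNReal.ofReal_mul (by positivity),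
    ← ENNReal.ofReal_add (by positivity) (by positivity),
    ← ENNReal.ofReal_add (potential_nonneg hw₀ _ _ _) (by positivity)]
  exact ENNReal.ofReal_le_ofReal
    (inv_of_mem_support_execution le_rfl hx).cost_add_totalErr_le

theorem expect_cost_le (hw : ∀ n, levelSum X.k X.level μ n ≤ w) :
    expect X.outcome Config.cost ≤ ENNReal.ofReal ((81 + 18 * lowSum X.k μ) * X.opt) +
      ENNReal.ofReal (72 * w) * expect X.outcome (receivedError X.pred X.B) := by
  have hw₀ : 0 ≤ w := (levelSum_nonneg _ _ _ _).trans (hw 0)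
  have hlow₀ : 0 ≤ lowSum X.k μ := Finset.sum_nonneg fun _ _ => by positivity
  set E := expect X.outcome (receivedError X.pred X.B)
  set K := ENNReal.ofReal ((81 + 18 * lowSum X.k μ) * X.opt)
  set v := ENNReal.ofReal (36 * w)
  have hinit : ENNReal.ofReal (X.potential μ w 0 X.initMem X.initCfg) ≤
      K + v * X.syncErr + v * X.totalErr := by
    refine (ENNReal.ofReal_le_ofReal (potential_init_le hw)).trans_eq ?_
    rw [ENNReal.ofReal_add (by positivity) (by positivity),
      ENNReal.ofReal_add (by positivity) (by positivity),
      ENNReal.ofReal_mul' (Nat.cast_nonneg X.syncErr),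
      ENNReal.ofReal_mul' (Nat.cast_nonneg X.totalErr), ENNReal.ofReal_natCast,
      ENNReal.ofReal_natCast]
  have hdouble : ENNReal.ofReal (72 * w) = v + v := by
    rw [← ENNReal.ofReal_add (by positivity) (by positivity)]
    ring_nf
  have htotal : v * X.totalErr ≠ ⊤ :=
    ENNReal.mul_ne_top ENNReal.ofReal_ne_top (ENNReal.natCast_ne_top _)
  refine (ENNReal.add_le_add_iff_right htotal).1 ?_
  calc expect X.outcome Config.cost + v * X.totalErr
      ≤ K + v * X.syncErr + v * X.totalErr + v * E :=
        (expect_cost_add_totalErr_le hw).trans (add_le_add_left hinit _)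
    _ ≤ K + v * E + v * X.totalErr + v * E := by
        gcongr
        exact syncErr_le_expect
    _ = K + ENNReal.ofReal (72 * w) * E + v * X.totalErr := by
        rw [hdouble]
        ring

theorem expect_cost_le_of_exact (h : expect X.outcome (receivedError X.pred X.B) = 0) :
    expect X.outcome Config.cost ≤ X.opt := by
  rw [expect_outcome, mean, ENNReal.tsum_eq_zero] at h
  rw [expect_outcome, ← mean_const (X.execution X.T) (X.opt : ℝ≥0∞)]
  refine mean_mono fun x hx => ?_
  have hexact : (receivedError X.pred X.B x.2 : ℝ≥0∞) = 0 :=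
    (mul_eq_zero.1 (h x)).resolve_left ((PMF.mem_support_iff _ _).1 hx)
  exact mod_cast ((inv_of_mem_support_execution le_rfl hx).exact (mod_cast hexact)).cost.le

theorem Inv.counts_le (h : X.Inv X.T m c) :
    (c.queries : ℝ) ≤ 5 * (1 + X.level X.k) * X.opt ∧
      (c.indices : ℝ) ≤ 5 * (1 + X.level X.k) * X.opt := by
  have hasked : (X.asked X.T : ℝ) ≤ 3 * (X.level X.k + 1) * X.opt := mod_cast sum_quota_le (X := X)
  have hqueries : (c.queries : ℝ) ≤ X.asked X.T + X.opt :=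
    mod_cast (Nat.le_add_right _ _).trans h.queries
  have hindices : (c.indices : ℝ) ≤ X.asked X.T + 2 * X.opt :=
    mod_cast (Nat.le_add_right _ _).trans h.indices
  have hlevel : (0 : ℝ) ≤ X.level X.k * X.opt := by positivity
  constructor <;> linarith

end Scenario

end Run

/-! ### Levels given by a convex function -/

section Levels

theorem sum_one_div_le_one_add_log (n : ℕ) :
    ∑ m ∈ Finset.Icc 1 n, (1 / m : ℝ) ≤ 1 + Real.log n := by
  refine le_trans (le_of_eq ?_) (harmonic_le_one_add_log n)
  rw [harmonic_eq_sum_Icc, Rat.cast_sum]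
  exact Finset.sum_congr rfl fun m _ => by rw [one_div, Rat.cast_inv, Rat.cast_natCast]

theorem sum_one_div_Ioc_le {m n : ℕ} (hm : 0 < m) (hmn : m ≤ n) :
    ∑ i ∈ Finset.Ioc m n, (1 / i : ℝ) ≤ Real.log n - Real.log m := by
  induction n, hmn using Nat.le_induction with
  | base => simp
  | succ n hn ih =>
    rw [← Finset.insert_Ioc_right_eq_Ioc_add_one hn, Finset.sum_insert (by simp)]
    have hn₀ : (0 : ℝ) < n := mod_cast hm.trans_le hn
    have hlog := Real.one_sub_inv_le_log_of_pos (x := ((n + 1 : ℕ) : ℝ) / n) (by positivity)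
    rw [Real.log_div (by positivity) hn₀.ne', inv_div] at hlog
    have hfrac : (1 : ℝ) / ((n + 1 : ℕ) : ℝ) = 1 - n / ((n + 1 : ℕ) : ℝ) := by
      push_cast
      field_simp
      ring
    linarith

theorem log_le_logb_two {x : ℝ} (hx : 1 ≤ x) : Real.log x ≤ Real.logb 2 x := by
  rw [Real.logb, le_div_iff₀ (Real.log_pos one_lt_two)]
  exact mul_le_of_le_one_right (Real.log_nonneg hx) (by linarith [Real.log_two_lt_d9])

theorem logb_natCast_nonneg (m : ℕ) : 0 ≤ Real.logb 2 m :=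
  div_nonneg (Real.log_natCast_nonneg m) (Real.log_nonneg one_le_two)

theorem monotone_logb_natCast : Monotone fun m : ℕ => Real.logb 2 m := fun m n hmn => by
  rcases m.eq_zero_or_pos with rfl | hm
  · simpa using logb_natCast_nonneg n
  · exact Real.logb_le_logb_of_le one_lt_two (mod_cast hm) (mod_cast hmn)

theorem one_le_logb_natCast {m : ℕ} (hm : 2 ≤ m) : 1 ≤ Real.logb 2 m := by
  simpa using monotone_logb_natCast hm

theorem lowSum_le (k μ : ℕ) : lowSum k μ ≤ 1 + Real.log k :=
  (Finset.sum_le_sum_of_subset_of_nonneg (Finset.filter_subset _ _) fun _ _ _ => by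
    positivity).trans (sum_one_div_le_one_add_log k)

theorem lowSum_ceil_le {a : ℝ} (ha : 0 ≤ a) (k : ℕ) : lowSum k ⌈(2 : ℝ) ^ a⌉₊ ≤ 1 + a := by
  obtain ⟨n, hn⟩ : ∃ n, ⌈(2 : ℝ) ^ a⌉₊ = n + 1 :=
    Nat.exists_eq_succ_of_ne_zero (Nat.ceil_pos.2 (by positivity)).ne'
  have hlog : Real.log n ≤ a := by
    rcases n.eq_zero_or_pos with rfl | hpos
    · simpa using ha
    · have hlt : (n : ℝ) < 2 ^ a := Nat.lt_ceil.1 (n.lt_succ_self.trans_eq hn.symm)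
      exact (log_le_logb_two (mod_cast hpos)).trans
        ((Real.logb_le_iff_le_rpow one_lt_two (mod_cast hpos)).2 hlt.le)
  calc lowSum k ⌈(2 : ℝ) ^ a⌉₊
      ≤ ∑ m ∈ Finset.Icc 1 n, (1 / m : ℝ) := by
        refine Finset.sum_le_sum_of_subset_of_nonneg (fun m hm => ?_) fun _ _ _ => by positivity
        obtain ⟨hmem, hlt⟩ := Finset.mem_filter.1 hm
        exact Finset.mem_Icc.2 ⟨(Finset.mem_Icc.1 hmem).1, Nat.le_of_lt_succ (hlt.trans_eq hn)⟩
    _ ≤ 1 + a := (sum_one_div_le_one_add_log n).trans (by linarith)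

theorem levelSum_succ_self (k : ℕ) (level : ℕ → ℕ) (n : ℕ) : levelSum k level (k + 1) n = 0 := by
  refine Finset.sum_eq_zero fun m hm => ?_
  rw [Finset.mem_filter, Finset.mem_Icc] at hm
  lia

variable {f : ℝ → ℝ} {a x y : ℝ} {m n : ℕ}

/-- The level of `m` remaining pages; a window of a phase is a range of constant level. -/
noncomputable def level (f : ℝ → ℝ) (m : ℕ) : ℕ := ⌊f (Real.logb 2 m)⌋₊

theorem level_mono (hf : MonotoneOn f (Set.Ici 0)) : Monotone (level f) := fun _ _ hmn =>
  Nat.floor_le_floor (hf (logb_natCast_nonneg _) (logb_natCast_nonneg _)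
    (monotone_logb_natCast hmn))

theorem nonneg_of_monotoneOn (hf : MonotoneOn f (Set.Ici 0)) (hf₀ : f 0 = 0) (hx : 0 ≤ x) :
    0 ≤ f x :=
  hf₀.symm.trans_le (hf Set.self_mem_Ici hx hx)

theorem level_le (hf : MonotoneOn f (Set.Ici 0)) (hf₀ : f 0 = 0) (m : ℕ) :
    level f m ≤ f (Real.logb 2 m) :=
  Nat.floor_le (nonneg_of_monotoneOn hf hf₀ (logb_natCast_nonneg m))

theorem mul_le_mul_of_convexOn (hconv : ConvexOn ℝ (Set.Ici 0) f) (hf₀ : f 0 = 0) (hx : 0 < x)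
    (hxy : x ≤ y) : f x * y ≤ x * f y := by
  have hsecant := hconv.secant_mono (a := 0) Set.self_mem_Ici hx.le (hx.le.trans hxy) hx.ne'
    (hx.trans_le hxy).ne' hxy
  rw [hf₀, sub_zero, sub_zero, sub_zero, sub_zero, div_le_div_iff₀ hx (hx.trans_le hxy)] at hsecant
  linarith

theorem mul_sub_le_mul_sub_of_convexOn (hconv : ConvexOn ℝ (Set.Ici 0) f) (hf₀ : f 0 = 0)
    (ha : 0 < a) (hax : a ≤ x) (hxy : x ≤ y) : f a * (y - x) ≤ a * (f y - f x) := by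
  rcases hxy.eq_or_lt with rfl | hlt
  · simp
  have hx : 0 < x := ha.trans_le hax
  have hslope := hconv.slope_mono_adjacent Set.self_mem_Ici (hx.le.trans hxy) hx hlt
  rw [hf₀, sub_zero, sub_zero, div_le_div_iff₀ hx (sub_pos.2 hlt)] at hslope
  have hsecant := mul_le_mul_of_convexOn hconv hf₀ ha hax
  refine le_of_mul_le_mul_right ?_ hx
  nlinarith [mul_le_mul_of_nonneg_right hsecant (sub_nonneg.2 hxy),
    mul_le_mul_of_nonneg_left hslope ha.le]

theorem log_sub_log_le_of_level_eq (hf : MonotoneOn f (Set.Ici 0))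
    (hconv : ConvexOn ℝ (Set.Ici 0) f) (hf₀ : f 0 = 0) (ha : 0 < a) (hfa : 0 < f a)
    (hm : 2 ^ a ≤ (m : ℝ)) (hmn : m ≤ n) (hlevel : level f m = level f n) :
    Real.log n - Real.log m ≤ a / f a := by
  have hm₀ : (0 : ℝ) < m := (Real.rpow_pos_of_pos two_pos a).trans_le hm
  have hn₀ : (0 : ℝ) < n := hm₀.trans_le (mod_cast hmn)
  have hlog : Real.log n - Real.log m ≤ Real.logb 2 n - Real.logb 2 m := by
    rw [← Real.log_div hn₀.ne' hm₀.ne', ← Real.logb_div hn₀.ne' hm₀.ne']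
    exact log_le_logb_two ((one_le_div hm₀).2 (mod_cast hmn))
  have hone : f (Real.logb 2 n) - f (Real.logb 2 m) ≤ 1 := by
    have hlower : (level f n : ℝ) ≤ f (Real.logb 2 m) := hlevel ▸ level_le hf hf₀ m
    have hupper : f (Real.logb 2 n) < level f n + 1 := Nat.lt_floor_add_one _
    linarith
  have hconvex := mul_sub_le_mul_sub_of_convexOn hconv hf₀ ha
    ((Real.le_logb_iff_rpow_le one_lt_two hm₀).2 hm) (monotone_logb_natCast hmn)
  refine hlog.trans ((le_div_iff₀' hfa).2 (hconvex.trans ?_))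
  exact mul_le_of_le_one_right ha.le hone

theorem le_two_rpow_add_one (hf : MonotoneOn f (Set.Ici 0)) (hexp : ∀ i : ℕ, f i ≤ 2 ^ i - 1)
    (hx : 0 ≤ x) : f x ≤ 2 ^ (x + 1) :=
  calc f x ≤ f ⌈x⌉₊ := hf hx (Nat.cast_nonneg (α := ℝ) _) (Nat.le_ceil x)
    _ ≤ 2 ^ (⌈x⌉₊ : ℝ) := by
      rw [Real.rpow_natCast]
      linarith [hexp ⌈x⌉₊]
    _ ≤ 2 ^ (x + 1) :=
      Real.rpow_le_rpow_of_exponent_le one_le_two (Nat.ceil_lt_add_one hx).le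

theorem one_div_le_of_two_rpow_le (hf : MonotoneOn f (Set.Ici 0))
    (hconv : ConvexOn ℝ (Set.Ici 0) f) (hf₀ : f 0 = 0) (hexp : ∀ i : ℕ, f i ≤ 2 ^ i - 1)
    (ha : 0 < a) (hfa : 0 < f a) (hm : 2 ^ a ≤ (m : ℝ)) : 1 / (m : ℝ) ≤ 2 * (a / f a) := by
  have hm₀ : (0 : ℝ) < m := (Real.rpow_pos_of_pos two_pos a).trans_le hm
  have hm₂ : 2 ≤ m := by
    have : (1 : ℝ) < m := (Real.one_lt_rpow one_lt_two ha).trans_le hm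
    exact_mod_cast this
  have hbound : f (Real.logb 2 m) ≤ 2 * m := by
    have := le_two_rpow_add_one hf hexp (logb_natCast_nonneg m)
    rwa [Real.rpow_add_one two_ne_zero, Real.rpow_logb two_pos (by norm_num) hm₀, mul_comm] at this
  have hfa_le : f a ≤ a * (2 * m) :=
    calc f a ≤ f a * Real.logb 2 m := le_mul_of_one_le_right hfa.le (one_le_logb_natCast hm₂)
      _ ≤ a * f (Real.logb 2 m) := mul_le_mul_of_convexOn hconv hf₀ ha
          ((Real.le_logb_iff_rpow_le one_lt_two hm₀).2 hm)
      _ ≤ a * (2 * m) := mul_le_mul_of_nonneg_left hbound ha.le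
  rw [← mul_div_assoc, div_le_div_iff₀ hm₀ hfa]
  linarith

theorem levelSum_le (hf : MonotoneOn f (Set.Ici 0)) (hconv : ConvexOn ℝ (Set.Ici 0) f)
    (hf₀ : f 0 = 0) (hexp : ∀ i : ℕ, f i ≤ 2 ^ i - 1) (ha : 0 < a) (hfa : 0 < f a) (k n : ℕ) :
    levelSum k (level f) ⌈(2 : ℝ) ^ a⌉₊ n ≤ 3 * (a / f a) := by
  unfold levelSum
  set S := (Finset.Icc 1 k).filter fun m => ⌈(2 : ℝ) ^ a⌉₊ ≤ m ∧ level f m = n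
  rcases S.eq_empty_or_nonempty with hempty | hne
  · rw [hempty, Finset.sum_empty]
    positivity
  obtain ⟨hmin, hmin_level⟩ := (Finset.mem_filter.1 (S.min'_mem hne)).2
  have hmax_level := (Finset.mem_filter.1 (S.max'_mem hne)).2.2
  have hpos : 0 < S.min' hne := (Finset.mem_Icc.1 (Finset.mem_filter.1 (S.min'_mem hne)).1).1
  have hle : S.min' hne ≤ S.max' hne := S.min'_le _ (S.max'_mem hne)
  calc ∑ m ∈ S, (1 / m : ℝ)
      ≤ ∑ m ∈ insert (S.min' hne) (Finset.Ioc (S.min' hne) (S.max' hne)), (1 / m : ℝ) := by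
        rw [Finset.Ioc_insert_left hle]
        exact Finset.sum_le_sum_of_subset_of_nonneg
          (fun m hm => Finset.mem_Icc.2 ⟨S.min'_le _ hm, S.le_max' _ hm⟩) fun _ _ _ => by positivity
    _ ≤ 1 / (S.min' hne : ℝ) + (Real.log (S.max' hne) - Real.log (S.min' hne)) := by
        rw [Finset.sum_insert Finset.left_notMem_Ioc]
        exact add_le_add_right (sum_one_div_Ioc_le hpos hle) _
    _ ≤ 2 * (a / f a) + a / f a :=
        add_le_add (one_div_le_of_two_rpow_le hf hconv hf₀ hexp ha hfa (Nat.ceil_le.1 hmin))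
          (log_sub_log_le_of_level_eq hf hconv hf₀ ha hfa (Nat.ceil_le.1 hmin) hle
            (hmin_level.trans hmax_level.symm))
    _ = 3 * (a / f a) := by ring

theorem continuousWithinAt_zero_of_convexOn (hf : MonotoneOn f (Set.Ici 0))
    (hconv : ConvexOn ℝ (Set.Ici 0) f) (hf₀ : f 0 = 0) : ContinuousWithinAt f (Set.Ici 0) 0 := by
  have hlin : ContinuousWithinAt (fun x : ℝ => x * f 1) (Set.Ici 0) 0 := by fun_prop
  rw [ContinuousWithinAt, zero_mul] at hlin
  rw [ContinuousWithinAt, hf₀]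
  refine tendsto_of_tendsto_of_tendsto_of_le_of_le' tendsto_const_nhds hlin ?_ ?_
  · filter_upwards [self_mem_nhdsWithin] with x hx using nonneg_of_monotoneOn hf hf₀ hx
  · filter_upwards [self_mem_nhdsWithin, mem_nhdsWithin_of_mem_nhds (Iio_mem_nhds one_pos)]
      with x hx hlt
    rcases (Set.mem_Ici.1 hx).eq_or_lt with rfl | hpos
    · rw [hf₀, zero_mul]
    · exact (mul_one (f x)).symm.trans_le (mul_le_mul_of_convexOn hconv hf₀ hpos (le_of_lt hlt))

theorem continuousOn_of_convexOn (hf : MonotoneOn f (Set.Ici 0))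
    (hconv : ConvexOn ℝ (Set.Ici 0) f) (hf₀ : f 0 = 0) : ContinuousOn f (Set.Ici 0) := by
  intro x hx
  rcases (Set.mem_Ici.1 hx).eq_or_lt with rfl | hpos
  · exact continuousWithinAt_zero_of_convexOn hf hconv hf₀
  · have hinterior := hconv.continuousOn_interior
    rw [interior_Ici] at hinterior
    exact (hinterior.continuousAt (Ioi_mem_nhds hpos)).continuousWithinAt

theorem surjOn_of_convexOn (hf : StrictMonoOn f (Set.Ici 0)) (hconv : ConvexOn ℝ (Set.Ici 0) f)
    (hf₀ : f 0 = 0) : Set.SurjOn f (Set.Ici 0) (Set.Ici 0) := by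
  intro y hy
  have hf₁ : 0 < f 1 := hf₀.symm.trans_lt (hf Set.self_mem_Ici (Set.mem_Ici.2 zero_le_one) one_pos)
  set b := max 1 (y / f 1)
  have hb : 1 ≤ b := le_max_left _ _
  have hyb : y ≤ f b :=
    calc y ≤ f 1 * b := (div_le_iff₀' hf₁).1 (le_max_right _ _)
      _ ≤ f b := (mul_le_mul_of_convexOn hconv hf₀ one_pos hb).trans_eq (one_mul _)
  obtain ⟨a, ha, hfa⟩ := intermediate_value_Icc (zero_le_one.trans hb)
    ((continuousOn_of_convexOn hf.monotoneOn hconv hf₀).mono Set.Icc_subset_Ici_self)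
    (show y ∈ Set.Icc (f 0) (f b) from ⟨hf₀.trans_le hy, hyb⟩)
  exact ⟨a, ha.1, hfa⟩

end Levels

section Guarantees

variable {Page : Type u} [DecidableEq Page]

namespace Scenario

variable {X : Scenario Page} {f : ℝ → ℝ} {a : ℝ} {m : Memory Page} {c : Config Page}

theorem Inv.counts_le_of_level (h : X.Inv X.T m c) (hX : X.level = Caching.level f)
    (hf : MonotoneOn f (Set.Ici 0)) (hf₀ : f 0 = 0) :
    (c.queries : ℝ) ≤ 234 * (1 + f (Real.logb 2 X.k)) * X.opt ∧
      (c.indices : ℝ) ≤ 234 * (1 + f (Real.logb 2 X.k)) * X.opt := by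
  have hlevel : (X.level X.k : ℝ) ≤ f (Real.logb 2 X.k) := hX ▸ level_le hf hf₀ X.k
  have hbound : 5 * (1 + X.level X.k) * X.opt ≤ 234 * (1 + f (Real.logb 2 X.k)) * X.opt := by
    gcongr
    norm_num
  exact h.counts_le.imp hbound.trans' hbound.trans'

theorem expect_cost_le_logb (hk : 2 ≤ X.k) :
    expect X.outcome Config.cost ≤ ENNReal.ofReal (234 * Real.logb 2 X.k * X.opt) := by
  have hcost := expect_cost_le (X := X) (μ := X.k + 1) fun n => (levelSum_succ_self _ _ n).le
  rw [mul_zero, ENNReal.ofReal_zero, zero_mul, add_zero] at hcost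
  refine hcost.trans (ENNReal.ofReal_le_ofReal
    (mul_le_mul_of_nonneg_right ?_ (Nat.cast_nonneg _)))
  have hlog : Real.log X.k ≤ Real.logb 2 X.k := log_le_logb_two (mod_cast X.k_pos)
  linarith [lowSum_le X.k (X.k + 1), one_le_logb_natCast hk]

theorem expect_cost_le_of_level (hX : X.level = Caching.level f) (hf : MonotoneOn f (Set.Ici 0))
    (hconv : ConvexOn ℝ (Set.Ici 0) f) (hf₀ : f 0 = 0) (hexp : ∀ i : ℕ, f i ≤ 2 ^ i - 1)
    (ha : 0 < a) (hfa : 0 < f a) : expect X.outcome Config.cost ≤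
      ENNReal.ofReal ((99 + 18 * a) * X.opt) +
        ENNReal.ofReal (216 * (a / f a)) * expect X.outcome (receivedError X.pred X.B) := by
  refine (expect_cost_le fun n => hX ▸ levelSum_le hf hconv hf₀ hexp ha hfa X.k n).trans ?_
  rw [← mul_assoc, show (72 : ℝ) * 3 = 216 by norm_num]
  refine add_le_add_left (ENNReal.ofReal_le_ofReal ?_) _
  exact mul_le_mul_of_nonneg_right (by linarith [lowSum_ceil_le ha.le X.k]) (Nat.cast_nonneg _)

theorem expect_cost_le_of_expect_receivedError_le (hX : X.level = Caching.level f)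
    (hf : MonotoneOn f (Set.Ici 0)) (hconv : ConvexOn ℝ (Set.Ici 0) f) (hf₀ : f 0 = 0)
    (hexp : ∀ i : ℕ, f i ≤ 2 ^ i - 1) (hk : 2 ≤ X.k) {η : ℝ≥0}
    (hη : expect X.outcome (receivedError X.pred X.B) ≤ η) (ha : 0 ≤ a) (hfa : f a = η / X.opt) :
    expect X.outcome Config.cost ≤ ENNReal.ofReal (234 * (1 + a) * X.opt) := by
  rcases X.opt.eq_zero_or_pos with hopt | hopt
  · exact (expect_cost_le_logb hk).trans_eq (by rw [hopt, Nat.cast_zero, mul_zero, mul_zero])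
  have hopt' : (0 : ℝ) < X.opt := mod_cast hopt
  rcases eq_or_ne η 0 with rfl | hη₀
  · refine (expect_cost_le_of_exact (nonpos_iff_eq_zero.1 hη)).trans ?_
    rw [← ENNReal.ofReal_natCast]
    exact ENNReal.ofReal_le_ofReal (le_mul_of_one_le_left hopt'.le (by linarith))
  have hη' : (0 : ℝ) < η := mod_cast pos_iff_ne_zero.2 hη₀
  have hfa_pos : 0 < f a := hfa ▸ div_pos hη' hopt'
  have ha_pos : 0 < a := ha.lt_of_ne fun h => hfa_pos.ne' (h ▸ hf₀)
  have hratio : a / f a * η = a * X.opt := by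
    rw [hfa]
    field_simp
  calc expect X.outcome Config.cost
      ≤ ENNReal.ofReal ((99 + 18 * a) * X.opt) + ENNReal.ofReal (216 * (a / f a)) * η :=
        (expect_cost_le_of_level hX hf hconv hf₀ hexp ha_pos hfa_pos).trans (by gcongr)
    _ = ENNReal.ofReal ((99 + 18 * a) * X.opt + 216 * (a / f a) * η) := by
        rw [ENNReal.ofReal_add (by positivity) (by positivity),
          ENNReal.ofReal_mul' (NNReal.coe_nonneg η), ENNReal.ofReal_coe_nnreal]
    _ ≤ ENNReal.ofReal (234 * (1 + a) * X.opt) := by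
        refine ENNReal.ofReal_le_ofReal ?_
        rw [mul_assoc, hratio]
        linarith

end Scenario

end Guarantees

end Caching

theorem theorem1 :
    ∃ C : ℝ, ∀ k : ℕ, 2 ≤ k → ∀ f : ℝ → ℝ,
      StrictMonoOn f (Set.Ici 0) → ConvexOn ℝ (Set.Ici 0) f → f 0 = 0 →
      (∀ i : ℕ, f i ≤ 2 ^ i - 1) →
      ∀ (Page : Type u) [DecidableEq Page], ∃ alg : Caching.OnlineAlgorithm Page,
        ∀ (A₀ : Finset Page), A₀.card = k →
        ∀ (r : ℕ → Page) (T : ℕ) (B : ℕ → Finset Page), Caching.IsBeladyRun r T A₀ B →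
        ∀ pred : Caching.Predictor Page k,
          -- every request is served, and the numbers of queries and of reported pages are bounded
          (∀ c ∈ (alg.outcome pred A₀ r T).support,
            c.unserved = 0 ∧
            (c.queries : ℝ) ≤ C * (1 + f (Real.logb 2 k)) * Caching.faults r T B ∧
            (c.indices : ℝ) ≤ C * (1 + f (Real.logb 2 k)) * Caching.faults r T B) ∧
          -- consistency
          (Caching.expect (alg.outcome pred A₀ r T) (Caching.receivedError pred B) = 0 →
            Caching.expect (alg.outcome pred A₀ r T) Caching.Config.cost
              ≤ Caching.faults r T B) ∧
          -- robustness
          Caching.expect (alg.outcome pred A₀ r T) Caching.Config.cost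
            ≤ ENNReal.ofReal (C * Real.logb 2 k * Caching.faults r T B) ∧
          -- smoothness
          (∀ η : ℝ≥0,
            Caching.expect (alg.outcome pred A₀ r T) (Caching.receivedError pred B) ≤ η →
            Caching.expect (alg.outcome pred A₀ r T) Caching.Config.cost
              ≤ ENNReal.ofReal
                  (C * (1 + Function.invFunOn f (Set.Ici 0) (η / Caching.faults r T B))
                    * Caching.faults r T B)) := by
  refine ⟨234, fun k hk f hf hconv hf₀ hexp Page _ =>
    ⟨Caching.follower Page k (Caching.level f), fun A₀ hA₀ r T B hB pred => ?_⟩⟩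
  let X : Caching.Scenario Page :=
    ⟨k, Caching.level f, r, T, A₀, B, pred, by lia, hA₀, hB, Caching.level_mono hf.monotoneOn⟩
  refine ⟨fun c hc => ?_, Caching.Scenario.expect_cost_le_of_exact (X := X),
    Caching.Scenario.expect_cost_le_logb (X := X) hk, fun η hη => ?_⟩
  · obtain ⟨m, hm⟩ := Caching.Scenario.exists_inv_of_mem_support_outcome (X := X) hc
    exact ⟨hm.served, hm.counts_le_of_level rfl hf.monotoneOn hf₀⟩
  · have hinv : (η : ℝ) / X.opt ∈ f '' Set.Ici 0 :=
      Caching.surjOn_of_convexOn hf hconv hf₀ (Set.mem_Ici.2 (by positivity))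
    exact Caching.Scenario.expect_cost_le_of_expect_receivedError_le (X := X) rfl hf.monotoneOn
      hconv hf₀ hexp hk hη (Function.invFunOn_mem hinv) (Function.invFunOn_eq hinv)
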